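/- Let $d$ be a dimension and $\mathbb{T}^d=\mathbb{R}^d/\mathbb{Z}^d$. Let $b:\mathbb{R}^d\times\mathbb{T}^d\to\mathbb{R}^d$ be measurable with $\nabla_x\cdot b=\nabla_y\cdot b=0$ (in the sense of distributions). Assume that the mean field $\bar b(x)=\int_{\mathbb{T}^d}b(x,y)\,dy$ is of class $C^1$ and that $b-\bar b\in L^\infty(\mathbb{R}^d\times\mathbb{T}^d;\mathbb{R}^d)$. Let $D:\mathbb{R}^d\times\mathbb{T}^d\to\mathbb{R}^{d\times d}$ be measurable and symmetric with $\lambda|\xi|^2\le \xi\cdot D(x,y)\xi\le\Lambda|\xi|^2$ for all $\xi\in\mathbb{R}^d$ and a.e. $(x,y)$, for some constants $\lambda,\Lambda>0$. Let $\Phi_\tau$, $\tau\in\mathbb{R}$, be the flow of $\dot X=\bar b(X)$, assumed to exist for all times, and let $J(\tau,x)$ be the Jacobian matrix of $\Phi_{-\tau}$ at $x$. Assume $|J(\tau,x)|\le C$ for all $\tau\in\mathbb{R}$, $x\in\mathbb{R}^d$, and put $\widetilde J(\tau,X)=J(\tau,\Phi_\tau(X))$. For a.e. $x$ and $1\le i\le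 d$ let $\omega_i(x,\cdot)\in H^1(\mathbb{T}^d)$, with zero mean, be the weak solution of the cell problem $$b(x,y)\cdot(\nabla_y\omega_i+e_i)-\nabla_y\cdot\big(D(x,y)(\nabla_y\omega_i+e_i)\big)=\bar b(x)\cdot e_i\quad\text{in }\mathbb{T}^d .$$ Writing $\widetilde f(\tau,X,y)=f(\Phi_\tau(X),y)$, put $$\mathfrak{B}_{ij}(\tau,X)=\int_{\mathbb{T}^d}\Big[\widetilde D(\nabla_y\widetilde\omega_j+e_j)\cdot(\nabla_y\widetilde\omega_i+e_i)+(\widetilde b\cdot\nabla_y\widetilde\omega_i)\,\widetilde\omega_j+\widetilde D\nabla_y\widetilde\omega_j\cdot e_i-\widetilde D\nabla_y\widetilde\omega_i\cdot e_j\Big]dy ,$$ $$\mathfrak{D}(X)=\lim_{\ell\to\infty}\frac1{2\ell}\int_{-\ell}^{\ell}\widetilde J(\tau,X)\,\mathfrak{B}(\tau,X)\,{}^{\top}\widetilde J(\tau,X)\,d\tau ,$$ and assume that this limit exists and is finite for a.e. $X\in\mathbb{R}^d$. Then $\mathfrak{D}$ is measurable, essentially bounded and uniformly positive definite (there is $c>0$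 with $\xi\cdot\mathfrak{D}(X)\xi\ge c|\xi|^2$ for all $\xi$ and a.e. $X$), and for every $T>0$ and every $u^{in}\in L^2(\mathbb{R}^d)$ the homogenized problem $$\partial_t u_0=\nabla_X\cdot\big(\mathfrak{D}(X)\nabla_X u_0\big)\ \text{ in }(0,T)\times\mathbb{R}^d,\qquad u_0(0,\cdot)=u^{in},$$ has exactly one solution with $u_0\in C([0,T];L^2(\mathbb{R}^d))$ and $\nabla_X u_0\in [L^2((0,T)\times\mathbb{R}^d)]^d$, the equation being understood in the weak sense $$-\int_0^T\!\!\int_{\mathbb{R}^d} u_0\,\partial_t\psi\,dX\,dt+\int_0^T\!\!\int_{\mathbb{R}^d}\mathfrak{D}\nabla_X u_0\cdot\nabla_X\psi\,dX\,dt-\int_{\mathbb{R}^d}u^{in}\psi(0,\cdot)\,dX=0\qquad\forall\,\psi\in C_c^\infty([0,T)\times\mathbb{R}^d).$$ -/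

import Mathlib

open MeasureTheory Filter Topology
open scoped ContDiff Matrix

noncomputable section

namespace MeanFlow

/-- Euclidean space `ℝ^d`. -/
abbrev Sp (d : ℕ) : Type := EuclideanSpace ℝ (Fin d)

/-- The unit torus `𝕋^d = ℝ^d / ℤ^d`, with its normalised Haar measure `volume`. -/
abbrev Tor (d : ℕ) : Type := UnitAddTorus (Fin d)

/-- Real `d × d` matrices. -/
abbrev Mat (d : ℕ) : Type := Matrix (Fin d) (Fin d) ℝ

/-- The canonical basis vector `e_i` of `ℝ^d`. -/
def stdVec {d : ℕ} (i : Fin d) : Sp d := EuclideanSpace.single i 1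

/-! ### Calculus on the torus -/

/-- Smooth functions on the torus: the associated `ℤ^d`-periodic function on `ℝ^d` is smooth. -/
def IsTorusTest {d : ℕ} (φ : Tor d → ℝ) : Prop :=
  ContDiff ℝ ∞ (fun z : Fin d → ℝ => φ (fun i => (z i : UnitAddCircle)))

/-- The gradient of a smooth function on the torus, through its partial derivatives. -/
def torusGrad {d : ℕ} (φ : Tor d → ℝ) (y : Tor d) : Sp d :=
  WithLp.toLp 2 (fun i => deriv (fun s : ℝ => φ (y + Pi.single i (s : UnitAddCircle))) 0)

/-- `g` is the weak (distributional) gradient of `f` on the torus. -/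
def HasTorusWeakGrad {d : ℕ} (f : Tor d → ℝ) (g : Tor d → Sp d) : Prop :=
  ∀ φ : Tor d → ℝ, IsTorusTest φ → ∀ i : Fin d,
    ∫ y, f y * torusGrad φ y i = - ∫ y, g y i * φ y

/-! ### Weak derivatives on `ℝ^d` -/

/-- `g` is the weak (distributional) gradient of `f` on `ℝ^d`. -/
def HasWeakGrad {d : ℕ} (f : Sp d → ℝ) (g : Sp d → Sp d) : Prop :=
  ∀ φ : Sp d → ℝ, ContDiff ℝ ∞ φ → HasCompactSupport φ → ∀ i : Fin d,
    ∫ x, f x * fderiv ℝ φ x (stdVec i) = - ∫ x, g x i * φ x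

/-! ### The fluid field, its mean and the flow -/

/-- The mean field `b̄(x) = ∫_{𝕋^d} b(x,y) dy`. -/
def meanField {d : ℕ} (b : Sp d → Tor d → Sp d) (x : Sp d) : Sp d := ∫ y, b x y

/-- `∇_x · b(x,y) = 0` (distributionally in `x`, for a.e. `y`). -/
def DivFreeX {d : ℕ} (b : Sp d → Tor d → Sp d) : Prop :=
  ∀ᵐ y : Tor d, ∀ φ : Sp d → ℝ, ContDiff ℝ ∞ φ → HasCompactSupport φ →
    ∫ x, fderiv ℝ φ x (b x y) = 0

/-- `∇_y · b(x,y) = 0` (distributionally in `y`, for a.e. `x`). -/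
def DivFreeY {d : ℕ} (b : Sp d → Tor d → Sp d) : Prop :=
  ∀ᵐ x : Sp d, ∀ φ : Tor d → ℝ, IsTorusTest φ →
    ∫ y, inner ℝ (b x y) (torusGrad φ y) = 0

/-- `Φ τ x` is the (global) flow of the autonomous equation `Ẋ = v(X)`, `X(0) = x`. -/
def IsFlowOf {d : ℕ} (v : Sp d → Sp d) (Φ : ℝ → Sp d → Sp d) : Prop :=
  ∀ x, Φ 0 x = x ∧ ∀ τ, HasDerivAt (fun s => Φ s x) (v (Φ τ x)) τ

/-- `J(τ,x)`: the Jacobian matrix at `x` of the backward flow map `Φ_{-τ}`. -/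
def jacobian {d : ℕ} (Φ : ℝ → Sp d → Sp d) (τ : ℝ) (x : Sp d) : Mat d :=
  Matrix.of fun i j => fderiv ℝ (Φ (-τ)) x (stdVec j) i

/-- The flow representation `J̃(τ,X) = J(τ, Φ_τ(X))`. -/
def flowJacobian {d : ℕ} (Φ : ℝ → Sp d → Sp d) (τ : ℝ) (X : Sp d) : Mat d :=
  jacobian Φ τ (Φ τ X)

/-! ### Cell problems and the effective diffusion -/

/-- `w ∈ H¹(𝕋^d)`, with weak gradient `g` and zero mean, is a weak solution of the cell problem
`b·(∇w + e_i) - ∇·(D(∇w + e_i)) = (∫ b)·e_i` on the torus. Here `b` and `D` are functions of `y`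
only: the slow variable is frozen. -/
structure IsCellSolution {d : ℕ} (b : Tor d → Sp d) (D : Tor d → Mat d) (i : Fin d)
    (w : Tor d → ℝ) (g : Tor d → Sp d) : Prop where
  memLp : MemLp w 2
  memLp_grad : MemLp g 2
  weakGrad : HasTorusWeakGrad w g
  mean_zero : ∫ y, w y = 0
  equation : ∀ φ : Tor d → ℝ, IsTorusTest φ →
    (∫ y, inner ℝ (b y) (g y + stdVec i) * φ y)
      + (∫ y, inner ℝ ((D y).toEuclideanLin (g y + stdVec i)) (torusGrad φ y))
      = (∫ y, b y) i * ∫ y, φ y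

/-- The solution of the cell problem, together with its weak gradient (both determined up to
equality almost everywhere). -/
def cellPair {d : ℕ} (b : Tor d → Sp d) (D : Tor d → Mat d) (i : Fin d) :
    (Tor d → ℝ) × (Tor d → Sp d) :=
  Classical.epsilon fun p => IsCellSolution b D i p.1 p.2

/-- The cell solution `ω_i`. -/
def cellSol {d : ℕ} (b : Tor d → Sp d) (D : Tor d → Mat d) (i : Fin d) : Tor d → ℝ :=
  (cellPair b D i).1

/-- The gradient `∇_y ω_i` of the cell solution. -/
def cellGrad {d : ℕ} (b : Tor d → Sp d) (D : Tor d → Mat d) (i : Fin d) : Tor d → Sp d :=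
  (cellPair b D i).2

/-- The matrix with entries
`∫ D(∇ω_j + e_j)·(∇ω_i + e_i) + ∫ (b·∇ω_i) ω_j + ∫ D∇ω_j·e_i - ∫ D∇ω_i·e_j`. -/
def cellMatrix {d : ℕ} (b : Tor d → Sp d) (D : Tor d → Mat d) : Mat d :=
  Matrix.of fun i j =>
    (∫ y, inner ℝ ((D y).toEuclideanLin (cellGrad b D j y + stdVec j))
        (cellGrad b D i y + stdVec i))
    + (∫ y, inner ℝ (b y) (cellGrad b D i y) * cellSol b D j y)
    + (∫ y, inner ℝ ((D y).toEuclideanLin (cellGrad b D j y)) (stdVec i))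
    - (∫ y, inner ℝ ((D y).toEuclideanLin (cellGrad b D i y)) (stdVec j))

/-- The matrix `𝔅(τ,X)`: all coefficients and cell solutions in their flow representation, i.e.
with the slow variable `x = Φ_τ(X)`. -/
def flowCellMatrix {d : ℕ} (b : Sp d → Tor d → Sp d) (D : Sp d → Tor d → Mat d)
    (Φ : ℝ → Sp d → Sp d) (τ : ℝ) (X : Sp d) : Mat d :=
  cellMatrix (b (Φ τ X)) (D (Φ τ X))

/-- The entries of `(1/2ℓ) ∫_{-ℓ}^{ℓ} J̃(τ,X) 𝔅(τ,X) J̃(τ,X)ᵀ dτ`. -/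
def fastTimeAverage {d : ℕ} (b : Sp d → Tor d → Sp d) (D : Sp d → Tor d → Mat d)
    (Φ : ℝ → Sp d → Sp d) (X : Sp d) (i j : Fin d) (ℓ : ℝ) : ℝ :=
  1 / (2 * ℓ) * ∫ τ in (-ℓ)..ℓ,
    (flowJacobian Φ τ X * flowCellMatrix b D Φ τ X * (flowJacobian Φ τ X)ᵀ) i j

/-- The effective diffusion matrix `𝔇(X)`, the limit of the averages as `ℓ → ∞`. -/
def effectiveDiffusion {d : ℕ} (b : Sp d → Tor d → Sp d) (D : Sp d → Tor d → Mat d)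
    (Φ : ℝ → Sp d → Sp d) (X : Sp d) : Mat d :=
  Matrix.of fun i j => limUnder atTop (fastTimeAverage b D Φ X i j)

/-! ### The homogenized equation -/

/-- A matrix field is measurable, essentially bounded and uniformly positive definite. -/
def IsBoundedCoercive {d : ℕ} (A : Sp d → Mat d) : Prop :=
  (∀ i j, AEMeasurable (fun X => A X i j)) ∧
  ∃ c C : ℝ, 0 < c ∧ ∀ᵐ X, ∀ ξ : Sp d,
    c * ‖ξ‖ ^ 2 ≤ inner ℝ ξ ((A X).toEuclideanLin ξ) ∧ ‖(A X).toEuclideanLin ξ‖ ≤ C * ‖ξ‖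

/-- The value at time `t ∈ [0,T]` of a path in `C([0,T]; L²(ℝ^d))` (constant extension to the other
times, which play no role). -/
def atTime {d : ℕ} {T : ℝ} (hT : 0 < T)
    (u : C(Set.Icc (0 : ℝ) T, Lp ℝ 2 (volume : Measure (Sp d)))) (t : ℝ) :
    Lp ℝ 2 (volume : Measure (Sp d)) :=
  u (Set.projIcc 0 T hT.le t)

/-- `u ∈ C([0,T]; L²(ℝ^d))` with `∇u = G ∈ L²((0,T) × ℝ^d)` is a weak solution of the Cauchy
problem `∂_t u = ∇·(A ∇u)` on `(0,T) × ℝ^d`, `u(0) = uin`. The test functions `ψ` are smooth with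
compact support in `[0,T) × ℝ^d` (as restrictions of functions on `ℝ × ℝ^d`). -/
def IsSolution {d : ℕ} (A : Sp d → Mat d) {T : ℝ} (hT : 0 < T)
    (uin : Lp ℝ 2 (volume : Measure (Sp d)))
    (u : C(Set.Icc (0 : ℝ) T, Lp ℝ 2 (volume : Measure (Sp d)))) : Prop :=
  atTime hT u 0 = uin ∧
  ∃ G : ℝ → Sp d → Sp d,
    MemLp (fun p : ℝ × Sp d => G p.1 p.2) 2 ((volume.restrict (Set.Ioo 0 T)).prod volume) ∧
    (∀ᵐ t ∂(volume.restrict (Set.Ioo 0 T)), HasWeakGrad (atTime hT u t) (G t)) ∧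
    ∀ ψ : ℝ × Sp d → ℝ, ContDiff ℝ ∞ ψ → HasCompactSupport ψ →
      tsupport ψ ⊆ Set.Iio T ×ˢ Set.univ →
      - (∫ t in Set.Ioo 0 T, ∫ x, atTime hT u t x * fderiv ℝ ψ (t, x) (1, 0))
        + (∫ t in Set.Ioo 0 T, ∫ x, fderiv ℝ ψ (t, x) (0, (A x).toEuclideanLin (G t x)))
        - (∫ x, uin x * ψ (0, x)) = 0

end MeanFlow

end

noncomputable section

namespace MeanFlow

/-! ### Coercive problems on closed subspaces of a Hilbert space -/

section Hilbert

variable {H : Type*} [NormedAddCommGroup H] [InnerProductSpace ℝ H]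

/-! The matrix 𝔇 is a limit of averages of J̃ 𝔅 J̃ᵀ. Two-sided bounds for 𝔅 and J̃, uniform in τ,
therefore make 𝔇 bounded and coercive. Well-posedness is then the theory of parabolic equations with
bounded measurable, possibly nonsymmetric, coefficients.

Cell problems. Write b(x,·) = b̄(x) + β. Both summands are divergence free in y, so the drift is
skew on H¹(𝕋^d), and ellipticity with the Poincaré inequality makes the problem coercive on
zero-mean functions; Lax–Milgram solves it (`CellCoeff.exists_varSolution`). The mean b̄(x), which
may be unbounded in x, cancels from the source, so the solutions are bounded uniformly in x. In ξ·𝔅ξ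
the drift term vanishes and the last two terms cancel. What remains is ∫ D(∇ω_ξ+ξ)·(∇ω_ξ+ξ) with ω_ξ
= Σ ξ_i ω_i, which is at least λ|ξ|² because ∇ω_ξ has mean zero (`CellCoeff.cellMatrix_coercive`;
the upper bound is `CellCoeff.abs_cellMatrix_le`). Measurability in x follows from a contraction
iteration that converges to the solution (`aestronglyMeasurable_solution`).

Flow. J̃(τ,X) is inverse to J(-τ,X), and both obey the assumed bound, so congruence with J̃ keeps
coercivity with a constant independent of τ; averages and limits inherit it
(`isBoundedCoercive_average`). The maps Φ_τ are locally Lipschitz with locally Lipschitz inverses: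
they preserve null sets and are differentiable almost everywhere, which suffices for the chain rule.

Parabolic problem. The Dirichlet form of 𝔇 on H¹ satisfies a Gårding inequality relative to L².
Yosida approximations of its operator form Cauchy sequences both in C([0,T];L²) and in L²(0,T;H¹),
and their limit is the solution (`IsFormPair.exists_solution`). For uniqueness the equation is
integrated once in time: with U = ∫u one gets d/dt |U|² ≤ 0, so no duality pairing for ∂_t u is
needed (`IsFormPair.eq_zero_of_weak`).

Sobolev functions are pairs (w, ∇w) in L². Smooth pairs are dense among them: a pair orthogonal to
all smooth ones solves Δw = w weakly, hence vanishes, by Fourier series on the torus and by a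
maximum principle on ℝ^d. -/

theorem exists_solution_of_coercive [CompleteSpace H] (V : Submodule ℝ H)
    (hV : IsClosed (V : Set H)) (T : H →L[ℝ] H) {α : ℝ} (hα : 0 < α)
    (hT : ∀ f ∈ V, α * ‖f‖ ^ 2 ≤ inner ℝ (T f) f) (k : H) :
    ∃ f ∈ V, ∀ h ∈ V, inner ℝ (T f) h = inner ℝ k h := by
  have : CompleteSpace V := hV.completeSpace_coe
  let B : V →L[ℝ] V →L[ℝ] ℝ := ((innerSL ℝ).comp T).bilinearComp V.subtypeL V.subtypeL
  have hB : ∀ v w : V, B v w = inner ℝ (T v) (w : H) := fun v w => rfl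
  have hc : IsCoercive B := ⟨α, hα, fun u => by
    rw [hB, mul_assoc, ← pow_two]; exact hT u u.2⟩
  let e := hc.continuousLinearEquivOfBilin
  refine ⟨e.symm (V.orthogonalProjectionOnto k), Subtype.mem _, fun h hh => ?_⟩
  have := hc.continuousLinearEquivOfBilin_apply (e.symm (V.orthogonalProjectionOnto k)) ⟨h, hh⟩
  rw [hB] at this
  rw [← this]
  change inner ℝ (e (e.symm _)) _ = _
  rw [e.apply_symm_apply]
  exact Submodule.inner_orthogonalProjectionOnto_eq_of_mem_right (K := V) ⟨h, hh⟩ k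

theorem unique_solution_of_coercive {V : Submodule ℝ H} {T : H →L[ℝ] H} {α : ℝ} (hα : 0 < α)
    (hT : ∀ f ∈ V, α * ‖f‖ ^ 2 ≤ inner ℝ (T f) f) {k f f' : H} (hf : f ∈ V) (hf' : f' ∈ V)
    (h : ∀ h ∈ V, inner ℝ (T f) h = inner ℝ k h) (h' : ∀ h ∈ V, inner ℝ (T f') h = inner ℝ k h) :
    f = f' := by
  have hd : f - f' ∈ V := V.sub_mem hf hf'
  have h0 : inner ℝ (T (f - f')) (f - f') = 0 := by
    rw [map_sub, inner_sub_left, h _ hd, h' _ hd, sub_self]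
  have h1 := hT _ hd
  rw [h0] at h1
  have : ‖f - f'‖ ^ 2 = 0 := le_antisymm (by nlinarith) (sq_nonneg _)
  exact sub_eq_zero.1 (norm_eq_zero.1 (pow_eq_zero_iff two_ne_zero |>.1 this))

/-- Distinct orthonormal vectors are at distance √2, so balls of radius 1/2 around them are disjoint
open sets. Countability of a basis is what lets measurability pass through basis expansions. -/
theorem _root_.Orthonormal.countable_of_secondCountable [SecondCountableTopology H] {ι : Type*}
    {v : ι → H} (hv : Orthonormal ℝ v) : Countable ι := by
  have hd : Pairwise (Function.onFun Disjoint fun i => Metric.ball (v i) (1 / 2)) := by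
    intro i j hij
    apply Metric.ball_disjoint_ball
    have h2 : ‖v i - v j‖ ^ 2 = 2 := by
      rw [norm_sub_sq_real, hv.1 i, hv.1 j, hv.2 hij]; norm_num
    rw [dist_eq_norm]
    nlinarith [norm_nonneg (v i - v j)]
  exact (Pairwise.countable_of_isOpen_disjoint hd (fun i => Metric.isOpen_ball)
    (fun i => ⟨v i, Metric.mem_ball_self (by norm_num)⟩))

/-- Pettis' theorem in a separable Hilbert space: the finite partial sums of the expansion in a
countable Hilbert basis are measurable and converge pointwise. -/
theorem stronglyMeasurable_of_inner [CompleteSpace H] [SecondCountableTopology H] {Ω : Type*}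
    [MeasurableSpace Ω] {f : Ω → H} (hf : ∀ h : H, Measurable fun z => inner ℝ h (f z)) :
    StronglyMeasurable f := by
  obtain ⟨w, b, hb⟩ := exists_hilbertBasis ℝ H
  have : Countable w := b.orthonormal.countable_of_secondCountable
  refine stronglyMeasurable_of_tendsto (u := atTop)
    (f := fun (s : Finset w) z => ∑ i ∈ s, b.repr (f z) i • b i) (fun s => ?_) ?_
  · refine Finset.stronglyMeasurable_fun_sum _ fun i _ => ?_
    refine StronglyMeasurable.smul_const ?_ _
    simp_rw [b.repr_apply_apply]
    exact (hf _).stronglyMeasurable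
  · rw [tendsto_pi_nhds]
    exact fun z => b.hasSum_repr (f z)

/-- Expanding the square bounds the factor by 1 - 2sα + s²K² for a step s; the choice s = α/K²
minimises it. -/
theorem contraction_of_coercive {T : H →L[ℝ] H} {α K : ℝ} (hα : 0 < α) (hK : 0 < K)
    (hTK : ‖T‖ ≤ K) {f : H} (hf : α * ‖f‖ ^ 2 ≤ inner ℝ (T f) f) (P : H →L[ℝ] H)
    (hP : ‖P (T f)‖ ≤ ‖T f‖) (hPf : inner ℝ (P (T f)) f = inner ℝ (T f) f) :
    ‖f - (α / K ^ 2) • P (T f)‖ ^ 2 ≤ (1 - α ^ 2 / K ^ 2) * ‖f‖ ^ 2 := by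
  have h1 : ‖P (T f)‖ ≤ K * ‖f‖ :=
    hP.trans ((T.le_opNorm f).trans (by gcongr))
  have h2 : ‖P (T f)‖ ^ 2 ≤ K ^ 2 * ‖f‖ ^ 2 := by
    rw [← mul_pow]; gcongr
  rw [norm_sub_sq_real, norm_smul, inner_smul_right, real_inner_comm, hPf, mul_pow,
    Real.norm_eq_abs, sq_abs]
  have h3 : (α / K ^ 2) * (α * ‖f‖ ^ 2) ≤ (α / K ^ 2) * inner ℝ (T f) f := by gcongr
  have h4 : (α / K ^ 2) ^ 2 * ‖P (T f)‖ ^ 2 ≤ (α / K ^ 2) ^ 2 * (K ^ 2 * ‖f‖ ^ 2) := by gcongr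
  have h5 : (α / K ^ 2) ^ 2 * (K ^ 2 * ‖f‖ ^ 2) = (α / K ^ 2) * (α * ‖f‖ ^ 2) := by
    field_simp
  have h6 : (1 - α ^ 2 / K ^ 2) * ‖f‖ ^ 2 = ‖f‖ ^ 2 - (α / K ^ 2) * (α * ‖f‖ ^ 2) := by
    field_simp
  rw [h6]
  linarith

/-- The solution of a family of coercive problems depends measurably on the parameter. -/
theorem aestronglyMeasurable_solution [CompleteSpace H] [SecondCountableTopology H] {Ω : Type*}
    [MeasurableSpace Ω] {ν : Measure Ω} (V : Submodule ℝ H) (hV : IsClosed (V : Set H))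
    {T : Ω → H →L[ℝ] H} {k u : Ω → H} {K : Ω → ℝ} {α : ℝ} (hα : 0 < α)
    (hK : Measurable K) (hK0 : ∀ z, 0 < K z) (hTK : ∀ z, ‖T z‖ ≤ K z)
    (hTm : ∀ f, StronglyMeasurable fun z => T z f) (hk : StronglyMeasurable k)
    (hT : ∀ᵐ z ∂ν, ∀ f ∈ V, α * ‖f‖ ^ 2 ≤ inner ℝ (T z f) f)
    (hu : ∀ᵐ z ∂ν, u z ∈ V ∧ ∀ h ∈ V, inner ℝ (T z (u z)) h = inner ℝ (k z) h) :
    AEStronglyMeasurable u ν := by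
  borelize H
  have : CompleteSpace V := hV.completeSpace_coe
  let P : H →L[ℝ] H := V.starProjection
  -- Projected Richardson iteration started at 0. Each iterate is measurable in z, since (f, z) ↦ T
  -- z f is continuous in f and measurable in z; no measurable selection of solutions is needed.
  let s : ℕ → Ω → H := fun n => n.rec (fun _ => 0)
    (fun _ v z => v z - (α / K z ^ 2) • P (T z (v z) - k z))
  have hs : ∀ n, StronglyMeasurable (s n) := by
    intro n
    induction n with
    | zero => exact stronglyMeasurable_const
    | succ n ih =>
      have h1 : StronglyMeasurable fun z => T z (s n z) := by
        have := stronglyMeasurable_uncurry_of_continuous_of_stronglyMeasurable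
          (u := fun (f : H) z => T z f) (fun z => (T z).continuous) hTm
        exact this.comp_measurable (ih.measurable.prodMk measurable_id)
      have h2 : StronglyMeasurable fun z => α / K z ^ 2 :=
        (measurable_const.div (hK.pow_const 2)).stronglyMeasurable
      exact ih.sub (h2.smul (P.continuous.comp_stronglyMeasurable (h1.sub hk)))
  refine aestronglyMeasurable_of_tendsto_ae atTop (fun n => (hs n).aestronglyMeasurable) ?_
  filter_upwards [hT, hu] with z hT ⟨huV, hu⟩
  -- The equation for `u z` says exactly that k - T u is orthogonal to V, so the error s n - u obeys
  -- the homogeneous iteration.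
  have hPk : P (k z) = P (T z (u z)) := by
    have : k z - T z (u z) ∈ Vᗮ := by
      rw [Submodule.mem_orthogonal']
      intro h hh
      rw [inner_sub_left, hu h hh, sub_self]
    rw [← sub_eq_zero, ← map_sub]
    exact (Submodule.starProjection_apply_eq_zero_iff V).2 this
  have hPn : ∀ x, ‖P x‖ ≤ ‖x‖ := fun x => V.norm_starProjection_apply_le x
  have hPi : ∀ x, ∀ f ∈ V, inner ℝ (P x) f = inner ℝ x f := fun x f hf =>
    Submodule.inner_orthogonalProjectionOnto_eq_of_mem_right (K := V) ⟨f, hf⟩ x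
  have hsV : ∀ n, s n z ∈ V := by
    intro n
    induction n with
    | zero => exact V.zero_mem
    | succ n ih => exact V.sub_mem ih (V.smul_mem _ (Subtype.mem _))
  set q := 1 - α ^ 2 / K z ^ 2 with hq
  have hstep : ∀ n, ‖s (n + 1) z - u z‖ ^ 2 ≤ q * ‖s n z - u z‖ ^ 2 := by
    intro n
    have hf : s n z - u z ∈ V := V.sub_mem (hsV n) huV
    have e : s (n + 1) z - u z =
        (s n z - u z) - (α / K z ^ 2) • P (T z (s n z - u z)) := by
      change s n z - (α / K z ^ 2) • P (T z (s n z) - k z) - u z = _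
      rw [map_sub, hPk, map_sub, map_sub]
      abel
    rw [e]
    exact contraction_of_coercive hα (hK0 z) (hTK z) (hT _ hf) P (hPn _) (hPi _ _ hf)
  -- The maximum with 0 is needed because q may be negative: if V is trivial, nothing forces α ≤ K
  -- z.
  have hbound : ∀ n, ‖s n z - u z‖ ^ 2 ≤ (max q 0) ^ n * ‖s 0 z - u z‖ ^ 2 := by
    intro n
    induction n with
    | zero => simp
    | succ n ih =>
      calc _ ≤ q * ‖s n z - u z‖ ^ 2 := hstep n
        _ ≤ max q 0 * ‖s n z - u z‖ ^ 2 := by gcongr; exact le_max_left _ _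
        _ ≤ max q 0 * ((max q 0) ^ n * ‖s 0 z - u z‖ ^ 2) := by gcongr
        _ = _ := by ring
  have hq1 : max q 0 < 1 := by
    have := hK0 z
    have : 0 < α ^ 2 / K z ^ 2 := by positivity
    exact max_lt (by linarith) one_pos
  have hlim : Tendsto (fun n => ‖s n z - u z‖ ^ 2) atTop (𝓝 0) := by
    refine squeeze_zero (fun n => sq_nonneg _) hbound ?_
    simpa using (tendsto_pow_atTop_nhds_zero_of_lt_one (le_max_right _ _) hq1).mul_const
      (‖s 0 z - u z‖ ^ 2)
  rw [tendsto_iff_norm_sub_tendsto_zero]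
  have := hlim.sqrt
  simpa [Real.sqrt_sq] using this

end Hilbert

/-! ### Multiplication operators on `L²` -/

section MultOp

variable {X F : Type*} [MeasurableSpace X] [NormedAddCommGroup F] [InnerProductSpace ℝ F]
  {μ : Measure X}

theorem memLp_clm_apply {M : X → F →L[ℝ] F} {K : ℝ} (hM : AEStronglyMeasurable M μ)
    (hK : ∀ᵐ x ∂μ, ‖M x‖ ≤ K) (f : Lp F 2 μ) : MemLp (fun x => M x (f x)) 2 μ := by
  refine MemLp.of_le_mul (c := K) (Lp.memLp f) ?_ ?_
  · exact (ContinuousLinearMap.id ℝ (F →L[ℝ] F)).aestronglyMeasurable_comp₂ hM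
      (Lp.aestronglyMeasurable f)
  · filter_upwards [hK] with x hx
    exact ((M x).le_opNorm _).trans (by gcongr)

/-- Multiplication of square integrable functions by a bounded measurable field of operators. -/
def multOp (M : X → F →L[ℝ] F) (K : ℝ) (hM : AEStronglyMeasurable M μ)
    (hK : ∀ᵐ x ∂μ, ‖M x‖ ≤ K) : Lp F 2 μ →L[ℝ] Lp F 2 μ :=
  LinearMap.mkContinuous
    { toFun := fun f => (memLp_clm_apply hM hK f).toLp _
      map_add' := fun f g => by
        rw [← MemLp.toLp_add]
        apply MemLp.toLp_congr
        filter_upwards [Lp.coeFn_add f g] with x hx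
        rw [hx, Pi.add_apply, Pi.add_apply, map_add]
      map_smul' := fun c f => by
        rw [RingHom.id_apply, ← MemLp.toLp_const_smul]
        apply MemLp.toLp_congr
        filter_upwards [Lp.coeFn_smul c f] with x hx
        rw [hx, Pi.smul_apply, Pi.smul_apply, map_smul] }
    K (fun f => by
      refine Lp.norm_le_mul_norm_of_ae_le_mul ?_
      filter_upwards [hK, (memLp_clm_apply hM hK f).coeFn_toLp] with x hx h
      simp only [LinearMap.coe_mk, AddHom.coe_mk]
      rw [h]
      exact ((M x).le_opNorm _).trans (by gcongr))

theorem coeFn_multOp {M : X → F →L[ℝ] F} {K : ℝ} (hM : AEStronglyMeasurable M μ)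
    (hK : ∀ᵐ x ∂μ, ‖M x‖ ≤ K) (f : Lp F 2 μ) :
    multOp M K hM hK f =ᵐ[μ] fun x => M x (f x) :=
  (memLp_clm_apply hM hK f).coeFn_toLp

theorem norm_multOp_le {M : X → F →L[ℝ] F} {K : ℝ} (hM : AEStronglyMeasurable M μ)
    (hK : ∀ᵐ x ∂μ, ‖M x‖ ≤ K) (hK0 : 0 ≤ K) : ‖multOp M K hM hK‖ ≤ K :=
  LinearMap.mkContinuous_norm_le _ hK0 _

theorem inner_multOp {M : X → F →L[ℝ] F} {K : ℝ} (hM : AEStronglyMeasurable M μ)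
    (hK : ∀ᵐ x ∂μ, ‖M x‖ ≤ K) (f h : Lp F 2 μ) :
    inner ℝ (multOp M K hM hK f) h = ∫ x, inner ℝ (M x (f x)) (h x) ∂μ := by
  rw [L2.inner_def]
  apply integral_congr_ae
  filter_upwards [coeFn_multOp hM hK f] with x hx
  rw [hx]

end MultOp

end MeanFlow
end

noncomputable section

namespace MeanFlow

/-! ### Square integrable pairs of a function and a vector field -/

/-- Values of pairs `(w, ∇w)`. -/
abbrev Jet (d : ℕ) : Type := WithLp 2 (ℝ × Sp d)

section Jet

variable {d : ℕ}

/-- The pair of a function and a vector field. -/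
def jet {X : Type*} (p : X → ℝ) (q : X → Sp d) (x : X) : Jet d := WithLp.toLp 2 (p x, q x)

@[simp] theorem jet_fst {X : Type*} (p : X → ℝ) (q : X → Sp d) (x : X) :
    (jet p q x).fst = p x := rfl

@[simp] theorem jet_snd {X : Type*} (p : X → ℝ) (q : X → Sp d) (x : X) :
    (jet p q x).snd = q x := rfl

variable {X : Type*} [MeasurableSpace X] {μ : Measure X}

theorem jet_inner (a b : Jet d) :
    inner ℝ a b = a.fst * b.fst + inner ℝ a.snd b.snd := by
  rw [WithLp.prod_inner_apply]
  congr 1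
  exact mul_comm _ _

theorem jet_norm_sq (a : Jet d) : ‖a‖ ^ 2 = a.fst ^ 2 + ‖a.snd‖ ^ 2 := by
  rw [WithLp.prod_norm_sq_eq_of_L2, Real.norm_eq_abs, sq_abs]

theorem aestronglyMeasurable_jet {p : X → ℝ} {q : X → Sp d} (hp : AEStronglyMeasurable p μ)
    (hq : AEStronglyMeasurable q μ) : AEStronglyMeasurable (jet p q) μ :=
  (WithLp.prod_continuous_toLp 2 ℝ (Sp d)).comp_aestronglyMeasurable (hp.prodMk hq)

theorem memLp_jet {p : X → ℝ} {q : X → Sp d} (hp : MemLp p 2 μ) (hq : MemLp q 2 μ) :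
    MemLp (jet p q) 2 μ := by
  refine MemLp.of_le (g := fun x => ‖p x‖ + ‖q x‖) (hp.norm.add hq.norm)
    (aestronglyMeasurable_jet hp.1 hq.1) (ae_of_all _ fun x => ?_)
  have h := jet_norm_sq (jet p q x)
  rw [jet_fst, jet_snd] at h
  rw [Real.norm_eq_abs, abs_of_nonneg (by positivity)]
  refine le_of_sq_le_sq ?_ (by positivity)
  rw [h, Real.norm_eq_abs, add_sq, sq_abs]
  have : 0 ≤ 2 * |p x| * ‖q x‖ := by positivity
  linarith

theorem memLp_fst (f : Lp (Jet d) 2 μ) : MemLp (fun x => (f x).fst) 2 μ :=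
  MemLp.of_le (Lp.memLp f)
    ((WithLp.fstL 2 ℝ ℝ (Sp d)).continuous.comp_aestronglyMeasurable (Lp.aestronglyMeasurable f))
    (ae_of_all _ fun x => WithLp.norm_fst_le (p := 2) (α := ℝ) (β := Sp d) (f x))

theorem memLp_snd (f : Lp (Jet d) 2 μ) : MemLp (fun x => (f x).snd) 2 μ :=
  MemLp.of_le (Lp.memLp f)
    ((WithLp.sndL 2 ℝ ℝ (Sp d)).continuous.comp_aestronglyMeasurable (Lp.aestronglyMeasurable f))
    (ae_of_all _ fun x => WithLp.norm_snd_le (p := 2) (α := ℝ) (β := Sp d) (f x))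

theorem memLp_coord {g : X → Sp d} (hg : MemLp g 2 μ) (i : Fin d) : MemLp (fun x => g x i) 2 μ :=
  MemLp.of_le hg ((EuclideanSpace.proj (𝕜 := ℝ) i).continuous.comp_aestronglyMeasurable hg.1)
    (ae_of_all _ fun x => PiLp.norm_apply_le (g x) i)

theorem integrable_mul_of_memLp {p q : X → ℝ} (hp : MemLp p 2 μ) (hq : MemLp q 2 μ) :
    Integrable (fun x => p x * q x) μ := hp.integrable_mul hq

theorem integrable_inner_of_memLp {F : Type*} [NormedAddCommGroup F] [InnerProductSpace ℝ F]
    {p q : X → F} (hp : MemLp p 2 μ) (hq : MemLp q 2 μ) :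
    Integrable (fun x => inner ℝ (p x) (q x)) μ := by
  refine (L2.integrable_inner (𝕜 := ℝ) (hp.toLp p) (hq.toLp q)).congr ?_
  filter_upwards [hp.coeFn_toLp, hq.coeFn_toLp] with x h1 h2
  rw [h1, h2]

theorem inner_eq_integral (f h : Lp (Jet d) 2 μ) :
    inner ℝ f h = (∫ x, (f x).fst * (h x).fst ∂μ) + ∫ x, inner ℝ (f x).snd (h x).snd ∂μ := by
  rw [L2.inner_def, ← integral_add (integrable_mul_of_memLp (memLp_fst f) (memLp_fst h))
    (integrable_inner_of_memLp (memLp_snd f) (memLp_snd h))]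
  exact integral_congr_ae (ae_of_all _ fun x => jet_inner _ _)

theorem norm_sq_eq_integral (f : Lp (Jet d) 2 μ) :
    ‖f‖ ^ 2 = (∫ x, (f x).fst ^ 2 ∂μ) + ∫ x, ‖(f x).snd‖ ^ 2 ∂μ := by
  rw [← real_inner_self_eq_norm_sq, inner_eq_integral]
  simp_rw [real_inner_self_eq_norm_sq, pow_two]

theorem fst_toLp_jet {p : X → ℝ} {q : X → Sp d} (h : MemLp (jet p q) 2 μ) :
    (fun x => ((h.toLp _ : Lp (Jet d) 2 μ) x).fst) =ᵐ[μ] p := by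
  filter_upwards [h.coeFn_toLp] with x hx
  rw [hx, jet_fst]

theorem snd_toLp_jet {p : X → ℝ} {q : X → Sp d} (h : MemLp (jet p q) 2 μ) :
    (fun x => ((h.toLp _ : Lp (Jet d) 2 μ) x).snd) =ᵐ[μ] q := by
  filter_upwards [h.coeFn_toLp] with x hx
  rw [hx, jet_snd]

theorem inner_toLp_jet {p : X → ℝ} {q : X → Sp d} (h : MemLp (jet p q) 2 μ)
    (f : Lp (Jet d) 2 μ) :
    inner ℝ f (h.toLp _) = (∫ x, (f x).fst * p x ∂μ) + ∫ x, inner ℝ (f x).snd (q x) ∂μ := by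
  rw [inner_eq_integral]
  congr 1 <;> apply integral_congr_ae
  · filter_upwards [fst_toLp_jet h] with x hx
    rw [hx]
  · filter_upwards [snd_toLp_jet h] with x hx
    rw [hx]

theorem inner_stdVec (v : Sp d) (i : Fin d) : inner ℝ v (stdVec i) = v i := by
  simp [stdVec, EuclideanSpace.inner_single_right]

theorem norm_stdVec (i : Fin d) : ‖(stdVec i : Sp d)‖ = 1 := by
  simp [stdVec]

/-! ### Spaces of functions with a weak gradient -/

/-- The closed space of all square integrable pairs `(w, g)` such that `g` is the weak gradient of
`w`, with respect to a set `𝒯` of test functions and their gradients. -/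
def weakGradSpace (μ : Measure X) (𝒯 : Set ((X → ℝ) × (X → Sp d))) :
    Submodule ℝ (Lp (Jet d) 2 μ) :=
  (Submodule.span ℝ {h | ∃ t ∈ 𝒯, ∃ i : Fin d,
    h =ᵐ[μ] jet (fun x => t.2 x i) (fun x => t.1 x • stdVec i)})ᗮ

theorem isClosed_weakGradSpace (𝒯 : Set ((X → ℝ) × (X → Sp d))) :
    IsClosed (weakGradSpace μ 𝒯 : Set (Lp (Jet d) 2 μ)) :=
  Submodule.isClosed_orthogonal _

/-- Orthogonality to the jets (∂_iφ, φ e_i) is the integration by parts identity. Defining the space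
as an orthogonal complement makes its closedness immediate. -/
theorem mem_weakGradSpace {𝒯 : Set ((X → ℝ) × (X → Sp d))}
    (h𝒯 : ∀ t ∈ 𝒯, MemLp t.1 2 μ ∧ MemLp t.2 2 μ) {f : Lp (Jet d) 2 μ} :
    f ∈ weakGradSpace μ 𝒯 ↔ ∀ t ∈ 𝒯, ∀ i : Fin d,
      ∫ x, (f x).fst * t.2 x i ∂μ = - ∫ x, (f x).snd i * t.1 x ∂μ := by
  have key : ∀ t ∈ 𝒯, ∀ i : Fin d,
      MemLp (jet (fun x => t.2 x i) (fun x => t.1 x • (stdVec i : Sp d))) 2 μ := fun t ht i =>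
    memLp_jet (memLp_coord (h𝒯 t ht).2 i)
      (MemLp.of_le (h𝒯 t ht).1 ((h𝒯 t ht).1.1.smul_const _)
        (ae_of_all _ fun x => by rw [norm_smul, norm_stdVec, mul_one]))
  have inn : ∀ t (ht : t ∈ 𝒯) (i : Fin d), inner ℝ f ((key t ht i).toLp _) =
      (∫ x, (f x).fst * t.2 x i ∂μ) + ∫ x, (f x).snd i * t.1 x ∂μ := by
    intro t ht i
    rw [inner_toLp_jet]
    congr 1
    refine integral_congr_ae (ae_of_all _ fun x => ?_)
    simp only
    rw [inner_smul_right, inner_stdVec, mul_comm]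
  rw [weakGradSpace, Submodule.mem_orthogonal']
  constructor
  · intro h t ht i
    have := h ((key t ht i).toLp _) (Submodule.subset_span ⟨t, ht, i, (key t ht i).coeFn_toLp⟩)
    rw [inn t ht i] at this
    linarith
  · intro h u hu
    induction hu using Submodule.span_induction with
    | mem u hu =>
      obtain ⟨t, ht, i, hu⟩ := hu
      have e : u = (key t ht i).toLp _ := Lp.ext (hu.trans (key t ht i).coeFn_toLp.symm)
      rw [e, inn t ht i, h t ht i]
      ring
    | zero => exact inner_zero_right _
    | add a b _ _ ha hb => rw [inner_add_right, ha, hb, add_zero]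
    | smul c a _ ha => rw [inner_smul_right, ha, mul_zero]

end Jet

end MeanFlow
end

noncomputable section

namespace MeanFlow

/-! ### The torus: measure and test functions -/

section Torus

variable {d : ℕ}

/-- The circle has length 1, so the scaling factor between its volume and the Haar probability
measure is 1. The Fourier results are stated for the latter. -/
theorem volume_tor (d : ℕ) :
    (volume : Measure (Tor d)) = Measure.pi fun _ => AddCircle.haarAddCircle := by
  rw [volume_pi]
  simp [AddCircle.volume_eq_smul_haarAddCircle]

instance isProbabilityMeasure_tor (d : ℕ) : IsProbabilityMeasure (volume : Measure (Tor d)) := by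
  rw [volume_tor]; infer_instance

theorem hasSum_sq_mFourierCoeff {w : Tor d → ℂ} (hw : MemLp w 2) :
    HasSum (fun k : Fin d → ℤ => ‖∫ y, UnitAddTorus.mFourier (-k) y • w y‖ ^ 2)
      (∫ y, ‖w y‖ ^ 2) := by
  rw [volume_tor] at hw ⊢
  have := @UnitAddTorus.hasSum_sq_mFourierCoeff (Fin d) _ (hw.toLp w)
  convert this using 1
  · ext k
    congr 2
    apply integral_congr_ae
    filter_upwards [hw.coeFn_toLp] with x hx
    rw [hx]
  · apply integral_congr_ae
    filter_upwards [hw.coeFn_toLp] with x hx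
    rw [hx]

/-- The projection `ℝ^d → 𝕋^d`. -/
def torProj (z : Fin d → ℝ) : Tor d := fun i => (z i : UnitAddCircle)

theorem isOpenQuotientMap_torProj : IsOpenQuotientMap (torProj (d := d)) :=
  IsOpenQuotientMap.piMap (f := fun (_ : Fin d) (x : ℝ) => (x : UnitAddCircle))
    (fun _ => QuotientAddGroup.isOpenQuotientMap_mk)

theorem torProj_add_single (z : Fin d → ℝ) (i : Fin d) (s : ℝ) :
    torProj z + Pi.single i (s : UnitAddCircle) = torProj (z + Pi.single i s) := by
  ext j
  by_cases h : j = i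
  · subst h; simp [torProj]
  · simp [torProj, h]

theorem torusGrad_torProj {φ : Tor d → ℝ} (hφ : Differentiable ℝ (φ ∘ torProj)) (z : Fin d → ℝ)
    (i : Fin d) : torusGrad φ (torProj z) i = fderiv ℝ (φ ∘ torProj) z (Pi.single i 1) := by
  have h1 : HasDerivAt (fun s : ℝ => z + Pi.single i s) (Pi.single i (1 : ℝ)) 0 := by
    have : HasDerivAt (fun s : ℝ => s • (Pi.single i (1 : ℝ) : Fin d → ℝ))
        ((1 : ℝ) • (Pi.single i (1 : ℝ) : Fin d → ℝ)) 0 := (hasDerivAt_id 0).smul_const _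
    have h2 := this.const_add z
    rw [one_smul] at h2
    refine h2.congr_of_eventuallyEq (Eventually.of_forall fun s => ?_)
    simp only
    rw [← Pi.single_smul, smul_eq_mul, mul_one]
  have h2 : HasFDerivAt (φ ∘ torProj) (fderiv ℝ (φ ∘ torProj) z) (z + Pi.single i (0 : ℝ)) := by
    rw [Pi.single_zero, add_zero]; exact (hφ z).hasFDerivAt
  have h3 := h2.comp_hasDerivAt (0 : ℝ) h1
  change deriv (fun s : ℝ => φ (torProj z + Pi.single i (s : UnitAddCircle))) 0 = _
  simp_rw [torProj_add_single]
  exact h3.deriv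

theorem IsTorusTest.differentiable {φ : Tor d → ℝ} (hφ : IsTorusTest φ) :
    Differentiable ℝ (φ ∘ torProj) := ContDiff.differentiable hφ (by simp)

theorem IsTorusTest.continuous {φ : Tor d → ℝ} (hφ : IsTorusTest φ) : Continuous φ :=
  isOpenQuotientMap_torProj.isQuotientMap.continuous_iff.2 (ContDiff.continuous hφ)

theorem IsTorusTest.continuous_torusGrad {φ : Tor d → ℝ} (hφ : IsTorusTest φ) :
    Continuous (torusGrad φ) := by
  refine (PiLp.continuous_toLp 2 _).comp (continuous_pi fun i => ?_)
  refine isOpenQuotientMap_torProj.isQuotientMap.continuous_iff.2 ?_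
  have : (fun y => torusGrad φ y i) ∘ torProj
      = fun z => fderiv ℝ (φ ∘ torProj) z (Pi.single i 1) :=
    funext fun z => torusGrad_torProj hφ.differentiable z i
  change Continuous ((fun y => torusGrad φ y i) ∘ torProj)
  rw [this]
  exact (ContDiff.continuous_fderiv hφ (by simp)).clm_apply continuous_const

theorem isTorusTest_const (c : ℝ) : IsTorusTest (fun _ : Tor d => c) := contDiff_const

theorem IsTorusTest.mul {φ ψ : Tor d → ℝ} (hφ : IsTorusTest φ) (hψ : IsTorusTest ψ) :
    IsTorusTest (fun y => φ y * ψ y) := ContDiff.mul hφ hψ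

theorem torusGrad_ext {φ : Tor d → ℝ} {g : Tor d → Sp d}
    (h : ∀ z i, HasDerivAt (fun s : ℝ => φ (torProj (z + Pi.single i s))) (g (torProj z) i) 0) :
    torusGrad φ = g := by
  ext y i
  obtain ⟨z, rfl⟩ := isOpenQuotientMap_torProj.surjective y
  change deriv (fun s : ℝ => φ (torProj z + Pi.single i (s : UnitAddCircle))) 0 = _
  simp_rw [torProj_add_single]
  exact (h z i).deriv

theorem IsTorusTest.hasDerivAt {φ : Tor d → ℝ} (hφ : IsTorusTest φ) (z : Fin d → ℝ) (i : Fin d) :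
    HasDerivAt (fun s : ℝ => φ (torProj (z + Pi.single i s))) (torusGrad φ (torProj z) i) 0 := by
  have h : DifferentiableAt ℝ (fun s : ℝ => φ (torProj (z + Pi.single i s))) 0 := by
    have h1 : Differentiable ℝ (fun s : ℝ => z + Pi.single i s) := by
      refine (differentiable_const z).add ?_
      exact (ContinuousLinearMap.single ℝ (fun _ : Fin d => ℝ) i).differentiable
    exact (hφ.differentiable.comp h1) 0
  have e : torusGrad φ (torProj z) i
      = deriv (fun s : ℝ => φ (torProj (z + Pi.single i s))) 0 := by
    change deriv (fun s : ℝ => φ (torProj z + Pi.single i (s : UnitAddCircle))) 0 = _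
    simp_rw [torProj_add_single]
  rw [e]
  exact h.hasDerivAt

theorem torusGrad_const (c : ℝ) : torusGrad (fun _ : Tor d => c) = 0 :=
  torusGrad_ext fun _ _ => hasDerivAt_const _ _

theorem IsTorusTest.torusGrad_mul {φ ψ : Tor d → ℝ} (hφ : IsTorusTest φ) (hψ : IsTorusTest ψ) :
    torusGrad (fun y => φ y * ψ y) = fun y => ψ y • torusGrad φ y + φ y • torusGrad ψ y := by
  refine torusGrad_ext fun z i => ?_
  have h := (hφ.hasDerivAt z i).fun_mul (hψ.hasDerivAt z i)
  rw [Pi.single_zero, add_zero] at h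
  rw [PiLp.add_apply, PiLp.smul_apply, PiLp.smul_apply, smul_eq_mul, smul_eq_mul, mul_comm (ψ _)]
  exact h

theorem memLp_of_continuous {F : Type*} [NormedAddCommGroup F] {p : Tor d → F} (hp : Continuous p)
    (q : ENNReal) : MemLp p q := by
  obtain ⟨C, hC⟩ := isCompact_univ.exists_bound_of_continuousOn hp.continuousOn
  exact MemLp.of_bound (hp.aestronglyMeasurable_of_compactSpace) C
    (ae_of_all _ fun y => hC y (Set.mem_univ y))

/-! ### Fourier modes -/

/-- Cosine modes on the torus. -/
def cosMode (k : Fin d → ℤ) (y : Tor d) : ℝ := (UnitAddTorus.mFourier k y).re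

/-- Sine modes on the torus. -/
def sinMode (k : Fin d → ℤ) (y : Tor d) : ℝ := (UnitAddTorus.mFourier k y).im

/-- The frequency `2πk` of a Fourier mode. -/
def freq (k : Fin d → ℤ) : Sp d := WithLp.toLp 2 fun i => 2 * Real.pi * (k i : ℝ)

theorem mFourier_torProj (k : Fin d → ℤ) (z : Fin d → ℝ) :
    UnitAddTorus.mFourier k (torProj z)
      = Complex.exp (((∑ i, 2 * Real.pi * (k i : ℝ) * z i : ℝ) : ℂ) * Complex.I) := by
  simp only [UnitAddTorus.mFourier, ContinuousMap.coe_mk, torProj]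
  rw [Complex.ofReal_sum, Finset.sum_mul, Complex.exp_sum]
  refine Finset.prod_congr rfl fun i _ => ?_
  rw [fourier_coe_apply]
  congr 1
  push_cast
  ring

theorem cosMode_torProj (k : Fin d → ℤ) (z : Fin d → ℝ) :
    cosMode k (torProj z) = Real.cos (∑ i, 2 * Real.pi * (k i : ℝ) * z i) := by
  rw [cosMode, mFourier_torProj, Complex.exp_ofReal_mul_I_re]

theorem sinMode_torProj (k : Fin d → ℤ) (z : Fin d → ℝ) :
    sinMode k (torProj z) = Real.sin (∑ i, 2 * Real.pi * (k i : ℝ) * z i) := by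
  rw [sinMode, mFourier_torProj, Complex.exp_ofReal_mul_I_im]

theorem isTorusTest_cosMode (k : Fin d → ℤ) : IsTorusTest (cosMode k) := by
  change ContDiff ℝ ∞ fun z => cosMode k (torProj z)
  simp_rw [cosMode_torProj]
  fun_prop

theorem isTorusTest_sinMode (k : Fin d → ℤ) : IsTorusTest (sinMode k) := by
  change ContDiff ℝ ∞ fun z => sinMode k (torProj z)
  simp_rw [sinMode_torProj]
  fun_prop

theorem hasDerivAt_phase (k : Fin d → ℤ) (z : Fin d → ℝ) (i : Fin d) :
    HasDerivAt (fun s : ℝ => ∑ j, 2 * Real.pi * (k j : ℝ) * (z + Pi.single i s : Fin d → ℝ) j)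
      (freq k i) 0 := by
  have e : (fun s : ℝ => ∑ j, 2 * Real.pi * (k j : ℝ) * (z + Pi.single i s : Fin d → ℝ) j) =
      fun s => (∑ j, 2 * Real.pi * (k j : ℝ) * z j) + freq k i * s := by
    ext s
    simp only [Pi.add_apply, mul_add, Finset.sum_add_distrib, add_right_inj]
    rw [Finset.sum_eq_single i]
    · simp [freq]
    · intro j _ hj; simp [hj]
    · simp
  rw [e]
  simpa using ((hasDerivAt_id (0 : ℝ)).const_mul (freq k i)).const_add
    (∑ j, 2 * Real.pi * (k j : ℝ) * z j)

theorem torusGrad_cosMode (k : Fin d → ℤ) :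
    torusGrad (cosMode k) = fun y => (-sinMode k y) • freq k := by
  refine torusGrad_ext fun z i => ?_
  simp_rw [cosMode_torProj]
  have := (hasDerivAt_phase k z i).cos
  simpa [sinMode_torProj] using this

theorem torusGrad_sinMode (k : Fin d → ℤ) :
    torusGrad (sinMode k) = fun y => (cosMode k y) • freq k := by
  refine torusGrad_ext fun z i => ?_
  simp_rw [sinMode_torProj]
  have := (hasDerivAt_phase k z i).sin
  simpa [cosMode_torProj] using this

/-- Parseval's identity for real functions. -/
theorem hasSum_sq_modes {w : Tor d → ℝ} (hw : MemLp w 2) :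
    HasSum (fun k : Fin d → ℤ => (∫ y, w y * cosMode k y) ^ 2 + (∫ y, w y * sinMode k y) ^ 2)
      (∫ y, w y ^ 2) := by
  have h := hasSum_sq_mFourierCoeff (w := fun y => (w y : ℂ)) hw.ofReal
  convert h using 1
  · ext k
    have hc := integrable_mul_of_memLp hw (memLp_of_continuous (isTorusTest_cosMode k).continuous 2)
    have hs := integrable_mul_of_memLp hw (memLp_of_continuous (isTorusTest_sinMode k).continuous 2)
    have e : ∀ y, UnitAddTorus.mFourier (-k) y • (w y : ℂ)
        = ((w y * cosMode k y : ℝ) : ℂ) - ((w y * sinMode k y : ℝ) : ℂ) * Complex.I := by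
      intro y
      rw [UnitAddTorus.mFourier_neg]
      apply Complex.ext <;> simp [cosMode, sinMode, mul_comm]
    simp_rw [e]
    rw [integral_sub hc.ofReal (hs.ofReal.mul_const _), integral_mul_const, integral_complex_ofReal,
      integral_complex_ofReal, Complex.sq_norm, Complex.normSq_apply]
    simp
    ring
  · simp

end Torus

end MeanFlow
end

noncomputable section

namespace MeanFlow

/-! ### Density of test functions -/

section Density

variable {d : ℕ} {X : Type*} [MeasurableSpace X] {μ : Measure X}

/-- The jets of the test functions. -/
def testJets (μ : Measure X) (𝒯 : Set ((X → ℝ) × (X → Sp d))) : Set (Lp (Jet d) 2 μ) :=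
  {h | ∃ t ∈ 𝒯, h =ᵐ[μ] jet t.1 t.2}

/-- A linear space of square integrable test functions for which integration by parts holds. -/
structure IsTestSpace (μ : Measure X) (𝒯 : Set ((X → ℝ) × (X → Sp d))) : Prop where
  zero_mem : 0 ∈ 𝒯
  add_mem : ∀ s ∈ 𝒯, ∀ t ∈ 𝒯, s + t ∈ 𝒯
  smul_mem : ∀ (c : ℝ), ∀ t ∈ 𝒯, c • t ∈ 𝒯
  memLp : ∀ t ∈ 𝒯, MemLp t.1 2 μ ∧ MemLp t.2 2 μ
  parts : ∀ s ∈ 𝒯, ∀ t ∈ 𝒯, ∀ i : Fin d, ∫ x, s.1 x * t.2 x i ∂μ = - ∫ x, s.2 x i * t.1 x ∂μ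

theorem IsTestSpace.testJets_subset {𝒯 : Set ((X → ℝ) × (X → Sp d))} (h𝒯 : IsTestSpace μ 𝒯) :
    testJets μ 𝒯 ⊆ weakGradSpace μ 𝒯 := by
  rintro h ⟨s, hs, hh⟩
  refine (mem_weakGradSpace h𝒯.memLp).2 fun t ht i => ?_
  have := h𝒯.parts s hs t ht i
  have e1 : ∫ x, (h x).fst * t.2 x i ∂μ = ∫ x, s.1 x * t.2 x i ∂μ := by
    refine integral_congr_ae ?_
    filter_upwards [hh] with x hx
    rw [hx, jet_fst]
  have e2 : ∫ x, (h x).snd i * t.1 x ∂μ = ∫ x, s.2 x i * t.1 x ∂μ := by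
    refine integral_congr_ae ?_
    filter_upwards [hh] with x hx
    rw [hx, jet_snd]
  rw [e1, e2, this]

/-- Density is reduced to a uniqueness statement. The difference between f and its projection on the
closure of the test jets is a weak-gradient pair orthogonal to every test jet, that is, a weak
solution of Δh = h. -/
theorem IsTestSpace.mem_closure_testJets {𝒯 : Set ((X → ℝ) × (X → Sp d))}
    (h𝒯 : IsTestSpace μ 𝒯)
    (horth : ∀ h ∈ weakGradSpace μ 𝒯,
      (∀ t ∈ 𝒯, (∫ x, (h x).fst * t.1 x ∂μ) + ∫ x, inner ℝ (h x).snd (t.2 x) ∂μ = 0) → h = 0)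
    {f : Lp (Jet d) 2 μ} (hf : f ∈ weakGradSpace μ 𝒯) : f ∈ closure (testJets μ 𝒯) := by
  let S : Submodule ℝ (Lp (Jet d) 2 μ) :=
    { carrier := testJets μ 𝒯
      zero_mem' := ⟨0, h𝒯.zero_mem, by
        filter_upwards [Lp.coeFn_zero (Jet d) 2 μ] with x hx
        rw [hx]; rfl⟩
      add_mem' := by
        rintro a b ⟨s, hs, ha⟩ ⟨t, ht, hb⟩
        refine ⟨s + t, h𝒯.add_mem s hs t ht, ?_⟩
        filter_upwards [Lp.coeFn_add a b, ha, hb] with x hx ha hb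
        rw [hx, Pi.add_apply, ha, hb]; rfl
      smul_mem' := by
        rintro c a ⟨s, hs, ha⟩
        refine ⟨c • s, h𝒯.smul_mem c s hs, ?_⟩
        filter_upwards [Lp.coeFn_smul c a, ha] with x hx ha
        rw [hx, Pi.smul_apply, ha]; rfl }
  have hSV : S.topologicalClosure ≤ weakGradSpace μ 𝒯 :=
    S.topologicalClosure_minimal h𝒯.testJets_subset (isClosed_weakGradSpace 𝒯)
  have : CompleteSpace S.topologicalClosure := S.isClosed_topologicalClosure.completeSpace_coe
  have hmem : S.topologicalClosure.starProjection f ∈ S.topologicalClosure :=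
    Submodule.starProjection_apply_mem _ _
  have h0 : f - S.topologicalClosure.starProjection f = 0 := by
    refine horth _ (Submodule.sub_mem _ hf (hSV hmem)) fun t ht => ?_
    have hj := memLp_jet (h𝒯.memLp t ht).1 (h𝒯.memLp t ht).2
    rw [← inner_toLp_jet hj]
    refine Submodule.starProjection_inner_eq_zero f _ (S.le_topologicalClosure ?_)
    exact ⟨t, ht, hj.coeFn_toLp⟩
  rw [sub_eq_zero] at h0
  rw [h0]
  exact hmem

end Density

/-! ### Operators acting on jets -/

section JetOp

variable {d : ℕ}

/-- The map `(w, g) ↦ (v·g, L g)`. -/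
def jetOp (v : Sp d) (L : Sp d →L[ℝ] Sp d) : Jet d →L[ℝ] Jet d :=
  ((WithLp.prodContinuousLinearEquiv 2 ℝ ℝ (Sp d)).symm : (ℝ × Sp d) →L[ℝ] Jet d).comp
    (((innerSL ℝ v).prod L).comp (WithLp.sndL 2 ℝ ℝ (Sp d)))

@[simp] theorem jetOp_fst (v : Sp d) (L : Sp d →L[ℝ] Sp d) (a : Jet d) :
    (jetOp v L a).fst = inner ℝ v a.snd := rfl

@[simp] theorem jetOp_snd (v : Sp d) (L : Sp d →L[ℝ] Sp d) (a : Jet d) :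
    (jetOp v L a).snd = L a.snd := rfl

theorem inner_jetOp (v : Sp d) (L : Sp d →L[ℝ] Sp d) (a b : Jet d) :
    inner ℝ (jetOp v L a) b = inner ℝ v a.snd * b.fst + inner ℝ (L a.snd) b.snd := by
  rw [jet_inner, jetOp_fst, jetOp_snd]

theorem norm_jetOp_le (v : Sp d) (L : Sp d →L[ℝ] Sp d) : ‖jetOp v L‖ ≤ ‖v‖ + ‖L‖ := by
  refine ContinuousLinearMap.opNorm_le_bound _ (by positivity) fun a => ?_
  have ha : ‖a.snd‖ ≤ ‖a‖ := by
    refine le_of_sq_le_sq ?_ (norm_nonneg _)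
    rw [jet_norm_sq a]; nlinarith [sq_nonneg a.fst]
  have h1 : |inner ℝ v a.snd| ≤ ‖v‖ * ‖a‖ :=
    (abs_real_inner_le_norm _ _).trans (by gcongr)
  have h2 : ‖L a.snd‖ ≤ ‖L‖ * ‖a‖ := (L.le_opNorm _).trans (by gcongr)
  refine le_of_sq_le_sq ?_ (by positivity)
  rw [jet_norm_sq, jetOp_fst, jetOp_snd, ← sq_abs (inner ℝ v a.snd)]
  have h3 : |inner ℝ v a.snd| ^ 2 ≤ (‖v‖ * ‖a‖) ^ 2 := by gcongr
  have h4 : ‖L a.snd‖ ^ 2 ≤ (‖L‖ * ‖a‖) ^ 2 := by gcongr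
  have h5 : 0 ≤ ‖v‖ * ‖L‖ * ‖a‖ ^ 2 := by positivity
  nlinarith

theorem continuous_jetOp :
    Continuous fun p : Sp d × (Sp d →L[ℝ] Sp d) => jetOp p.1 p.2 := by
  let F : (Sp d × (Sp d →L[ℝ] Sp d)) →ₗ[ℝ] (Jet d →L[ℝ] Jet d) :=
    { toFun := fun p => jetOp p.1 p.2
      map_add' := fun p q => by
        ext a : 1
        apply (WithLp.prodContinuousLinearEquiv 2 ℝ ℝ (Sp d)).injective
        refine Prod.ext ?_ ?_
        · change inner ℝ (p.1 + q.1) a.snd = inner ℝ p.1 a.snd + inner ℝ q.1 a.snd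
          exact inner_add_left _ _ _
        · rfl
      map_smul' := fun c p => by
        ext a : 1
        apply (WithLp.prodContinuousLinearEquiv 2 ℝ ℝ (Sp d)).injective
        refine Prod.ext ?_ ?_
        · change inner ℝ (c • p.1) a.snd = c * inner ℝ p.1 a.snd
          exact real_inner_smul_left _ _ _
        · rfl }
  exact F.continuous_of_finiteDimensional

theorem aestronglyMeasurable_jetOp {X : Type*} [MeasurableSpace X] {μ : Measure X} {v : X → Sp d}
    {L : X → Sp d →L[ℝ] Sp d} (hv : AEStronglyMeasurable v μ) (hL : AEStronglyMeasurable L μ) :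
    AEStronglyMeasurable (fun x => jetOp (v x) (L x)) μ :=
  continuous_jetOp.comp_aestronglyMeasurable₂ hv hL

/-- The operator of a matrix. -/
def matOp (A : Mat d) : Sp d →L[ℝ] Sp d := A.toEuclideanLin.toContinuousLinearMap

@[simp] theorem matOp_apply (A : Mat d) (v : Sp d) : matOp A v = A.toEuclideanLin v := rfl

theorem continuous_matOp : Continuous (matOp (d := d)) := by
  let F : Mat d →ₗ[ℝ] (Sp d →L[ℝ] Sp d) :=
    { toFun := matOp
      map_add' := fun A B => by ext v : 1; simp [matOp]
      map_smul' := fun c A => by ext v : 1; simp [matOp] }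
  exact F.continuous_of_finiteDimensional

end JetOp

/-! ### Sobolev functions on the torus -/

section TorusSobolev

variable {d : ℕ}

/-- Smooth functions on the torus, with their gradients. -/
def torusTests (d : ℕ) : Set ((Tor d → ℝ) × (Tor d → Sp d)) :=
  {t | IsTorusTest t.1 ∧ t.2 = torusGrad t.1}

/-- By translation invariance s ↦ ∫ φ(y + s e_i) dy is constant; differentiation under the integral
sign at s = 0 gives the claim. -/
theorem integral_torusGrad_eq_zero {φ : Tor d → ℝ} (hφ : IsTorusTest φ) (i : Fin d) :
    ∫ y, torusGrad φ y i = 0 := by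
  have hc : Continuous fun y => torusGrad φ y i :=
    (EuclideanSpace.proj (𝕜 := ℝ) i).continuous.comp hφ.continuous_torusGrad
  obtain ⟨C, hC⟩ := isCompact_univ.exists_bound_of_continuousOn hc.continuousOn
  have hder : ∀ (y : Tor d) (s : ℝ),
      HasDerivAt (fun s : ℝ => φ (y + Pi.single i (s : UnitAddCircle)))
        (torusGrad φ (y + Pi.single i (s : UnitAddCircle)) i) s := by
    intro y s
    obtain ⟨z, rfl⟩ := isOpenQuotientMap_torProj.surjective y
    have h := hφ.hasDerivAt (z + Pi.single i s) i
    have h1 : HasDerivAt (fun r : ℝ => φ (torProj (z + Pi.single i s + Pi.single i r)))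
      (torusGrad φ (torProj (z + Pi.single i s)) i) (s - s) := by rwa [sub_self]
    have h2 := h1.comp_sub_const s s
    have e : (fun r : ℝ => φ (torProj (z + Pi.single i s + Pi.single i (r - s))))
        = fun r : ℝ => φ (torProj z + Pi.single i (r : UnitAddCircle)) := by
      funext r
      rw [torProj_add_single, add_assoc, ← Pi.single_add, add_sub_cancel]
    rw [e] at h2
    rw [torProj_add_single]
    exact h2
  have hcs : ∀ {p : Tor d → ℝ}, Continuous p → ∀ s : ℝ,
      Continuous fun y : Tor d => p (y + Pi.single i (s : UnitAddCircle)) := by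
    intro p hp s
    have : Continuous fun y : Tor d => y + Pi.single i (s : UnitAddCircle) :=
      continuous_add_const _
    exact hp.comp this
  have hconst : ∀ s : ℝ, ∫ y : Tor d, φ (y + Pi.single i (s : UnitAddCircle)) = ∫ y, φ y := fun s =>
    integral_add_right_eq_self φ _
  obtain ⟨F, hF⟩ : ∃ F : ℝ → Tor d → ℝ, ∀ s y, F s y = φ (y + Pi.single i (s : UnitAddCircle)) :=
    ⟨_, fun _ _ => rfl⟩
  obtain ⟨F', hF'⟩ : ∃ F' : ℝ → Tor d → ℝ,
      ∀ s y, F' s y = torusGrad φ (y + Pi.single i (s : UnitAddCircle)) i := ⟨_, fun _ _ => rfl⟩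
  have hFc : ∀ s, Continuous (F s) := fun s => by
    rw [funext (hF s)]; exact hcs hφ.continuous s
  have hFc' : ∀ s, Continuous (F' s) := fun s => by
    rw [funext (hF' s)]; exact hcs hc s
  have hd : ∀ y s, HasDerivAt (fun s => F s y) (F' s y) s := fun y s => by
    simp_rw [hF, hF']; exact hder y s
  have hb : ∀ s y, ‖F' s y‖ ≤ C := fun s y => by
    rw [hF']; exact hC _ (Set.mem_univ _)
  have h := (hasDerivAt_integral_of_dominated_loc_of_deriv_le (μ := (volume : Measure (Tor d)))
    (F := F) (F' := F') (x₀ := 0) (s := Set.univ) (bound := fun _ => C) Filter.univ_mem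
    (Eventually.of_forall fun s => (hFc s).aestronglyMeasurable)
    ((memLp_of_continuous (hFc 0) 1).integrable le_rfl) (hFc' 0).aestronglyMeasurable
    (ae_of_all _ fun y s _ => hb s y) (integrable_const C) (ae_of_all _ fun y s _ => hd y s)).2
  have e : (fun s => ∫ y, F s y) = fun _ => ∫ y, φ y := funext fun s => by
    simp_rw [hF]; exact hconst s
  rw [e] at h
  rw [← h.unique (hasDerivAt_const _ _)]
  refine integral_congr_ae (ae_of_all _ fun y => ?_)
  simp [hF']

theorem isTestSpace_torus : IsTestSpace volume (torusTests d) where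
  zero_mem := ⟨isTorusTest_const 0, (torusGrad_const 0).symm⟩
  add_mem := by
    rintro s ⟨hs, hs'⟩ t ⟨ht, ht'⟩
    refine ⟨ContDiff.add hs ht, ?_⟩
    rw [Prod.snd_add, hs', ht']
    refine (torusGrad_ext fun z i => ?_).symm
    have := (hs.hasDerivAt z i).add (ht.hasDerivAt z i)
    exact this
  smul_mem := by
    rintro c t ⟨ht, ht'⟩
    refine ⟨ContDiff.const_smul c ht, ?_⟩
    rw [Prod.smul_snd, ht']
    refine (torusGrad_ext fun z i => ?_).symm
    exact (ht.hasDerivAt z i).const_smul c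
  memLp := by
    rintro t ⟨ht, ht'⟩
    rw [ht']
    exact ⟨memLp_of_continuous ht.continuous 2, memLp_of_continuous ht.continuous_torusGrad 2⟩
  parts := by
    rintro s ⟨hs, hs'⟩ t ⟨ht, ht'⟩ i
    rw [hs', ht']
    have h := integral_torusGrad_eq_zero (hs.mul ht) i
    rw [hs.torusGrad_mul ht] at h
    have m := fun {φ : Tor d → ℝ} (hφ : IsTorusTest φ) =>
      memLp_coord (memLp_of_continuous hφ.continuous_torusGrad 2 (F := Sp d)) i
    have h1 := integrable_mul_of_memLp (memLp_of_continuous ht.continuous 2) (m hs)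
    have h2 := integrable_mul_of_memLp (memLp_of_continuous hs.continuous 2) (m ht)
    simp only [PiLp.add_apply, PiLp.smul_apply, smul_eq_mul] at h
    rw [integral_add h1 h2] at h
    simp_rw [mul_comm (torusGrad s.1 _ i)]
    linarith

theorem mem_torusWeakGradSpace {f : Lp (Jet d) 2 (volume : Measure (Tor d))} :
    f ∈ weakGradSpace volume (torusTests d) ↔
      HasTorusWeakGrad (fun y => (f y).fst) (fun y => (f y).snd) := by
  rw [mem_weakGradSpace isTestSpace_torus.memLp]
  constructor
  · exact fun h φ hφ i => h (φ, torusGrad φ) ⟨hφ, rfl⟩ i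
  · rintro h ⟨φ, γ⟩ ⟨hφ, hγ⟩ i
    obtain rfl : γ = torusGrad φ := hγ
    exact h φ hφ i

/-- Together with `sin_coeff` this is the rule that ∇ acts on Fourier coefficients as multiplication
by 2πik, in real form. -/
theorem HasTorusWeakGrad.cos_coeff {w : Tor d → ℝ} {g : Tor d → Sp d} (h : HasTorusWeakGrad w g)
    (k : Fin d → ℤ) (i : Fin d) :
    ∫ y, g y i * cosMode k y = freq k i * ∫ y, w y * sinMode k y := by
  have := h _ (isTorusTest_cosMode k) i
  rw [torusGrad_cosMode] at this
  simp only [PiLp.smul_apply, smul_eq_mul] at this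
  rw [← integral_const_mul, ← neg_neg (∫ y, g y i * cosMode k y), ← this, ← integral_neg]
  congr 1
  ext y
  ring

theorem HasTorusWeakGrad.sin_coeff {w : Tor d → ℝ} {g : Tor d → Sp d} (h : HasTorusWeakGrad w g)
    (k : Fin d → ℤ) (i : Fin d) :
    ∫ y, g y i * sinMode k y = - (freq k i * ∫ y, w y * cosMode k y) := by
  have := h _ (isTorusTest_sinMode k) i
  rw [torusGrad_sinMode] at this
  simp only [PiLp.smul_apply, smul_eq_mul] at this
  rw [← integral_const_mul, ← neg_neg (∫ y, g y i * sinMode k y), ← this]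
  congr 2
  ext y
  ring

/-- A nonzero integer has square at least 1 and 2π > 1. This crude bound gives the Poincaré
inequality with constant 1. -/
theorem one_le_norm_freq {k : Fin d → ℤ} (hk : k ≠ 0) : ∃ i, 1 ≤ freq k i ^ 2 := by
  obtain ⟨i, hi⟩ := Function.ne_iff.1 hk
  refine ⟨i, ?_⟩
  have h1 : (1 : ℝ) ≤ (k i : ℝ) ^ 2 := by
    have h0 : k i ≠ 0 := hi
    have : 1 ≤ (k i) ^ 2 := by
      have : 0 < (k i) ^ 2 := by positivity
      omega
    exact_mod_cast this
  have h2 := Real.pi_gt_three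
  change (1 : ℝ) ≤ (2 * Real.pi * (k i : ℝ)) ^ 2
  rw [mul_pow]
  nlinarith

/-- The Poincaré inequality on the torus. -/
theorem poincare_torus {w : Tor d → ℝ} {g : Tor d → Sp d} (hw : MemLp w 2) (hg : MemLp g 2)
    (h : HasTorusWeakGrad w g) (h0 : ∫ y, w y = 0) : ∫ y, w y ^ 2 ≤ ∫ y, ‖g y‖ ^ 2 := by
  have hs := hasSum_sum (s := Finset.univ) fun i _ => hasSum_sq_modes (memLp_coord hg i)
  have e : ∑ i, ∫ y, g y i ^ 2 = ∫ y, ‖g y‖ ^ 2 := by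
    rw [← integral_finsetSum _ fun i _ => (memLp_coord hg i).integrable_sq]
    simp_rw [EuclideanSpace.real_norm_sq_eq]
  rw [e] at hs
  -- Both sides are compared mode by mode through Parseval. For k = 0 the left side vanishes by the
  -- zero mean; for other k one component of the gradient already dominates.
  refine hasSum_le (fun k => ?_) (hasSum_sq_modes hw) hs
  by_cases hk : k = 0
  · have h1 : ∀ y : Tor d, cosMode 0 y = 1 := fun y => by
      simp [cosMode, UnitAddTorus.mFourier_zero]
    have h2 : ∀ y : Tor d, sinMode 0 y = 0 := fun y => by
      simp [sinMode, UnitAddTorus.mFourier_zero]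
    subst hk
    simp_rw [h1, h2, mul_one, mul_zero, h0]
    simp only [ne_eq, OfNat.ofNat_ne_zero, not_false_eq_true, zero_pow, integral_zero, add_zero]
    positivity
  · obtain ⟨i, hi⟩ := one_le_norm_freq hk
    refine le_trans ?_ (Finset.single_le_sum (f := fun i => (∫ y, g y i * cosMode k y) ^ 2
      + (∫ y, g y i * sinMode k y) ^ 2) (fun i _ => by positivity) (Finset.mem_univ i))
    simp only
    rw [h.cos_coeff, h.sin_coeff]
    nlinarith [sq_nonneg (∫ y, w y * cosMode k y), sq_nonneg (∫ y, w y * sinMode k y)]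

theorem ae_eq_zero_of_modes {w : Tor d → ℝ} (hw : MemLp w 2)
    (hc : ∀ k, ∫ y, w y * cosMode k y = 0) (hs : ∀ k, ∫ y, w y * sinMode k y = 0) :
    w =ᵐ[volume] 0 := by
  have h := hasSum_sq_modes hw
  simp_rw [hc, hs] at h
  have h1 : ∫ y, w y ^ 2 = 0 := by
    refine h.unique ?_
    simp
  rw [integral_eq_zero_iff_of_nonneg (fun y => sq_nonneg _) hw.integrable_sq] at h1
  filter_upwards [h1] with y hy
  simpa using hy

/-- Testing an orthogonal pair h with the modes of frequency k gives (1 + |2πk|²) ĥ(k) = 0. All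
coefficients of the function vanish, and with them those of its gradient. -/
theorem mem_closure_testJets_torus {f : Lp (Jet d) 2 (volume : Measure (Tor d))}
    (hf : f ∈ weakGradSpace volume (torusTests d)) :
    f ∈ closure (testJets volume (torusTests d)) := by
  refine isTestSpace_torus.mem_closure_testJets (fun h hh ho => ?_) hf
  rw [mem_torusWeakGradSpace] at hh
  have hi : ∀ (p : Tor d → ℝ), Continuous p → ∀ (k : Fin d → ℤ),
      ∫ y, inner ℝ (h y).snd (p y • freq k) = ∑ i, freq k i * ∫ y, (h y).snd i * p y := by
    intro p hp k
    simp_rw [← integral_const_mul]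
    rw [← integral_finsetSum]
    · refine integral_congr_ae (ae_of_all _ fun y => ?_)
      simp only [PiLp.inner_apply, PiLp.smul_apply, smul_eq_mul, RCLike.inner_apply, conj_trivial]
      exact Finset.sum_congr rfl fun i _ => by ring
    · exact fun i _ => (integrable_mul_of_memLp (memLp_coord (memLp_snd h) i)
        (memLp_of_continuous hp 2)).const_mul _
  have hpos : ∀ k : Fin d → ℤ, 0 < 1 + ∑ i, freq k i ^ 2 := fun k => by positivity
  have hc : ∀ k, ∫ y, (h y).fst * cosMode k y = 0 := by
    intro k
    have := ho (cosMode k, torusGrad (cosMode k)) ⟨isTorusTest_cosMode k, rfl⟩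
    simp only [torusGrad_cosMode] at this
    rw [hi (fun y => -sinMode k y) (isTorusTest_sinMode k).continuous.neg] at this
    have e : ∀ i, freq k i * ∫ y, (h y).snd i * -sinMode k y
        = freq k i ^ 2 * ∫ y, (h y).fst * cosMode k y := by
      intro i
      simp_rw [mul_neg]
      rw [integral_neg, hh.sin_coeff]
      ring
    simp_rw [e] at this
    rw [← Finset.sum_mul, ← one_add_mul] at this
    exact (mul_eq_zero.1 this).resolve_left (hpos k).ne'
  have hs : ∀ k, ∫ y, (h y).fst * sinMode k y = 0 := by
    intro k
    have := ho (sinMode k, torusGrad (sinMode k)) ⟨isTorusTest_sinMode k, rfl⟩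
    simp only [torusGrad_sinMode] at this
    rw [hi _ (isTorusTest_cosMode k).continuous] at this
    have e : ∀ i, freq k i * ∫ y, (h y).snd i * cosMode k y
        = freq k i ^ 2 * ∫ y, (h y).fst * sinMode k y := by
      intro i
      rw [hh.cos_coeff]
      ring
    simp_rw [e] at this
    rw [← Finset.sum_mul, ← one_add_mul] at this
    exact (mul_eq_zero.1 this).resolve_left (hpos k).ne'
  have h1 := ae_eq_zero_of_modes (memLp_fst h) hc hs
  have h2 : ∀ i, (fun y => (h y).snd i) =ᵐ[volume] 0 := fun i =>
    ae_eq_zero_of_modes (memLp_coord (memLp_snd h) i)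
      (fun k => by rw [hh.cos_coeff, hs, mul_zero])
      (fun k => by rw [hh.sin_coeff, hc, mul_zero, neg_zero])
  refine Lp.ext ?_
  filter_upwards [h1, ae_all_iff.2 h2, Lp.coeFn_zero (Jet d) 2 (volume : Measure (Tor d))]
    with y h1 h2 h3
  rw [h3]
  apply (WithLp.prodContinuousLinearEquiv 2 ℝ ℝ (Sp d)).injective
  refine Prod.ext h1 ?_
  ext i
  exact h2 i

end TorusSobolev

end MeanFlow
end

noncomputable section

namespace MeanFlow

/-! ### The cell problem -/

section Cell

variable {d : ℕ}

/-- Constant gradients are orthogonal to the gradients of Sobolev functions. -/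
theorem HasTorusWeakGrad.integral_grad_eq_zero {w : Tor d → ℝ} {g : Tor d → Sp d}
    (h : HasTorusWeakGrad w g) (i : Fin d) : ∫ y, g y i = 0 := by
  have := h _ (isTorusTest_const 1) i
  rw [torusGrad_const] at this
  simpa using this.symm

theorem HasTorusWeakGrad.integral_inner_eq_zero {w : Tor d → ℝ} {g : Tor d → Sp d}
    (h : HasTorusWeakGrad w g) (hg : MemLp g 2) (v : Sp d) : ∫ y, inner ℝ v (g y) = 0 := by
  have e : ∀ y, inner ℝ v (g y) = ∑ i, v i * g y i := fun y => by
    simp [PiLp.inner_apply, mul_comm]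
  simp_rw [e]
  rw [integral_finsetSum]
  · simp_rw [integral_const_mul, h.integral_grad_eq_zero, mul_zero, Finset.sum_const_zero]
  · exact fun i _ => ((memLp_coord hg i).integrable one_le_two).const_mul _

/-- Sobolev functions on the torus with zero mean, with their gradients. -/
def cellSpace (d : ℕ) : Submodule ℝ (Lp (Jet d) 2 (volume : Measure (Tor d))) :=
  weakGradSpace volume (torusTests d) ⊓
    (Submodule.span ℝ {(memLp_jet (memLp_const 1) (memLp_const 0)).toLp _})ᗮ

theorem isClosed_cellSpace :
    IsClosed (cellSpace d : Set (Lp (Jet d) 2 (volume : Measure (Tor d)))) :=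
  (isClosed_weakGradSpace _).inter (Submodule.isClosed_orthogonal _)

theorem mem_cellSpace {f : Lp (Jet d) 2 (volume : Measure (Tor d))} :
    f ∈ cellSpace d ↔
      HasTorusWeakGrad (fun y => (f y).fst) (fun y => (f y).snd) ∧ ∫ y, (f y).fst = 0 := by
  rw [cellSpace, Submodule.mem_inf, mem_torusWeakGradSpace, Submodule.mem_orthogonal_singleton_iff_inner_left,
    inner_toLp_jet]
  simp

/-- Bounded measurable coefficients on the torus. -/
structure BddCoeff (β : Tor d → Sp d) (D : Tor d → Mat d) (M Lam : ℝ) : Prop where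
  nonneg_drift : 0 ≤ M
  nonneg_diff : 0 ≤ Lam
  meas_drift : AEStronglyMeasurable β
  bdd_drift : ∀ᵐ y, ‖β y‖ ≤ M
  meas_diff : AEStronglyMeasurable fun y => matOp (D y)
  bdd_diff : ∀ᵐ y, ‖matOp (D y)‖ ≤ Lam

/-- Bounded coefficients with divergence free drift of mean zero and coercive diffusion. -/
structure CellCoeff (β : Tor d → Sp d) (D : Tor d → Mat d) (M lam Lam : ℝ) : Prop
    extends BddCoeff β D M Lam where
  pos : 0 < lam
  div_free : ∀ φ : Tor d → ℝ, IsTorusTest φ → ∫ y, inner ℝ (β y) (torusGrad φ y) = 0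
  mean_zero : ∫ y, β y = 0
  coercive : ∀ᵐ y, ∀ ξ : Sp d, lam * ‖ξ‖ ^ 2 ≤ inner ℝ ξ ((D y).toEuclideanLin ξ)

variable {β : Tor d → Sp d} {D : Tor d → Mat d} {M lam Lam : ℝ}

theorem BddCoeff.meas_jetOp (h : BddCoeff β D M Lam) (v : Sp d) :
    AEStronglyMeasurable fun y => jetOp (v + β y) (matOp (D y)) := by
  have h1 : AEStronglyMeasurable fun y => v + β y := aestronglyMeasurable_const.add h.meas_drift
  exact aestronglyMeasurable_jetOp h1 h.meas_diff

theorem BddCoeff.bdd_jetOp (h : BddCoeff β D M Lam) (v : Sp d) :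
    ∀ᵐ y, ‖jetOp (v + β y) (matOp (D y))‖ ≤ ‖v‖ + M + Lam := by
  filter_upwards [h.bdd_drift, h.bdd_diff] with y h1 h2
  exact (norm_jetOp_le _ _).trans (add_le_add ((norm_add_le _ _).trans (by gcongr)) h2)

theorem BddCoeff.meas_diffOp (h : BddCoeff β D M Lam) :
    AEStronglyMeasurable fun y => jetOp (0 : Sp d) (matOp (D y)) :=
  aestronglyMeasurable_jetOp aestronglyMeasurable_const h.meas_diff

theorem BddCoeff.bdd_diffOp (h : BddCoeff β D M Lam) :
    ∀ᵐ y, ‖jetOp (0 : Sp d) (matOp (D y))‖ ≤ Lam := by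
  filter_upwards [h.bdd_diff] with y h2
  refine (norm_jetOp_le _ _).trans ?_
  rwa [norm_zero, zero_add]

/-- The operator of the cell problem with drift `v + β`. -/
def cellOp (h : BddCoeff β D M Lam) (v : Sp d) :
    Lp (Jet d) 2 (volume : Measure (Tor d)) →L[ℝ] Lp (Jet d) 2 (volume : Measure (Tor d)) :=
  multOp _ (‖v‖ + M + Lam) (h.meas_jetOp v) (h.bdd_jetOp v)

/-- The diffusive part of the operator of the cell problem. -/
def diffOp (h : BddCoeff β D M Lam) :
    Lp (Jet d) 2 (volume : Measure (Tor d)) →L[ℝ] Lp (Jet d) 2 (volume : Measure (Tor d)) :=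
  multOp _ Lam h.meas_diffOp h.bdd_diffOp

theorem BddCoeff.memLp_drift (h : BddCoeff β D M Lam) : MemLp β 2 :=
  MemLp.of_bound h.meas_drift M h.bdd_drift

theorem BddCoeff.memLp_diff (h : BddCoeff β D M Lam) (v : Sp d) :
    MemLp (fun y => (D y).toEuclideanLin v) 2 := by
  refine MemLp.of_bound (h.meas_diff.apply_continuousLinearMap v) (Lam * ‖v‖) ?_
  filter_upwards [h.bdd_diff] with y hy
  exact (matOp (D y)).le_of_opNorm_le hy v

/-- The constant jet `(0, v)`. -/
def constJet (v : Sp d) : Lp (Jet d) 2 (volume : Measure (Tor d)) :=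
  (memLp_jet (memLp_const 0) (memLp_const v)).toLp _

theorem BddCoeff.memLp_rhs (h : BddCoeff β D M Lam) (i : Fin d) :
    MemLp (jet (fun y => -β y i) (fun y => -(D y).toEuclideanLin (stdVec i))) 2 :=
  memLp_jet (memLp_coord h.memLp_drift i).neg (h.memLp_diff _).neg

/-- The right-hand side of the cell problem. -/
def cellRhs (h : BddCoeff β D M Lam) (i : Fin d) : Lp (Jet d) 2 (volume : Measure (Tor d)) :=
  (h.memLp_rhs i).toLp _

theorem norm_toLp_le_of_bound {g : Tor d → Jet d} (hg : MemLp g 2) {C : ℝ} (hC : 0 ≤ C)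
    (h : ∀ᵐ y, ‖g y‖ ≤ C) : ‖hg.toLp g‖ ≤ C := by
  have := Lp.norm_le_of_ae_bound (f := hg.toLp g) (C := C) hC (by
    filter_upwards [hg.coeFn_toLp, h] with y h1 h2
    rwa [h1])
  have e : measureUnivNNReal (volume : Measure (Tor d)) = 1 := by simp [measureUnivNNReal]
  rwa [e, NNReal.coe_one, Real.one_rpow, one_mul] at this

/-- The constant part `v` of the drift is absent from the right-hand side, which is why this bound,
and later the bound on the solutions, is uniform in x although b̄ may be unbounded. -/
theorem norm_cellRhs_le (h : BddCoeff β D M Lam) (i : Fin d) : ‖cellRhs h i‖ ≤ M + Lam := by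
  have := h.nonneg_drift
  have := h.nonneg_diff
  refine norm_toLp_le_of_bound _ (by positivity) ?_
  filter_upwards [h.bdd_drift, h.bdd_diff] with y h1 h2
  have h3 : |β y i| ≤ M := (PiLp.norm_apply_le (β y) i).trans h1
  have h4 : ‖(D y).toEuclideanLin (stdVec i)‖ ≤ Lam := by
    have := (matOp (D y)).le_of_opNorm_le h2 (stdVec i)
    rwa [norm_stdVec, mul_one] at this
  refine le_of_sq_le_sq ?_ (by positivity)
  rw [jet_norm_sq, jet_fst, jet_snd, norm_neg, neg_sq, ← sq_abs (β y i)]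
  have h5 : |β y i| ^ 2 ≤ M ^ 2 := by gcongr
  have h6 : ‖(D y).toEuclideanLin (stdVec i)‖ ^ 2 ≤ Lam ^ 2 := by gcongr
  nlinarith

theorem norm_constJet_le (v : Sp d) : ‖constJet v‖ ≤ ‖v‖ := by
  refine norm_toLp_le_of_bound _ (norm_nonneg _) (ae_of_all _ fun y => ?_)
  refine le_of_sq_le_sq ?_ (norm_nonneg _)
  rw [jet_norm_sq]
  simp

theorem inner_diffOp (h : BddCoeff β D M Lam) (f k : Lp (Jet d) 2 (volume : Measure (Tor d))) :
    inner ℝ (diffOp h f) k = ∫ y, inner ℝ ((D y).toEuclideanLin (f y).snd) (k y).snd := by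
  rw [diffOp, inner_multOp]
  refine integral_congr_ae (ae_of_all _ fun y => ?_)
  simp only
  rw [inner_jetOp, inner_zero_left, zero_mul, zero_add, matOp_apply]

theorem BddCoeff.integrable_diff (h : BddCoeff β D M Lam)
    (f k : Lp (Jet d) 2 (volume : Measure (Tor d))) :
    Integrable fun y => inner ℝ ((D y).toEuclideanLin (f y).snd) (k y).snd := by
  refine (L2.integrable_inner (𝕜 := ℝ) (diffOp h f) k).congr ?_
  filter_upwards [coeFn_multOp h.meas_diffOp h.bdd_diffOp f] with y hy
  rw [diffOp, hy, inner_jetOp, inner_zero_left, zero_mul, zero_add, matOp_apply]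

theorem BddCoeff.memLp_inner_drift (h : BddCoeff β D M Lam) (v : Sp d)
    {g : Tor d → Sp d} (hg : MemLp g 2) : MemLp (fun y => inner ℝ (v + β y) (g y)) 2 := by
  refine MemLp.of_le_mul (c := ‖v‖ + M) hg
    ((aestronglyMeasurable_const.add h.meas_drift).inner hg.1) ?_
  filter_upwards [h.bdd_drift] with y hy
  refine (norm_inner_le_norm _ _).trans ?_
  gcongr
  exact (norm_add_le _ _).trans (by gcongr)

theorem inner_cellOp (h : BddCoeff β D M Lam) (v : Sp d)
    (f k : Lp (Jet d) 2 (volume : Measure (Tor d))) :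
    inner ℝ (cellOp h v f) k = (∫ y, inner ℝ (v + β y) (f y).snd * (k y).fst)
      + inner ℝ (diffOp h f) k := by
  rw [cellOp, inner_multOp, inner_diffOp, ← integral_add
    (integrable_mul_of_memLp (h.memLp_inner_drift v (memLp_snd f)) (memLp_fst k))
    (h.integrable_diff f k)]
  refine integral_congr_ae (ae_of_all _ fun y => ?_)
  simp only
  rw [inner_jetOp, matOp_apply]

theorem norm_diffOp_le (h : BddCoeff β D M Lam) : ‖diffOp h‖ ≤ Lam :=
  norm_multOp_le _ _ h.nonneg_diff

theorem abs_inner_diffOp_le (h : BddCoeff β D M Lam)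
    (f k : Lp (Jet d) 2 (volume : Measure (Tor d))) :
    |inner ℝ (diffOp h f) k| ≤ Lam * (‖f‖ * ‖k‖) := by
  refine (abs_real_inner_le_norm _ _).trans ?_
  rw [← mul_assoc]
  gcongr
  exact (diffOp h).le_of_opNorm_le (norm_diffOp_le h) f

theorem norm_cellOp_le (h : BddCoeff β D M Lam) (v : Sp d) : ‖cellOp h v‖ ≤ ‖v‖ + M + Lam := by
  have := h.nonneg_drift
  have := h.nonneg_diff
  exact norm_multOp_le _ _ (by positivity)

/-- A constant field is divergence free because gradients of test functions have mean zero. -/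
theorem CellCoeff.div_free_add (h : CellCoeff β D M lam Lam) (v : Sp d) {φ : Tor d → ℝ}
    (hφ : IsTorusTest φ) : ∫ y, inner ℝ (v + β y) (torusGrad φ y) = 0 := by
  have hm := memLp_of_continuous hφ.continuous_torusGrad 2
  have hv : ∫ y, inner ℝ v (torusGrad φ y) = 0 := by
    have hw : HasTorusWeakGrad φ (torusGrad φ) := fun ψ hψ i =>
      isTestSpace_torus.parts (φ, torusGrad φ) ⟨hφ, rfl⟩ (ψ, torusGrad ψ) ⟨hψ, rfl⟩ i
    exact hw.integral_inner_eq_zero hm v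
  simp_rw [inner_add_left]
  rw [integral_add (integrable_inner_of_memLp (memLp_const v) hm)
    (integrable_inner_of_memLp h.memLp_drift hm), hv, h.div_free φ hφ, add_zero]

/-- The drift term of the cell problem is skew. -/
theorem CellCoeff.drift_skew (h : CellCoeff β D M lam Lam) (v : Sp d)
    {f : Lp (Jet d) 2 (volume : Measure (Tor d))} (hf : f ∈ weakGradSpace volume (torusTests d)) :
    ∫ y, inner ℝ (v + β y) (f y).snd * (f y).fst = 0 := by
  -- Written as a difference of two bounded quadratic forms, the drift term is continuous in f, so
  -- it is enough to treat test functions.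
  have e : ∀ f : Lp (Jet d) 2 (volume : Measure (Tor d)),
      ∫ y, inner ℝ (v + β y) (f y).snd * (f y).fst
        = inner ℝ (cellOp h.toBddCoeff v f) f - inner ℝ (diffOp h.toBddCoeff f) f := fun f => by
    rw [inner_cellOp]; ring
  have hcl : IsClosed {f : Lp (Jet d) 2 (volume : Measure (Tor d)) |
      inner ℝ (cellOp h.toBddCoeff v f) f - inner ℝ (diffOp h.toBddCoeff f) f = 0} :=
    isClosed_eq (by fun_prop) continuous_const
  rw [e]
  refine hcl.closure_subset_iff.2 ?_ (mem_closure_testJets_torus hf)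
  rintro f ⟨t, ⟨ht, ht'⟩, hft⟩
  rw [Set.mem_ofPred_eq, ← e]
  -- For smooth φ the integrand is half of (v + β)·∇(φ²).
  have h2 := h.div_free_add v (ht.mul ht)
  rw [ht.torusGrad_mul ht] at h2
  have e3 : ∀ y, inner ℝ (v + β y) (t.1 y • torusGrad t.1 y + t.1 y • torusGrad t.1 y)
      = 2 * (inner ℝ (v + β y) (torusGrad t.1 y) * t.1 y) := fun y => by
    rw [inner_add_right, inner_smul_right]; ring
  simp_rw [e3] at h2
  rw [integral_const_mul] at h2
  rw [← (mul_eq_zero.1 h2).resolve_left two_ne_zero]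
  refine integral_congr_ae ?_
  filter_upwards [hft] with y hy
  rw [hy, jet_fst, jet_snd, ht']

/-- This is the drift term tested against the constant 1. Zero-mean functions do not see it, and
`CellCoeff.isCellSolution` needs it to reach arbitrary test functions. -/
theorem CellCoeff.drift_mean (h : CellCoeff β D M lam Lam) (v : Sp d)
    {f : Lp (Jet d) 2 (volume : Measure (Tor d))} (hf : f ∈ weakGradSpace volume (torusTests d)) :
    ∫ y, inner ℝ (v + β y) (f y).snd = 0 := by
  have hL : MemLp (jet (fun _ => (0 : ℝ)) fun y => v + β y) 2 (volume : Measure (Tor d)) :=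
    memLp_jet (memLp_const 0) ((memLp_const v).add h.memLp_drift)
  have e : ∀ f : Lp (Jet d) 2 (volume : Measure (Tor d)),
      ∫ y, inner ℝ (v + β y) (f y).snd = inner ℝ f (hL.toLp _) := fun f => by
    rw [inner_toLp_jet]
    simp only [mul_zero, integral_zero, zero_add]
    simp_rw [real_inner_comm]
  have hcl : IsClosed {f : Lp (Jet d) 2 (volume : Measure (Tor d)) | inner ℝ f (hL.toLp _) = 0} :=
    isClosed_eq (by fun_prop) continuous_const
  rw [e]
  refine hcl.closure_subset_iff.2 ?_ (mem_closure_testJets_torus hf)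
  rintro f ⟨t, ⟨ht, ht'⟩, hft⟩
  rw [Set.mem_ofPred_eq, ← e, ← h.div_free_add v ht]
  refine integral_congr_ae ?_
  filter_upwards [hft] with y hy
  rw [hy, jet_snd, ht']

theorem CellCoeff.diff_coercive (h : CellCoeff β D M lam Lam)
    (f : Lp (Jet d) 2 (volume : Measure (Tor d))) :
    lam * ∫ y, ‖(f y).snd‖ ^ 2 ≤ inner ℝ (diffOp h.toBddCoeff f) f := by
  rw [inner_diffOp, ← integral_const_mul]
  refine integral_mono_ae ((memLp_snd f).integrable_norm_pow two_ne_zero |>.const_mul _)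
    (h.integrable_diff f f) ?_
  filter_upwards [h.coercive] with y hy
  rw [real_inner_comm]
  exact hy _

/-- The drift drops out by skewness. The Poincaré inequality with constant 1 gives ∫|∇w|² ≥ ‖f‖²/2,
whence the factor 1/2. -/
theorem CellCoeff.cellOp_coercive (h : CellCoeff β D M lam Lam) (v : Sp d)
    {f : Lp (Jet d) 2 (volume : Measure (Tor d))} (hf : f ∈ cellSpace d) :
    lam / 2 * ‖f‖ ^ 2 ≤ inner ℝ (cellOp h.toBddCoeff v f) f := by
  have h1 := mem_cellSpace.1 hf
  have h2 := poincare_torus (memLp_fst f) (memLp_snd f) h1.1 h1.2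
  rw [inner_cellOp, h.drift_skew v hf.1, zero_add]
  refine le_trans ?_ (h.diff_coercive f)
  rw [norm_sq_eq_integral]
  have := h.pos
  nlinarith

/-- `f` solves the `i`-th cell problem, in variational form. -/
def IsVarSolution (h : BddCoeff β D M Lam) (v : Sp d) (i : Fin d)
    (f : Lp (Jet d) 2 (volume : Measure (Tor d))) : Prop :=
  f ∈ cellSpace d ∧ ∀ k ∈ cellSpace d, inner ℝ (cellOp h v f) k = inner ℝ (cellRhs h i) k

theorem CellCoeff.exists_varSolution (h : CellCoeff β D M lam Lam) (v : Sp d) (i : Fin d) :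
    ∃ f, IsVarSolution h.toBddCoeff v i f :=
  exists_solution_of_coercive (cellSpace d) isClosed_cellSpace _ (half_pos h.pos)
    (fun _ hf => h.cellOp_coercive v hf) _

theorem CellCoeff.varSolution_unique (h : CellCoeff β D M lam Lam) {v : Sp d} {i : Fin d}
    {f f' : Lp (Jet d) 2 (volume : Measure (Tor d))} (hf : IsVarSolution h.toBddCoeff v i f)
    (hf' : IsVarSolution h.toBddCoeff v i f') : f = f' :=
  unique_solution_of_coercive (half_pos h.pos) (fun _ hf => h.cellOp_coercive v hf) hf.1 hf'.1
    hf.2 hf'.2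

/-- The equation is tested with its own solution: (λ/2)‖f‖² ≤ ‖rhs‖ ‖f‖. -/
theorem CellCoeff.norm_varSolution_le (h : CellCoeff β D M lam Lam) {v : Sp d} {i : Fin d}
    {f : Lp (Jet d) 2 (volume : Measure (Tor d))} (hf : IsVarSolution h.toBddCoeff v i f) :
    ‖f‖ ≤ 2 * (M + Lam) / lam := by
  have h1 := h.cellOp_coercive v hf.1
  rw [hf.2 f hf.1] at h1
  have h2 := (real_inner_le_norm (cellRhs h.toBddCoeff i) f).trans
    (mul_le_mul_of_nonneg_right (norm_cellRhs_le h.toBddCoeff i) (norm_nonneg f))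
  have h3 := h.pos
  have := h.nonneg_drift
  have := h.nonneg_diff
  rw [le_div_iff₀ h3]
  by_contra! h4
  have h5 : 0 < ‖f‖ := by
    by_contra! h6
    have : ‖f‖ = 0 := le_antisymm h6 (norm_nonneg _)
    rw [this, zero_mul] at h4
    linarith
  nlinarith

theorem inner_cellRhs (h : BddCoeff β D M Lam) (i : Fin d)
    (k : Lp (Jet d) 2 (volume : Measure (Tor d))) :
    inner ℝ (cellRhs h i) k = - (∫ y, β y i * (k y).fst)
      - ∫ y, inner ℝ ((D y).toEuclideanLin (stdVec i)) (k y).snd := by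
  rw [real_inner_comm, cellRhs, inner_toLp_jet]
  simp_rw [inner_neg_right, mul_neg, integral_neg, real_inner_comm, mul_comm]
  ring

theorem coeFn_constJet (v : Sp d) :
    ⇑(constJet v) =ᵐ[volume] jet (fun _ => 0) (fun _ => v) := MemLp.coeFn_toLp _

end Cell

end MeanFlow
end

noncomputable section

namespace MeanFlow

/-! ### The matrix of the cell problems -/

section CellMatrix

variable {d : ℕ} {β : Tor d → Sp d} {D : Tor d → Mat d} {M lam Lam : ℝ} {b : Tor d → Sp d}
  {v : Sp d}

/-- This links the operator form with the weak form of the cell problem. Expanding b·(∇w + e_i) with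
b = v + β produces a term v_i ∫k, which is the right-hand side of the cell problem. -/
theorem residual_eq (h : BddCoeff β D M Lam) (hb : ∀ᵐ y, b y = v + β y) (i : Fin d)
    (f k : Lp (Jet d) 2 (volume : Measure (Tor d))) :
    inner ℝ (cellOp h v f) k - inner ℝ (cellRhs h i) k =
      (∫ y, inner ℝ (b y) ((f y).snd + stdVec i) * (k y).fst)
      + (∫ y, inner ℝ ((D y).toEuclideanLin ((f y).snd + stdVec i)) (k y).snd)
      - v i * ∫ y, (k y).fst := by
  have hk := memLp_fst k
  have e1 : ∫ y, inner ℝ (b y) ((f y).snd + stdVec i) * (k y).fst =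
      (∫ y, inner ℝ (v + β y) (f y).snd * (k y).fst) + (v i * (∫ y, (k y).fst)
        + ∫ y, β y i * (k y).fst) := by
    have i1 := (hk.integrable one_le_two).const_mul (v i)
    have i2 := integrable_mul_of_memLp (memLp_coord h.memLp_drift i) hk
    have i3 := integrable_mul_of_memLp (h.memLp_inner_drift v (memLp_snd f)) hk
    have i4 := integral_add i3 (i1.add i2)
    have i5 := integral_add i1 i2
    simp only [Pi.add_apply] at i4
    rw [← integral_const_mul, ← i5, ← i4]
    refine integral_congr_ae ?_
    filter_upwards [hb] with y hy
    rw [hy, inner_add_right, inner_stdVec, PiLp.add_apply]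
    ring
  have e2 : ∫ y, inner ℝ ((D y).toEuclideanLin ((f y).snd + stdVec i)) (k y).snd =
      inner ℝ (diffOp h f) k + ∫ y, inner ℝ ((D y).toEuclideanLin (stdVec i)) (k y).snd := by
    rw [inner_diffOp, ← integral_add (h.integrable_diff f k)
      (integrable_inner_of_memLp (h.memLp_diff _) (memLp_snd k))]
    refine integral_congr_ae (ae_of_all _ fun y => ?_)
    simp only
    rw [map_add, inner_add_left]
  rw [e1, e2, inner_cellOp, inner_cellRhs]
  ring

theorem CellCoeff.integral_eq (h : CellCoeff β D M lam Lam) (hb : ∀ᵐ y, b y = v + β y) :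
    ∫ y, b y = v := by
  rw [integral_congr_ae hb, integral_add (integrable_const v)
    (h.memLp_drift.integrable one_le_two), h.mean_zero]
  simp

/-- The weak equation, known for smooth tests, extends by density to every Sobolev test function, in
particular to those of zero mean. -/
theorem CellCoeff.isVarSolution (h : CellCoeff β D M lam Lam) (hb : ∀ᵐ y, b y = v + β y)
    {i : Fin d} {w : Tor d → ℝ} {g : Tor d → Sp d} (hs : IsCellSolution b D i w g) :
    IsVarSolution h.toBddCoeff v i ((memLp_jet hs.memLp hs.memLp_grad).toLp _) := by
  set f : Lp (Jet d) 2 (volume : Measure (Tor d)) := (memLp_jet hs.memLp hs.memLp_grad).toLp _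
    with hf
  have h1 : (fun y => (f y).fst) =ᵐ[volume] w := fst_toLp_jet _
  have h2 : (fun y => (f y).snd) =ᵐ[volume] g := snd_toLp_jet _
  constructor
  · rw [mem_cellSpace]
    refine ⟨fun φ hφ j => ?_, ?_⟩
    · have e1 : ∫ y, (f y).fst * torusGrad φ y j = ∫ y, w y * torusGrad φ y j := by
        refine integral_congr_ae ?_
        filter_upwards [h1] with y h1
        rw [h1]
      have e2 : ∫ y, (f y).snd j * φ y = ∫ y, g y j * φ y := by
        refine integral_congr_ae ?_
        filter_upwards [h2] with y h2
        rw [h2]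
      rw [e1, e2]
      exact hs.weakGrad φ hφ j
    · rw [integral_congr_ae h1]
      exact hs.mean_zero
  · intro k hk
    have hcl : IsClosed {k : Lp (Jet d) 2 (volume : Measure (Tor d)) |
        inner ℝ (cellOp h.toBddCoeff v f) k = inner ℝ (cellRhs h.toBddCoeff i) k} :=
      isClosed_eq (by fun_prop) (by fun_prop)
    refine hcl.closure_subset_iff.2 ?_ (mem_closure_testJets_torus hk.1)
    rintro k ⟨t, ⟨ht, ht'⟩, hkt⟩
    rw [Set.mem_ofPred_eq, ← sub_eq_zero, residual_eq h.toBddCoeff hb]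
    have he := hs.equation t.1 ht
    rw [h.integral_eq hb] at he
    have e1 : ∫ y, inner ℝ (b y) ((f y).snd + stdVec i) * (k y).fst
        = ∫ y, inner ℝ (b y) (g y + stdVec i) * t.1 y := by
      refine integral_congr_ae ?_
      filter_upwards [h2, hkt] with y h2 h3
      rw [h2, h3, jet_fst]
    have e2 : ∫ y, inner ℝ ((D y).toEuclideanLin ((f y).snd + stdVec i)) (k y).snd
        = ∫ y, inner ℝ ((D y).toEuclideanLin (g y + stdVec i)) (torusGrad t.1 y) := by
      refine integral_congr_ae ?_
      filter_upwards [h2, hkt] with y h2 h3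
      rw [h2, h3, jet_snd, ht']
    have e3 : ∫ y, (k y).fst = ∫ y, t.1 y := by
      refine integral_congr_ae ?_
      filter_upwards [hkt] with y h3
      rw [h3, jet_fst]
    rw [e1, e2, e3, he, sub_self]

/-- The variational problem only allows zero-mean tests. A general φ is split into φ - ∫φ and a
constant; against constants the equation holds because ∫ b·∇w = 0 and ∫ b·e_i = v_i. -/
theorem CellCoeff.isCellSolution (h : CellCoeff β D M lam Lam) (hb : ∀ᵐ y, b y = v + β y)
    {i : Fin d} {f : Lp (Jet d) 2 (volume : Measure (Tor d))}
    (hf : IsVarSolution h.toBddCoeff v i f) :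
    IsCellSolution b D i (fun y => (f y).fst) (fun y => (f y).snd) where
  memLp := memLp_fst f
  memLp_grad := memLp_snd f
  weakGrad := (mem_cellSpace.1 hf.1).1
  mean_zero := (mem_cellSpace.1 hf.1).2
  equation := by
    intro φ hφ
    rw [h.integral_eq hb]
    let one : Lp (Jet d) 2 (volume : Measure (Tor d)) :=
      (memLp_jet (memLp_const 1) (memLp_const 0)).toLp _
    have ho1 : (fun y => (one y).fst) =ᵐ[volume] fun _ => 1 := fst_toLp_jet _
    have ho2 : (fun y => (one y).snd) =ᵐ[volume] fun _ => 0 := snd_toLp_jet _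
    have hj := memLp_jet (memLp_of_continuous hφ.continuous 2)
      (memLp_of_continuous hφ.continuous_torusGrad 2)
    let k : Lp (Jet d) 2 (volume : Measure (Tor d)) := hj.toLp _
    have hk1 : (fun y => (k y).fst) =ᵐ[volume] φ := fst_toLp_jet _
    have hk2 : (fun y => (k y).snd) =ᵐ[volume] torusGrad φ := snd_toLp_jet _
    have hone : inner ℝ (cellOp h.toBddCoeff v f) one - inner ℝ (cellRhs h.toBddCoeff i) one
        = 0 := by
      rw [residual_eq h.toBddCoeff hb]
      have e1 : ∫ y, inner ℝ (b y) ((f y).snd + stdVec i) * (one y).fst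
          = (∫ y, inner ℝ (v + β y) (f y).snd) + ∫ y, inner ℝ (stdVec i) (b y) := by
        have hbi : Integrable b := (Integrable.congr ((integrable_const v).add
          (h.memLp_drift.integrable one_le_two)) (by
            filter_upwards [hb] with y hy
            rw [hy]; rfl))
        rw [← integral_add ((h.memLp_inner_drift v (memLp_snd f)).integrable one_le_two)
          (hbi.const_inner _)]
        refine integral_congr_ae ?_
        filter_upwards [ho1, hb] with y h1 h2
        rw [h1, mul_one, inner_add_right, real_inner_comm (b y) (stdVec i), h2]
      have e2 : ∫ y, inner ℝ ((D y).toEuclideanLin ((f y).snd + stdVec i)) (one y).snd = 0 := by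
        rw [← integral_zero (Tor d) ℝ]
        refine integral_congr_ae ?_
        filter_upwards [ho2] with y h2
        rw [h2, inner_zero_right]
      have hbi : Integrable b := (Integrable.congr ((integrable_const v).add
          (h.memLp_drift.integrable one_le_two)) (by
            filter_upwards [hb] with y hy
            rw [hy]; rfl))
      rw [e1, e2, integral_congr_ae ho1, h.drift_mean v hf.1.1, integral_inner hbi,
        h.integral_eq hb, real_inner_comm, inner_stdVec]
      simp
    have hmem : k - (∫ y, φ y) • one ∈ cellSpace d := by
      have hV : ∀ {t : Lp (Jet d) 2 (volume : Measure (Tor d))} {ψ : Tor d → ℝ},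
          IsTorusTest ψ → t =ᵐ[volume] jet ψ (torusGrad ψ) →
          t ∈ weakGradSpace volume (torusTests d) := fun hψ ht =>
        isTestSpace_torus.testJets_subset ⟨(_, _), ⟨hψ, rfl⟩, ht⟩
      refine ⟨Submodule.sub_mem _ (hV hφ hj.coeFn_toLp) (Submodule.smul_mem _ _
        (hV (isTorusTest_const 1) ?_)), ?_⟩
      · rw [torusGrad_const]
        exact MemLp.coeFn_toLp _
      · refine Submodule.mem_orthogonal_singleton_iff_inner_left.2 ?_
        change inner ℝ _ one = 0
        rw [inner_sub_left, inner_smul_left, inner_toLp_jet, inner_toLp_jet]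
        simp only [mul_one, inner_zero_right]
        rw [integral_congr_ae hk1, integral_congr_ae ho1]
        simp
    have hres := sub_eq_zero.2 (hf.2 _ hmem)
    rw [inner_sub_right, inner_sub_right, inner_smul_right, inner_smul_right] at hres
    have hk : inner ℝ (cellOp h.toBddCoeff v f) k - inner ℝ (cellRhs h.toBddCoeff i) k = 0 := by
      linear_combination hres + (∫ y, φ y) * hone
    rw [residual_eq h.toBddCoeff hb, sub_eq_zero] at hk
    have e1 : ∫ y, inner ℝ (b y) ((f y).snd + stdVec i) * (k y).fst
        = ∫ y, inner ℝ (b y) ((f y).snd + stdVec i) * φ y := by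
      refine integral_congr_ae ?_
      filter_upwards [hk1] with y h1
      rw [h1]
    have e2 : ∫ y, inner ℝ ((D y).toEuclideanLin ((f y).snd + stdVec i)) (k y).snd
        = ∫ y, inner ℝ ((D y).toEuclideanLin ((f y).snd + stdVec i)) (torusGrad φ y) := by
      refine integral_congr_ae ?_
      filter_upwards [hk2] with y h1
      rw [h1]
    rw [e1, e2, integral_congr_ae hk1] at hk
    exact hk

/-- Existence makes the `Classical.epsilon` choice an actual solution, and uniqueness identifies it
with the variational one up to null sets. -/
theorem CellCoeff.cellPair_ae_eq (h : CellCoeff β D M lam Lam) (hb : ∀ᵐ y, b y = v + β y)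
    {i : Fin d} {f : Lp (Jet d) 2 (volume : Measure (Tor d))}
    (hf : IsVarSolution h.toBddCoeff v i f) :
    (∀ᵐ y, cellSol b D i y = (f y).fst) ∧ ∀ᵐ y, cellGrad b D i y = (f y).snd := by
  have hs : IsCellSolution b D i (cellSol b D i) (cellGrad b D i) :=
    Classical.epsilon_spec (p := fun p : (Tor d → ℝ) × (Tor d → Sp d) =>
      IsCellSolution b D i p.1 p.2) ⟨(_, _), h.isCellSolution hb hf⟩
  have e := h.varSolution_unique hf (h.isVarSolution hb hs)
  have h1 := fst_toLp_jet (memLp_jet hs.memLp hs.memLp_grad)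
  have h2 := snd_toLp_jet (memLp_jet hs.memLp hs.memLp_grad)
  rw [← e] at h1 h2
  exact ⟨h1.symm, h2.symm⟩

/-- The matrix of the cell problems in terms of the variational solutions. -/
def varMatrix (h : BddCoeff β D M Lam)
    (f : Fin d → Lp (Jet d) 2 (volume : Measure (Tor d))) (i j : Fin d) : ℝ :=
  inner ℝ (diffOp h (f j + constJet (stdVec j))) (f i + constJet (stdVec i))
    + (inner ℝ (cellRhs h i) (f j) - inner ℝ (diffOp h (f i)) (f j))
    + inner ℝ (diffOp h (f j)) (constJet (stdVec i))
    - inner ℝ (diffOp h (f i)) (constJet (stdVec j))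

theorem add_constJet_snd (f : Lp (Jet d) 2 (volume : Measure (Tor d))) (ξ : Sp d) :
    ∀ᵐ y, ((f + constJet ξ) y).snd = (f y).snd + ξ := by
  filter_upwards [Lp.coeFn_add f (constJet ξ), coeFn_constJet ξ] with y h1 h2
  rw [h1, Pi.add_apply, WithLp.add_snd, h2, jet_snd]

theorem CellCoeff.cellMatrix_eq (h : CellCoeff β D M lam Lam) (hb : ∀ᵐ y, b y = v + β y)
    {f : Fin d → Lp (Jet d) 2 (volume : Measure (Tor d))}
    (hf : ∀ i, IsVarSolution h.toBddCoeff v i (f i)) (i j : Fin d) :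
    cellMatrix b D i j = varMatrix h.toBddCoeff f i j := by
  have hw := fun i => (h.cellPair_ae_eq hb (hf i)).1
  have hg := fun i => (h.cellPair_ae_eq hb (hf i)).2
  -- The drift term contains the possibly unbounded mean v. The equation of f_i tested with f_j
  -- trades it for terms that involve only β and D.
  have hskew : inner ℝ (cellRhs h.toBddCoeff i) (f j) - inner ℝ (diffOp h.toBddCoeff (f i)) (f j)
      = ∫ y, inner ℝ (b y) (cellGrad b D i y) * cellSol b D j y := by
    rw [← (hf i).2 _ (hf j).1, inner_cellOp, add_sub_cancel_right]
    refine integral_congr_ae ?_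
    filter_upwards [hb, hg i, hw j] with y h1 h2 h3
    rw [h1, h2, h3]
  have e1 : inner ℝ (diffOp h.toBddCoeff (f j + constJet (stdVec j))) (f i + constJet (stdVec i))
      = ∫ y, inner ℝ ((D y).toEuclideanLin (cellGrad b D j y + stdVec j))
        (cellGrad b D i y + stdVec i) := by
    rw [inner_diffOp]
    refine integral_congr_ae ?_
    filter_upwards [hg i, hg j, add_constJet_snd (f i) (stdVec i),
      add_constJet_snd (f j) (stdVec j)] with y h1 h2 h3 h4
    rw [h1, h2, h3, h4]
  have e2 : ∀ i j : Fin d, inner ℝ (diffOp h.toBddCoeff (f j)) (constJet (stdVec i))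
      = ∫ y, inner ℝ ((D y).toEuclideanLin (cellGrad b D j y)) (stdVec i) := by
    intro i j
    rw [inner_diffOp]
    refine integral_congr_ae ?_
    filter_upwards [hg j, coeFn_constJet (d := d) (stdVec i)] with y h2 h3
    rw [h2, h3, jet_snd]
  rw [varMatrix, hskew, e1, e2, e2]
  rfl

theorem inner_toEuclideanLin_eq (A : Mat d) (ξ η : Sp d) :
    inner ℝ ξ (A.toEuclideanLin η) = ∑ i, ∑ j, ξ i * η j * A i j := by
  rw [PiLp.inner_apply]
  refine Finset.sum_congr rfl fun i _ => ?_
  rw [RCLike.inner_apply, conj_trivial, Matrix.toLpLin_apply]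
  simp only [Matrix.mulVec, dotProduct, Finset.sum_mul]
  exact Finset.sum_congr rfl fun j _ => by ring

theorem sum_smul_stdVec (ξ : Sp d) : ∑ i, ξ i • stdVec i = ξ := by
  ext j
  simp [stdVec, Pi.single_apply]

theorem sum_smul_constJet (ξ : Sp d) : ∑ i, ξ i • constJet (stdVec i) = constJet ξ := by
  let F : Sp d →ₗ[ℝ] Lp (Jet d) 2 (volume : Measure (Tor d)) :=
    { toFun := constJet
      map_add' := fun a b => by
        refine Lp.ext ?_
        filter_upwards [coeFn_constJet (a + b), coeFn_constJet a, coeFn_constJet b,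
          Lp.coeFn_add (constJet a) (constJet b)] with y h1 h2 h3 h4
        rw [h1, h4, Pi.add_apply, h2, h3]
        simp [jet, ← WithLp.toLp_add]
      map_smul' := fun c a => by
        refine Lp.ext ?_
        filter_upwards [coeFn_constJet (c • a), coeFn_constJet a,
          Lp.coeFn_smul c (constJet a)] with y h1 h2 h4
        rw [RingHom.id_apply, h1, h4, Pi.smul_apply, h2]
        simp [jet, ← WithLp.toLp_smul] }
  change ∑ i, ξ i • F (stdVec i) = F ξ
  simp_rw [← map_smul, ← map_sum, sum_smul_stdVec]

theorem sum_sum_inner {H : Type*} [NormedAddCommGroup H] [InnerProductSpace ℝ H] (B : H →L[ℝ] H)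
    (a c : Fin d → H) (ξ : Sp d) :
    ∑ i, ∑ j, ξ i * ξ j * inner ℝ (B (a j)) (c i)
      = inner ℝ (B (∑ i, ξ i • a i)) (∑ i, ξ i • c i) := by
  simp_rw [map_sum, map_smul, inner_sum, sum_inner, inner_smul_left, inner_smul_right,
    conj_trivial]
  refine Finset.sum_congr rfl fun i _ => Finset.sum_congr rfl fun j _ => by ring

/-- With F = Σ ξ_i f_i, the drift term of ξ·𝔅ξ becomes ∫ (b·∇F) F = 0 and the last two terms of 𝔅
cancel after exchanging i and j. The remaining Dirichlet energy of ∇F + ξ is bounded below by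
Jensen's inequality, since this field has mean ξ. -/
theorem CellCoeff.cellMatrix_coercive (h : CellCoeff β D M lam Lam) (hb : ∀ᵐ y, b y = v + β y)
    (ξ : Sp d) : lam * ‖ξ‖ ^ 2 ≤ inner ℝ ξ ((cellMatrix b D).toEuclideanLin ξ) := by
  choose f hf using fun i => h.exists_varSolution v i
  set A := diffOp h.toBddCoeff with hA
  set F := ∑ i, ξ i • f i with hF
  have hFV : F ∈ cellSpace d := Submodule.sum_mem _ fun i _ => Submodule.smul_mem _ _ (hf i).1
  have e : inner ℝ ξ ((cellMatrix b D).toEuclideanLin ξ)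
      = inner ℝ (A (F + constJet ξ)) (F + constJet ξ) := by
    rw [inner_toEuclideanLin_eq]
    -- The factors ξ_j ξ_i mark the terms in which the roles of i and j are swapped; their double
    -- sums are exchanged before being contracted.
    have e0 : ∀ i j, ξ i * ξ j * cellMatrix b D i j =
        ξ i * ξ j * inner ℝ (A (f j + constJet (stdVec j))) (f i + constJet (stdVec i))
        + ξ j * ξ i * inner ℝ ((cellOp h.toBddCoeff v - A) (f i)) (f j)
        + (ξ i * ξ j * inner ℝ (A (f j)) (constJet (stdVec i))
        - ξ j * ξ i * inner ℝ (A (f i)) (constJet (stdVec j))) := by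
      intro i j
      rw [h.cellMatrix_eq hb hf, varMatrix, ← (hf i).2 _ (hf j).1,
        _root_.sub_apply, inner_sub_left]
      ring
    simp_rw [e0, Finset.sum_add_distrib, Finset.sum_sub_distrib]
    rw [sum_sum_inner A (fun i => f i + constJet (stdVec i)) (fun i => f i + constJet (stdVec i)),
      sum_sum_inner A f (fun i => constJet (stdVec i)),
      Finset.sum_comm (f := fun i j =>
        ξ j * ξ i * inner ℝ ((cellOp h.toBddCoeff v - A) (f i)) (f j)),
      sum_sum_inner (cellOp h.toBddCoeff v - A) f f,
      Finset.sum_comm (f := fun i j => ξ j * ξ i * inner ℝ (A (f i)) (constJet (stdVec j))),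
      sum_sum_inner A f (fun i => constJet (stdVec i))]
    simp_rw [smul_add, Finset.sum_add_distrib, sum_smul_constJet]
    rw [← hF, _root_.sub_apply, inner_sub_left, inner_cellOp, h.drift_skew v hFV.1]
    ring
  rw [e]
  refine le_trans ?_ (h.diff_coercive _)
  have hpos := h.pos
  gcongr
  have hsq := (memLp_snd (F + constJet ξ)).integrable_norm_pow two_ne_zero
  have hin : ∫ y, inner ℝ ξ ((F + constJet ξ) y).snd = ‖ξ‖ ^ 2 := by
    have : ∫ y, inner ℝ ξ ((F + constJet ξ) y).snd
        = (∫ y, inner ℝ ξ (F y).snd) + ∫ y : Tor d, ‖ξ‖ ^ 2 := by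
      rw [← integral_add (integrable_inner_of_memLp (memLp_const ξ) (memLp_snd F))
        (integrable_const _)]
      refine integral_congr_ae ?_
      filter_upwards [add_constJet_snd F ξ] with y hy
      rw [hy, inner_add_right, real_inner_self_eq_norm_sq]
    rw [this, (mem_cellSpace.1 hFV).1.integral_inner_eq_zero (memLp_snd F)]
    simp
  -- Young's inequality under the integral: |ξ|² = ∫ ξ·(∇F + ξ) ≤ |ξ|²/2 + ½∫|∇F + ξ|².
  have hle : ∫ y, inner ℝ ξ ((F + constJet ξ) y).snd
      ≤ ∫ y, (‖ξ‖ ^ 2 / 2 + ‖((F + constJet ξ) y).snd‖ ^ 2 / 2) := by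
    refine integral_mono (integrable_inner_of_memLp (memLp_const ξ) (memLp_snd _))
      ((integrable_const _).add (hsq.div_const 2)) fun y => ?_
    have := real_inner_le_norm ξ ((F + constJet ξ) y).snd
    nlinarith [sq_nonneg (‖ξ‖ - ‖((F + constJet ξ) y).snd‖)]
  rw [hin, integral_add (integrable_const _) (hsq.div_const 2)] at hle
  have hdiv := integral_div (μ := (volume : Measure (Tor d))) 2
    fun y => ‖((F + constJet ξ) y).snd‖ ^ 2
  simp only [integral_const, probReal_univ, smul_eq_mul, one_mul] at hle
  linarith

/-- A bound for the entries of the cell matrices. -/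
def cellBound (M lam Lam : ℝ) : ℝ :=
  Lam * (2 * (M + Lam) / lam + 1) ^ 2 + (M + Lam) * (2 * (M + Lam) / lam)
    + Lam * (2 * (M + Lam) / lam) ^ 2 + 2 * Lam * (2 * (M + Lam) / lam)

/-- Cauchy–Schwarz is applied to each term of `varMatrix`, with R bounding the solutions. Since
`varMatrix` does not contain v, the bound is independent of it. -/
theorem CellCoeff.abs_cellMatrix_le (h : CellCoeff β D M lam Lam) (hb : ∀ᵐ y, b y = v + β y)
    (i j : Fin d) : |cellMatrix b D i j| ≤ cellBound M lam Lam := by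
  choose f hf using fun i => h.exists_varSolution v i
  rw [h.cellMatrix_eq hb hf, varMatrix, cellBound]
  set R := 2 * (M + Lam) / lam
  have hR : ∀ i, ‖f i‖ ≤ R := fun i => h.norm_varSolution_le (hf i)
  have hR0 : 0 ≤ R := (norm_nonneg _).trans (hR i)
  have hL := h.nonneg_diff
  have hM := h.nonneg_drift
  have hE : ∀ i : Fin d, ‖constJet (stdVec i)‖ ≤ 1 := fun i =>
    (norm_constJet_le _).trans (norm_stdVec i).le
  have hFE : ∀ i, ‖f i + constJet (stdVec i)‖ ≤ R + 1 := fun i =>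
    (norm_add_le _ _).trans (add_le_add (hR i) (hE i))
  have b1 := (abs_inner_diffOp_le h.toBddCoeff (f j + constJet (stdVec j))
    (f i + constJet (stdVec i))).trans
    (mul_le_mul_of_nonneg_left (mul_le_mul (hFE j) (hFE i) (norm_nonneg _) (by positivity)) hL)
  have b2 := (abs_real_inner_le_norm (cellRhs h.toBddCoeff i) (f j)).trans
    (mul_le_mul (norm_cellRhs_le _ i) (hR j) (norm_nonneg _) (by positivity))
  have b3 := (abs_inner_diffOp_le h.toBddCoeff (f i) (f j)).trans
    (mul_le_mul_of_nonneg_left (mul_le_mul (hR i) (hR j) (norm_nonneg _) (by positivity)) hL)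
  have b4 := fun i j => (abs_inner_diffOp_le h.toBddCoeff (f j) (constJet (stdVec i))).trans
    (mul_le_mul_of_nonneg_left (mul_le_mul (hR j) (hE i) (norm_nonneg _) (by positivity)) hL)
  have b5 := b4 i j
  have b6 := b4 j i
  rw [abs_le] at *
  constructor <;> nlinarith [b1.1, b1.2, b2.1, b2.2, b3.1, b3.2, b5.1, b5.2, b6.1, b6.2]

end CellMatrix

end MeanFlow
end

noncomputable section

namespace MeanFlow

/-! ### Measurable dependence of the cell problems on the slow variable -/

section Measurability

/-- A measurable representative is set to 0 where it violates the bound. Bounds valid at every point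
allow the cell operators to be defined for every x. -/
theorem AEStronglyMeasurable.exists_bounded_rep {Z F : Type*} [MeasurableSpace Z] {μ : Measure Z}
    [NormedAddCommGroup F] {f : Z → F} (hf : AEStronglyMeasurable f μ) {C : ℝ} (hC : 0 ≤ C)
    (hfC : ∀ᵐ z ∂μ, ‖f z‖ ≤ C) :
    ∃ g : Z → F, StronglyMeasurable g ∧ f =ᵐ[μ] g ∧ ∀ z, ‖g z‖ ≤ C := by
  classical
  refine ⟨fun z => if ‖hf.mk f z‖ ≤ C then hf.mk f z else 0, ?_, ?_, fun z => ?_⟩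
  · exact StronglyMeasurable.ite (hf.stronglyMeasurable_mk.norm.measurable measurableSet_Iic)
      hf.stronglyMeasurable_mk stronglyMeasurable_const
  · filter_upwards [hf.ae_eq_mk, hfC] with z h1 h2
    rw [← h1, if_pos h2]
  · by_cases h : ‖hf.mk f z‖ ≤ C
    · simp only [if_pos h]; exact h
    · simp only [if_neg h, norm_zero]; exact hC

theorem aestronglyMeasurable_clm_apply {H Ω : Type*} [NormedAddCommGroup H] [InnerProductSpace ℝ H]
    [SecondCountableTopology H] [MeasurableSpace Ω] {ν : Measure Ω}
    {T : Ω → H →L[ℝ] H} (hT : ∀ f, StronglyMeasurable fun z => T z f) {u : Ω → H}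
    (hu : AEStronglyMeasurable u ν) : AEStronglyMeasurable (fun z => T z (u z)) ν := by
  borelize H
  have h1 := stronglyMeasurable_uncurry_of_continuous_of_stronglyMeasurable
    (u := fun (f : H) z => T z f) (fun z => (T z).continuous) hT
  have h2 : AEMeasurable (fun z => (u z, z)) ν := hu.aemeasurable.prodMk aemeasurable_id
  exact h1.aestronglyMeasurable.comp_aemeasurable h2

variable {d : ℕ}

theorem secondCountable_torusL2 :
    SecondCountableTopology (Lp (Jet d) 2 (volume : Measure (Tor d))) := by
  have : Fact ((2 : ENNReal) ≠ ⊤) := ⟨ENNReal.ofNat_ne_top⟩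
  infer_instance

theorem isCellSolution_congr {b : Tor d → Sp d} {D D' : Tor d → Mat d} (h : D =ᵐ[volume] D')
    {i : Fin d} {w : Tor d → ℝ} {g : Tor d → Sp d} (hs : IsCellSolution b D i w g) :
    IsCellSolution b D' i w g where
  memLp := hs.memLp
  memLp_grad := hs.memLp_grad
  weakGrad := hs.weakGrad
  mean_zero := hs.mean_zero
  equation := fun φ hφ => by
    rw [← hs.equation φ hφ]
    congr 1
    refine integral_congr_ae ?_
    filter_upwards [h] with y hy
    rw [hy]

/-- The matrices agree exactly. Coefficients equal almost everywhere have the same solution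
predicate, hence the same `Classical.epsilon` choice. -/
theorem cellMatrix_congr {b : Tor d → Sp d} {D D' : Tor d → Mat d} (h : D =ᵐ[volume] D') :
    cellMatrix b D = cellMatrix b D' := by
  have hp : ∀ i, cellPair b D i = cellPair b D' i := fun i => by
    unfold cellPair
    congr 1
    ext p
    exact ⟨isCellSolution_congr h, isCellSolution_congr h.symm⟩
  have hw : cellSol b D = cellSol b D' := funext fun i => congrArg Prod.fst (hp i)
  have hg : cellGrad b D = cellGrad b D' := funext fun i => congrArg Prod.snd (hp i)
  ext i j
  simp only [cellMatrix, Matrix.of_apply]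
  rw [hw, hg]
  have e : ∀ q r : Tor d → Sp d,
      ∫ y, inner ℝ ((D y).toEuclideanLin (q y)) (r y)
        = ∫ y, inner ℝ ((D' y).toEuclideanLin (q y)) (r y) := fun q r => by
    refine integral_congr_ae ?_
    filter_upwards [h] with y hy
    rw [hy]
  rw [e, e _ fun _ => stdVec i, e _ fun _ => stdVec j]

/-- A bounded measurable family of coefficients. -/
structure BddFamily (β : Sp d → Tor d → Sp d) (D : Sp d → Tor d → Mat d) (M Lam : ℝ) : Prop where
  nonneg_drift : 0 ≤ M
  nonneg_diff : 0 ≤ Lam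
  meas_drift : StronglyMeasurable (Function.uncurry β)
  bdd_drift : ∀ x y, ‖β x y‖ ≤ M
  meas_diff : StronglyMeasurable fun p : Sp d × Tor d => matOp (D p.1 p.2)
  bdd_diff : ∀ x y, ‖matOp (D x y)‖ ≤ Lam

variable {β : Sp d → Tor d → Sp d} {D : Sp d → Tor d → Mat d} {M lam Lam : ℝ}

theorem BddFamily.coeff (h : BddFamily β D M Lam) (x : Sp d) : BddCoeff (β x) (D x) M Lam where
  nonneg_drift := h.nonneg_drift
  nonneg_diff := h.nonneg_diff
  meas_drift := (h.meas_drift.comp_measurable measurable_prodMk_left).aestronglyMeasurable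
  bdd_drift := ae_of_all _ (h.bdd_drift x)
  meas_diff := (h.meas_diff.comp_measurable
    (measurable_prodMk_left (x := x))).aestronglyMeasurable
  bdd_diff := ae_of_all _ (h.bdd_diff x)

theorem stronglyMeasurable_jet_snd (f : Lp (Jet d) 2 (volume : Measure (Tor d))) :
    StronglyMeasurable fun p : Sp d × Tor d => (f p.2).snd :=
  ((WithLp.sndL 2 ℝ ℝ (Sp d)).continuous.comp_stronglyMeasurable
    (Lp.stronglyMeasurable f)).comp_measurable measurable_snd

theorem stronglyMeasurable_jet_fst (f : Lp (Jet d) 2 (volume : Measure (Tor d))) :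
    StronglyMeasurable fun p : Sp d × Tor d => (f p.2).fst :=
  ((WithLp.fstL 2 ℝ ℝ (Sp d)).continuous.comp_stronglyMeasurable
    (Lp.stronglyMeasurable f)).comp_measurable measurable_snd

theorem BddFamily.meas_diff_apply (h : BddFamily β D M Lam) {g : Sp d × Tor d → Sp d}
    (hg : StronglyMeasurable g) :
    StronglyMeasurable fun p : Sp d × Tor d => (D p.1 p.2).toEuclideanLin (g p) :=
  (ContinuousLinearMap.id ℝ (Sp d →L[ℝ] Sp d)).continuous₂.comp_stronglyMeasurable
    (h.meas_diff.prodMk hg)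

theorem BddFamily.measurable_inner_diffOp (h : BddFamily β D M Lam)
    (f k : Lp (Jet d) 2 (volume : Measure (Tor d))) :
    Measurable fun x => inner ℝ (diffOp (h.coeff x) f) k := by
  simp_rw [inner_diffOp]
  refine (StronglyMeasurable.integral_prod_right ?_).measurable
  exact (h.meas_diff_apply (stronglyMeasurable_jet_snd f)).inner (stronglyMeasurable_jet_snd k)

theorem BddFamily.stronglyMeasurable_diffOp (h : BddFamily β D M Lam)
    (f : Lp (Jet d) 2 (volume : Measure (Tor d))) :
    StronglyMeasurable fun x => diffOp (h.coeff x) f := by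
  have := secondCountable_torusL2 (d := d)
  refine stronglyMeasurable_of_inner fun k => ?_
  have e : ∀ x, inner ℝ k (diffOp (h.coeff x) f) = inner ℝ (diffOp (h.coeff x) f) k :=
    fun x => real_inner_comm _ _
  simp_rw [e]
  exact h.measurable_inner_diffOp f k

theorem BddFamily.stronglyMeasurable_cellOp (h : BddFamily β D M Lam) {v : Sp d → Sp d}
    (hv : StronglyMeasurable v) (f : Lp (Jet d) 2 (volume : Measure (Tor d))) :
    StronglyMeasurable fun x => cellOp (h.coeff x) (v x) f := by
  have := secondCountable_torusL2 (d := d)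
  refine stronglyMeasurable_of_inner fun k => ?_
  have e : ∀ x, inner ℝ k (cellOp (h.coeff x) (v x) f) = inner ℝ (cellOp (h.coeff x) (v x) f) k :=
    fun x => real_inner_comm _ _
  simp_rw [e, inner_cellOp]
  refine Measurable.add ?_ (h.measurable_inner_diffOp f k)
  refine (StronglyMeasurable.integral_prod_right ?_).measurable
  have h1 : StronglyMeasurable fun p : Sp d × Tor d => v p.1 + β p.1 p.2 :=
    (hv.comp_measurable measurable_fst).add h.meas_drift
  exact (h1.inner (stronglyMeasurable_jet_snd f)).mul (stronglyMeasurable_jet_fst k)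

theorem BddFamily.stronglyMeasurable_cellRhs (h : BddFamily β D M Lam) (i : Fin d) :
    StronglyMeasurable fun x => cellRhs (h.coeff x) i := by
  have := secondCountable_torusL2 (d := d)
  refine stronglyMeasurable_of_inner fun k => ?_
  have e : ∀ x, inner ℝ k (cellRhs (h.coeff x) i) = inner ℝ (cellRhs (h.coeff x) i) k :=
    fun x => real_inner_comm _ _
  simp_rw [e, inner_cellRhs]
  refine Measurable.sub (Measurable.neg ?_) ?_
  · refine (StronglyMeasurable.integral_prod_right ?_).measurable
    have h1 : StronglyMeasurable fun p : Sp d × Tor d => β p.1 p.2 i :=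
      (EuclideanSpace.proj (𝕜 := ℝ) i).continuous.comp_stronglyMeasurable h.meas_drift
    exact h1.mul (stronglyMeasurable_jet_fst k)
  · refine (StronglyMeasurable.integral_prod_right ?_).measurable
    exact (h.meas_diff_apply stronglyMeasurable_const).inner (stronglyMeasurable_jet_snd k)

theorem BddFamily.aemeasurable_cellMatrix (h : BddFamily β D M Lam) {v : Sp d → Sp d}
    (hv : StronglyMeasurable v) {b : Sp d → Tor d → Sp d}
    (hc : ∀ᵐ x, CellCoeff (β x) (D x) M lam Lam) (hb : ∀ᵐ x, ∀ᵐ y, b x y = v x + β x y)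
    (hlam : 0 < lam) (i j : Fin d) : AEMeasurable fun x => cellMatrix (b x) (D x) i j := by
  classical
  have hsc := secondCountable_torusL2 (d := d)
  -- The solutions are chosen pointwise with no regard to measurability, which is recovered below
  -- from uniqueness; 0 is a default on a null set.
  let u : Fin d → Sp d → Lp (Jet d) 2 (volume : Measure (Tor d)) := fun i x =>
    if hx : ∃ f, IsVarSolution (h.coeff x) (v x) i f then hx.choose else 0
  have hu : ∀ i, ∀ᵐ x, IsVarSolution (h.coeff x) (v x) i (u i x) := fun i => by
    filter_upwards [hc] with x hx
    have he := hx.exists_varSolution (v x) i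
    have e : u i x = he.choose := dif_pos he
    rw [e]
    exact he.choose_spec
  have hum : ∀ i, AEStronglyMeasurable (u i) volume := fun i => by
    -- The operator bound K may depend on x and need not be bounded, so no bound on the mean field
    -- is required; the summand 1 makes it positive.
    refine aestronglyMeasurable_solution (T := fun x => cellOp (h.coeff x) (v x))
      (k := fun x => cellRhs (h.coeff x) i) (K := fun x => ‖v x‖ + M + Lam + 1)
      (cellSpace d) isClosed_cellSpace (half_pos hlam) ?_ ?_ ?_
      (h.stronglyMeasurable_cellOp hv) (h.stronglyMeasurable_cellRhs i) ?_ (hu i)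
    · exact ((hv.norm.measurable.add_const _).add_const _).add_const _
    · intro x
      have := h.nonneg_drift
      have := h.nonneg_diff
      positivity
    · exact fun x => (norm_cellOp_le _ _).trans (le_add_of_nonneg_right zero_le_one)
    · filter_upwards [hc] with x hx f hf
      exact hx.cellOp_coercive (v x) hf
  have hA : ∀ {p q : Sp d → Lp (Jet d) 2 (volume : Measure (Tor d))},
      AEStronglyMeasurable p volume → AEStronglyMeasurable q volume →
      AEStronglyMeasurable (fun x => inner ℝ (diffOp (h.coeff x) (p x)) (q x)) volume :=
    fun hp hq => (aestronglyMeasurable_clm_apply h.stronglyMeasurable_diffOp hp).inner hq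
  have hm : AEStronglyMeasurable (fun x => varMatrix (h.coeff x) (fun i => u i x) i j)
      volume := by
    have cj : ∀ i : Fin d, AEStronglyMeasurable (fun _ : Sp d => constJet (stdVec i)) volume :=
      fun i => aestronglyMeasurable_const
    exact (((hA ((hum j).add (cj j)) ((hum i).add (cj i))).add
      (((h.stronglyMeasurable_cellRhs i).aestronglyMeasurable.inner (hum j)).sub
        (hA (hum i) (hum j)))).add (hA (hum j) (cj i))).sub (hA (hum i) (cj j))
  refine hm.aemeasurable.congr ?_
  filter_upwards [hc, hb, ae_all_iff.2 hu] with x hx hbx hux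
  exact (hx.cellMatrix_eq hbx hux i j).symm

end Measurability

/-! ### Uniform bounds for the cell matrices of the given field and diffusion. -/

section Uniform

variable {d : ℕ}

/-- Polarisation: for symmetric nonnegative A, 4⟨η, Aξ⟩ = q(ξ+η) - q(ξ-η) ≤ Λ|ξ+η|². The vector η is
then taken parallel to Aξ with |η| = |ξ|. -/
theorem norm_matOp_le {A : Mat d} {Lam : ℝ} (hsymm : A.IsSymm) (hLam : 0 ≤ Lam)
    (h0 : ∀ ξ : Sp d, 0 ≤ inner ℝ ξ (A.toEuclideanLin ξ))
    (h : ∀ ξ : Sp d, inner ℝ ξ (A.toEuclideanLin ξ) ≤ Lam * ‖ξ‖ ^ 2) : ‖matOp A‖ ≤ Lam := by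
  have hsym : ∀ ξ η : Sp d, inner ℝ ξ (A.toEuclideanLin η) = inner ℝ η (A.toEuclideanLin ξ) := by
    intro ξ η
    rw [inner_toEuclideanLin_eq, inner_toEuclideanLin_eq, Finset.sum_comm]
    refine Finset.sum_congr rfl fun i _ => Finset.sum_congr rfl fun j _ => ?_
    rw [hsymm.apply]
    ring
  have hpol : ∀ ξ η : Sp d, 4 * inner ℝ η (A.toEuclideanLin ξ) ≤ Lam * ‖ξ + η‖ ^ 2 := by
    intro ξ η
    have h1 := h (ξ + η)
    have h2 := h0 (ξ - η)
    simp only [map_add, map_sub, inner_add_left, inner_add_right, inner_sub_left,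
      inner_sub_right] at h1 h2
    rw [hsym ξ η] at h1 h2
    linarith
  refine ContinuousLinearMap.opNorm_le_bound _ hLam fun ξ => ?_
  rw [matOp_apply]
  set η := A.toEuclideanLin ξ with hη
  rcases eq_or_ne η 0 with h3 | h3
  · rw [h3, norm_zero]; positivity
  have h4 : 0 < ‖η‖ := norm_pos_iff.2 h3
  have h5 := hpol ξ ((‖ξ‖ / ‖η‖) • η)
  rw [inner_smul_left, ← hη, real_inner_self_eq_norm_sq, conj_trivial] at h5
  have h6 : ‖ξ + (‖ξ‖ / ‖η‖) • η‖ ≤ 2 * ‖ξ‖ := by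
    refine (norm_add_le _ _).trans ?_
    rw [norm_smul, Real.norm_of_nonneg (by positivity), div_mul_cancel₀ _ h4.ne']
    linarith
  have h7 : Lam * ‖ξ + (‖ξ‖ / ‖η‖) • η‖ ^ 2 ≤ Lam * (2 * ‖ξ‖) ^ 2 := by gcongr
  have h8 : ‖ξ‖ / ‖η‖ * ‖η‖ ^ 2 = ‖ξ‖ * ‖η‖ := by field_simp
  rw [h8] at h5
  rcases eq_or_ne ξ 0 with h9 | h9
  · simp [hη, h9]
  have h10 : 0 < ‖ξ‖ := norm_pos_iff.2 h9
  by_contra! h11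
  nlinarith

/-- The matrix of an operator. -/
def opMat (L : Sp d →L[ℝ] Sp d) : Mat d := Matrix.toEuclideanLin.symm (L : Sp d →ₗ[ℝ] Sp d)

theorem matOp_opMat (L : Sp d →L[ℝ] Sp d) : matOp (opMat L) = L := by
  ext v : 1
  rw [matOp_apply, opMat, LinearEquiv.apply_symm_apply]
  rfl

theorem opMat_matOp (A : Mat d) : opMat (matOp A) = A := by
  unfold opMat matOp
  apply Matrix.toEuclideanLin.injective
  rw [LinearEquiv.apply_symm_apply]
  rfl

/-- The cell matrices are measurable in the slow variable, uniformly bounded and coercive. -/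
theorem exists_cellMatrix_bounds
    (b : Sp d → Tor d → Sp d) (D : Sp d → Tor d → Mat d)
    (hb_meas : AEStronglyMeasurable (fun p : Sp d × Tor d => b p.1 p.2) volume)
    (hb_bdd : ∃ M : ℝ, ∀ᵐ p : Sp d × Tor d, ‖b p.1 p.2 - meanField b p.1‖ ≤ M)
    (hb_mean : Continuous (meanField b)) (hb_divy : DivFreeY b)
    (hD_meas : ∀ i j, AEMeasurable (fun p : Sp d × Tor d => D p.1 p.2 i j) volume)
    (hD_symm : ∀ᵐ p : Sp d × Tor d, (D p.1 p.2).IsSymm)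
    (hD_coer : ∃ lam Lam : ℝ, 0 < lam ∧ 0 < Lam ∧
      ∀ᵐ p : Sp d × Tor d, ∀ ξ : Sp d,
        lam * ‖ξ‖ ^ 2 ≤ inner ℝ ξ ((D p.1 p.2).toEuclideanLin ξ) ∧
        inner ℝ ξ ((D p.1 p.2).toEuclideanLin ξ) ≤ Lam * ‖ξ‖ ^ 2) :
    (∀ i j, AEMeasurable fun x => cellMatrix (b x) (D x) i j) ∧
    ∃ lam R : ℝ, 0 < lam ∧ ∀ᵐ x,
      (∀ ξ : Sp d, lam * ‖ξ‖ ^ 2 ≤ inner ℝ ξ ((cellMatrix (b x) (D x)).toEuclideanLin ξ)) ∧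
      ∀ i j, |cellMatrix (b x) (D x) i j| ≤ R := by
  obtain ⟨M₀, hM₀⟩ := hb_bdd
  obtain ⟨lam, Lam, hlam, hLam, hcoer⟩ := hD_coer
  set M := max M₀ 0
  have hv : StronglyMeasurable (meanField b) := hb_mean.stronglyMeasurable
  have hβm : AEStronglyMeasurable (fun p : Sp d × Tor d => b p.1 p.2 - meanField b p.1) volume :=
    hb_meas.sub (hv.comp_measurable measurable_fst).aestronglyMeasurable
  -- The fluctuation, and below the diffusion operator, are replaced by jointly measurable,
  -- everywhere bounded versions. By Fubini, for almost every x these differ from the originals only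
  -- on a null set of y.
  obtain ⟨β, hβ, hβe, hβb⟩ := AEStronglyMeasurable.exists_bounded_rep hβm (le_max_right M₀ 0) (by
    filter_upwards [hM₀] with p hp
    exact hp.trans (le_max_left _ _))
  have hLm : AEStronglyMeasurable (fun p : Sp d × Tor d => matOp (D p.1 p.2)) volume := by
    have hD : AEMeasurable (fun (p : Sp d × Tor d) (i j : Fin d) => D p.1 p.2 i j) volume :=
      aemeasurable_pi_lambda _ fun i => aemeasurable_pi_lambda _ fun j => hD_meas i j
    exact continuous_matOp.comp_aestronglyMeasurable (β := Mat d) hD.aestronglyMeasurable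
  obtain ⟨L, hL, hLe, hLb⟩ := AEStronglyMeasurable.exists_bounded_rep hLm hLam.le (by
    filter_upwards [hcoer, hD_symm] with p h1 h2
    exact norm_matOp_le h2 hLam.le
      (fun ξ => le_trans (by positivity) (h1 ξ).1) (fun ξ => (h1 ξ).2))
  have hF : BddFamily (fun x y => β (x, y)) (fun x y => opMat (L (x, y))) M Lam :=
    { nonneg_drift := le_max_right _ _
      nonneg_diff := hLam.le
      meas_drift := hβ
      bdd_drift := fun x y => hβb (x, y)
      meas_diff := by simp_rw [matOp_opMat]; exact hL
      bdd_diff := fun x y => by rw [matOp_opMat]; exact hLb (x, y) }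
  have hβx : ∀ᵐ x, ∀ᵐ y, b x y - meanField b x = β (x, y) := Measure.ae_ae_of_ae_prod hβe
  have hbx : ∀ᵐ x, ∀ᵐ y, b x y = meanField b x + β (x, y) := by
    filter_upwards [hβx] with x hx
    filter_upwards [hx] with y hy
    rw [← hy]; abel
  have hLx : ∀ᵐ x, ∀ᵐ y, matOp (D x y) = L (x, y) := Measure.ae_ae_of_ae_prod hLe
  have hDx : ∀ᵐ x, D x =ᵐ[volume] fun y => opMat (L (x, y)) := by
    filter_upwards [hLx] with x hx
    filter_upwards [hx] with y hy
    rw [← hy, opMat_matOp]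
  have hcx := Measure.ae_ae_of_ae_prod hcoer
  have hcell : ∀ᵐ x, CellCoeff (fun y => β (x, y)) (fun y => opMat (L (x, y))) M lam Lam := by
    filter_upwards [hbx, hDx, hcx, hb_divy] with x h1 h2 h3 h4
    have hβL := (hF.coeff x).memLp_drift
    have hdiv : ∀ φ : Tor d → ℝ, IsTorusTest φ →
        ∫ y, inner ℝ (β (x, y)) (torusGrad φ y) = 0 := by
      intro φ hφ
      have hm := memLp_of_continuous hφ.continuous_torusGrad 2
      have hw : HasTorusWeakGrad φ (torusGrad φ) := fun ψ hψ i =>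
        isTestSpace_torus.parts (φ, torusGrad φ) ⟨hφ, rfl⟩ (ψ, torusGrad ψ) ⟨hψ, rfl⟩ i
      have e := h4 φ hφ
      have e1 : ∫ y, inner ℝ (b x y) (torusGrad φ y)
          = ∫ y, (inner ℝ (meanField b x) (torusGrad φ y)
            + inner ℝ (β (x, y)) (torusGrad φ y)) := by
        refine integral_congr_ae ?_
        filter_upwards [h1] with y hy
        rw [hy, inner_add_left]
      rw [e1, integral_add (integrable_inner_of_memLp (memLp_const _) hm)
        (integrable_inner_of_memLp hβL hm), hw.integral_inner_eq_zero hm, zero_add] at e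
      exact e
    have hmean : ∫ y, β (x, y) = 0 := by
      have e : meanField b x = ∫ y, (meanField b x + β (x, y)) := integral_congr_ae h1
      rw [integral_add (integrable_const _) (hβL.integrable one_le_two)] at e
      simpa using e
    exact
      { toBddCoeff := hF.coeff x
        pos := hlam
        div_free := hdiv
        mean_zero := hmean
        coercive := by
          filter_upwards [h2, h3] with y hy h3
          intro ξ
          rw [← hy]
          exact (h3 ξ).1 }
  constructor
  · intro i j
    refine (hF.aemeasurable_cellMatrix hv hcell hbx hlam i j).congr ?_
    filter_upwards [hDx] with x hx
    rw [cellMatrix_congr hx]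
  · refine ⟨lam, cellBound M lam Lam, hlam, ?_⟩
    filter_upwards [hcell, hbx, hDx] with x h1 h2 h3
    rw [cellMatrix_congr h3]
    exact ⟨h1.cellMatrix_coercive h2, h1.abs_cellMatrix_le h2⟩

end Uniform

end MeanFlow
end

noncomputable section

namespace MeanFlow

/-! ### Flows of `C¹` vector fields -/

section Flow

/-- Reversed trajectories solve the equation of -v, so estimates for positive times suffice. -/
theorem hasDerivAt_trajectory_neg {E : Type*} [NormedAddCommGroup E] [NormedSpace ℝ E]
    {v : E → E} {γ : ℝ → E} (hγ : ∀ t, HasDerivAt γ (v (γ t)) t) (t : ℝ) :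
    HasDerivAt (fun s => γ (-s)) ((fun x => -v x) (γ (-t))) t := by
  have := (hγ (-t)).scomp t (hasDerivAt_neg t)
  simpa [Function.comp_def] using this

variable {E : Type*} [NormedAddCommGroup E] [NormedSpace ℝ E] [FiniteDimensional ℝ E]
  {v : E → E}

theorem exists_lipschitzOnWith_closedBall (hv : ContDiff ℝ 1 v) (R : ℝ) :
    ∃ K : NNReal, LipschitzOnWith K v (Metric.closedBall 0 R) := by
  have : ProperSpace E := FiniteDimensional.proper_real E
  obtain ⟨C, hC⟩ := (isCompact_closedBall (0 : E) R).exists_bound_of_continuousOn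
    (hv.continuous_fderiv one_ne_zero).continuousOn
  refine ⟨C.toNNReal, (convex_closedBall 0 R).lipschitzOnWith_of_nnnorm_fderiv_le
    (fun x _ => hv.differentiable one_ne_zero x) fun x hx => ?_⟩
  rw [← NNReal.coe_le_coe, coe_nnnorm]
  exact (hC x hx).trans (Real.le_coe_toNNReal C)

/-- Trajectories depend locally Lipschitz continuously on the initial point. -/
theorem exists_dist_trajectories_le (hv : ContDiff ℝ 1 v) {γ₀ : ℝ → E}
    (hγ₀ : ∀ t, HasDerivAt γ₀ (v (γ₀ t)) t) (T : ℝ) :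
    ∃ δ > 0, ∃ K : NNReal, ∀ γ γ' : ℝ → E, (∀ t, HasDerivAt γ (v (γ t)) t) →
      (∀ t, HasDerivAt γ' (v (γ' t)) t) → dist (γ 0) (γ₀ 0) < δ → dist (γ' 0) (γ₀ 0) < δ →
      ∀ t ∈ Set.Icc 0 T, dist (γ t) (γ' t) ≤ dist (γ 0) (γ' 0) * Real.exp (K * t) := by
  have hc : ∀ {γ : ℝ → E}, (∀ t, HasDerivAt γ (v (γ t)) t) → Continuous γ := fun h =>
    continuous_iff_continuousAt.2 fun t => (h t).continuousAt
  obtain ⟨R, hR⟩ := (isCompact_Icc (a := (0 : ℝ)) (b := T)).exists_bound_of_continuousOn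
    (hc hγ₀).continuousOn
  obtain ⟨K, hK⟩ := exists_lipschitzOnWith_closedBall hv (R + 1)
  have hgron : ∀ {γ γ' : ℝ → E} {a b δ : ℝ}, (∀ t, HasDerivAt γ (v (γ t)) t) →
      (∀ t, HasDerivAt γ' (v (γ' t)) t) →
      (∀ t ∈ Set.Ico a b, γ t ∈ Metric.closedBall 0 (R + 1)) →
      (∀ t ∈ Set.Ico a b, γ' t ∈ Metric.closedBall 0 (R + 1)) → dist (γ a) (γ' a) ≤ δ →
      ∀ t ∈ Set.Icc a b, dist (γ t) (γ' t) ≤ δ * Real.exp (K * (t - a)) :=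
    fun h h' hs hs' hd => dist_le_of_trajectories_ODE_of_mem (v := fun _ => v)
      (s := fun _ => Metric.closedBall 0 (R + 1)) (fun _ _ => hK) (hc h).continuousOn
      (fun t _ => (h t).hasDerivWithinAt) hs (hc h').continuousOn
      (fun t _ => (h' t).hasDerivWithinAt) hs' hd
  -- With this δ the Grönwall bound δ exp(Kt) stays below 1 up to time T. Trajectories starting
  -- δ-close to γ₀ thus remain in the ball of radius R + 1, where v is K-Lipschitz.
  set δ := Real.exp (-(K * |T|)) / 2 with hδ
  have hδ0 : 0 < δ := by positivity
  have hδT : ∀ t ≤ T, δ * Real.exp (K * t) < 1 := by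
    intro t ht
    have h1 : Real.exp (K * t) ≤ Real.exp (K * |T|) :=
      Real.exp_le_exp.2 (mul_le_mul_of_nonneg_left (ht.trans (le_abs_self T)) K.2)
    have h2 : Real.exp (-(K * |T|)) * Real.exp (K * |T|) = 1 := by
      rw [← Real.exp_add, neg_add_cancel, Real.exp_zero]
    rw [hδ]
    nlinarith [Real.exp_pos (-(K * |T|))]
  have hball : ∀ {γ : ℝ → E} {t : ℝ}, t ∈ Set.Icc 0 T → dist (γ t) (γ₀ t) ≤ 1 →
      γ t ∈ Metric.closedBall 0 (R + 1) := by
    intro γ t ht h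
    rw [mem_closedBall_zero_iff]
    have h1 := hR t ht
    have h2 := norm_sub_norm_le (γ t) (γ₀ t)
    rw [dist_eq_norm] at h
    linarith
  have hclose : ∀ γ : ℝ → E, (∀ t, HasDerivAt γ (v (γ t)) t) → dist (γ 0) (γ₀ 0) < δ →
      ∀ t ∈ Set.Icc 0 T, dist (γ t) (γ₀ t) ≤ δ * Real.exp (K * t) := by
    intro γ hγ h0
    have hcd : Continuous fun t => dist (γ t) (γ₀ t) := (hc hγ).dist (hc hγ₀)
    have hclosed : IsClosed {t | dist (γ t) (γ₀ t) ≤ δ * Real.exp (K * t)} :=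
      isClosed_le hcd (by fun_prop)
    -- Continuation argument: the times at which the bound holds form a closed set that can always
    -- be extended to the right. The strict inequality below 1 leaves room, and Grönwall restarted
    -- at s restores the same bound.
    refine (hclosed.inter isClosed_Icc).Icc_subset_of_forall_exists_gt (by simpa using h0.le) ?_
    rintro s ⟨hs, hs0, hsT⟩ y hy
    have hev : ∀ᶠ t in 𝓝 s, dist (γ t) (γ₀ t) < 1 :=
      (hcd.tendsto s).eventually_lt_const (lt_of_le_of_lt hs (hδT s hsT.le))
    obtain ⟨ε, hε, hεs⟩ := Metric.eventually_nhds_iff.1 hev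
    set r := min (min y T) (s + ε / 2) with hr
    have hsr : s < r := lt_min (lt_min hy hsT) (by linarith)
    have hry : r ≤ y := (min_le_left _ _).trans (min_le_left _ _)
    have hrT : r ≤ T := (min_le_left _ _).trans (min_le_right _ _)
    have hrε : r ≤ s + ε / 2 := min_le_right _ _
    refine ⟨r, ?_, hsr, hry⟩
    have hmem : ∀ t ∈ Set.Ico s r, t ∈ Set.Icc 0 T ∧ dist (γ t) (γ₀ t) ≤ 1 := by
      intro t ht
      refine ⟨⟨hs0.trans ht.1, ht.2.le.trans hrT⟩, (hεs ?_).le⟩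
      rw [Real.dist_eq, abs_of_nonneg (by linarith [ht.1])]
      linarith [ht.2]
    have h3 := hgron hγ hγ₀ (fun t ht => hball (hmem t ht).1 (hmem t ht).2)
      (fun t ht => hball (hmem t ht).1 (by rw [dist_self]; exact zero_le_one)) hs r
      ⟨hsr.le, le_rfl⟩
    rw [mul_assoc, ← Real.exp_add] at h3
    have e : (K : ℝ) * s + K * (r - s) = K * r := by ring
    rw [e] at h3
    exact h3
  refine ⟨δ, hδ0, K, fun γ γ' hγ hγ' h0 h0' t ht => ?_⟩
  have h3 := hgron hγ hγ' (a := 0) (b := T)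
    (fun t ht => hball (Set.Ico_subset_Icc_self ht)
      ((hclose γ hγ h0 t (Set.Ico_subset_Icc_self ht)).trans (hδT t ht.2.le).le))
    (fun t ht => hball (Set.Ico_subset_Icc_self ht)
      ((hclose γ' hγ' h0' t (Set.Ico_subset_Icc_self ht)).trans (hδT t ht.2.le).le)) le_rfl t ht
  rwa [sub_zero] at h3

theorem trajectory_unique (hv : ContDiff ℝ 1 v) {γ γ' : ℝ → E}
    (hγ : ∀ t, HasDerivAt γ (v (γ t)) t) (hγ' : ∀ t, HasDerivAt γ' (v (γ' t)) t)
    (h : γ 0 = γ' 0) : γ = γ' := by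
  have key : ∀ {v : E → E}, ContDiff ℝ 1 v → ∀ {γ γ' : ℝ → E},
      (∀ t, HasDerivAt γ (v (γ t)) t) → (∀ t, HasDerivAt γ' (v (γ' t)) t) → γ 0 = γ' 0 →
      ∀ t, 0 ≤ t → γ t = γ' t := by
    intro v hv γ γ' hγ hγ' h t ht
    obtain ⟨δ, hδ, K, H⟩ := exists_dist_trajectories_le hv hγ t
    have h1 := H γ γ' hγ hγ' (by simpa using hδ) (by rw [h, dist_self]; exact hδ) t ⟨ht, le_rfl⟩
    rw [h, dist_self, zero_mul] at h1
    exact dist_le_zero.1 h1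
  ext t
  rcases le_total 0 t with ht | ht
  · exact key hv hγ hγ' h t ht
  · have := key hv.neg (hasDerivAt_trajectory_neg hγ) (hasDerivAt_trajectory_neg hγ')
      (by simpa using h) (-t) (by linarith)
    simpa using this

theorem exists_dist_trajectories_le_symm (hv : ContDiff ℝ 1 v) {γ₀ : ℝ → E}
    (hγ₀ : ∀ t, HasDerivAt γ₀ (v (γ₀ t)) t) (T : ℝ) :
    ∃ δ > 0, ∃ L : NNReal, ∀ γ γ' : ℝ → E, (∀ t, HasDerivAt γ (v (γ t)) t) →
      (∀ t, HasDerivAt γ' (v (γ' t)) t) → dist (γ 0) (γ₀ 0) < δ → dist (γ' 0) (γ₀ 0) < δ →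
      ∀ t ∈ Set.Icc (-T) T, dist (γ t) (γ' t) ≤ L * dist (γ 0) (γ' 0) := by
  obtain ⟨δ₁, hδ₁, K₁, H₁⟩ := exists_dist_trajectories_le hv hγ₀ T
  obtain ⟨δ₂, hδ₂, K₂, H₂⟩ :=
    exists_dist_trajectories_le hv.neg (hasDerivAt_trajectory_neg hγ₀) T
  refine ⟨min δ₁ δ₂, lt_min hδ₁ hδ₂,
    (max (Real.exp (K₁ * T)) (Real.exp (K₂ * T))).toNNReal, ?_⟩
  intro γ γ' hγ hγ' h h' t ht
  rw [Real.coe_toNNReal _ (by positivity), mul_comm]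
  rcases le_total 0 t with h0 | h0
  · refine (H₁ γ γ' hγ hγ' (h.trans_le (min_le_left _ _)) (h'.trans_le (min_le_left _ _)) t
      ⟨h0, ht.2⟩).trans ?_
    gcongr
    refine le_trans ?_ (le_max_left _ _)
    exact Real.exp_le_exp.2 (mul_le_mul_of_nonneg_left ht.2 K₁.2)
  · have := H₂ _ _ (hasDerivAt_trajectory_neg hγ) (hasDerivAt_trajectory_neg hγ')
      (by simpa using h.trans_le (min_le_right _ _))
      (by simpa using h'.trans_le (min_le_right _ _)) (-t) ⟨by linarith, by linarith [ht.1]⟩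
    simp only [neg_neg, neg_zero] at this
    refine this.trans ?_
    gcongr
    refine le_trans ?_ (le_max_right _ _)
    exact Real.exp_le_exp.2 (mul_le_mul_of_nonneg_left (by linarith [ht.1]) K₂.2)

end Flow

/-! ### Flow maps: group law, null sets and Jacobians. -/

section FlowMap

variable {d : ℕ} {v : Sp d → Sp d} {Φ : ℝ → Sp d → Sp d}

theorem IsFlowOf.add (hΦ : IsFlowOf v Φ) (hv : ContDiff ℝ 1 v) (s t : ℝ) (x : Sp d) :
    Φ t (Φ s x) = Φ (t + s) x := by
  have h1 : ∀ r, HasDerivAt (fun r => Φ (r + s) x) (v (Φ (r + s) x)) r := fun r =>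
    ((hΦ x).2 (r + s)).comp_add_const r s
  have := trajectory_unique hv (hΦ (Φ s x)).2 h1 (by simp [(hΦ _).1])
  exact congrFun this t

theorem IsFlowOf.neg_apply (hΦ : IsFlowOf v Φ) (hv : ContDiff ℝ 1 v) (t : ℝ) (x : Sp d) :
    Φ (-t) (Φ t x) = x := by
  rw [hΦ.add hv, neg_add_cancel, (hΦ x).1]

theorem IsFlowOf.exists_lipschitz (hΦ : IsFlowOf v Φ) (hv : ContDiff ℝ 1 v) (x₀ : Sp d) (T : ℝ) :
    ∃ δ > 0, ∃ L : NNReal, ∀ t ∈ Set.Icc (-T) T, LipschitzOnWith L (Φ t) (Metric.ball x₀ δ) := by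
  obtain ⟨δ, hδ, L, H⟩ := exists_dist_trajectories_le_symm hv (hΦ x₀).2 T
  refine ⟨δ, hδ, L, fun t ht => LipschitzOnWith.of_dist_le_mul fun x hx y hy => ?_⟩
  have := H (fun s => Φ s x) (fun s => Φ s y) (hΦ x).2 (hΦ y).2
    (by simpa [(hΦ _).1] using hx) (by simpa [(hΦ _).1] using hy) t ht
  simpa [(hΦ _).1] using this

theorem IsFlowOf.continuous (hΦ : IsFlowOf v Φ) (hv : ContDiff ℝ 1 v) :
    Continuous (Function.uncurry Φ) := by
  rw [continuous_iff_continuousAt]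
  rintro ⟨t₀, x₀⟩
  obtain ⟨δ, hδ, L, H⟩ := hΦ.exists_lipschitz hv x₀ (|t₀| + 1)
  have hmem : Set.Ioo (t₀ - 1) (t₀ + 1) ×ˢ Metric.ball x₀ δ ∈ 𝓝 (t₀, x₀) :=
    prod_mem_nhds (Ioo_mem_nhds (by linarith) (by linarith)) (Metric.ball_mem_nhds x₀ hδ)
  refine ContinuousOn.continuousAt ?_ hmem
  refine continuousOn_prod_of_continuousOn_lipschitzOnWith' _ L (fun t ht => H t ⟨?_, ?_⟩) fun x _ t _ =>
    ((hΦ x).2 t).continuousAt.continuousWithinAt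
  · linarith [ht.1, neg_abs_le t₀]
  · linarith [ht.2, le_abs_self t₀]

/-- Lebesgue measure and d-dimensional Hausdorff measure have the same null sets, and Lipschitz maps
increase the latter by at most a constant factor. -/
theorem volume_image_eq_zero_of_lipschitzOnWith {f : Sp d → Sp d} {K : NNReal} {s : Set (Sp d)}
    (hf : LipschitzOnWith K f s) (hs : volume s = 0) : volume (f '' s) = 0 := by
  have hH : (volume : Measure (Sp d)) ≪ Measure.hausdorffMeasure d ∧
      Measure.hausdorffMeasure d ≪ (volume : Measure (Sp d)) := by
    have : (Measure.hausdorffMeasure d : Measure (Sp d)).IsAddHaarMeasure := by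
      simpa using MeasureTheory.isAddHaarMeasure_hausdorffMeasure (E := Sp d)
    exact ⟨Measure.absolutelyContinuous_isAddHaarMeasure _ _,
      Measure.absolutelyContinuous_isAddHaarMeasure _ _⟩
  refine hH.1 (le_antisymm ?_ bot_le)
  refine (hf.hausdorffMeasure_image_le (Nat.cast_nonneg d)).trans ?_
  rw [hH.2 hs, mul_zero]

/-- Locally the preimage of N under Φ_t lies in the image of a piece of N under Φ_{-t}, which is
Lipschitz near Φ_t(x). -/
theorem IsFlowOf.volume_preimage_eq_zero (hΦ : IsFlowOf v Φ) (hv : ContDiff ℝ 1 v) (t : ℝ)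
    {N : Set (Sp d)} (hN : volume N = 0) : volume (Φ t ⁻¹' N) = 0 := by
  refine measure_null_of_locally_null _ fun x hx => ?_
  obtain ⟨δ, hδ, L, H⟩ := hΦ.exists_lipschitz hv (Φ t x) |t|
  refine ⟨Φ t ⁻¹' (N ∩ Metric.ball (Φ t x) δ), ?_, ?_⟩
  · have hc : Continuous (Φ t) := (hΦ.continuous hv).comp (Continuous.prodMk_right t)
    rw [Set.preimage_inter]
    exact inter_mem_nhdsWithin _ (hc.continuousAt (Metric.ball_mem_nhds _ hδ))
  · refine measure_mono_null ?_ (volume_image_eq_zero_of_lipschitzOnWith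
      ((H (-t) ⟨by linarith [le_abs_self t], neg_le_abs t⟩).mono Set.inter_subset_right)
      (measure_mono_null Set.inter_subset_left hN))
    exact fun y hy => ⟨Φ t y, hy, hΦ.neg_apply hv t y⟩

theorem IsFlowOf.ae_comp (hΦ : IsFlowOf v Φ) (hv : ContDiff ℝ 1 v) (t : ℝ) {p : Sp d → Prop}
    (hp : ∀ᵐ x, p x) : ∀ᵐ x, p (Φ t x) :=
  hΦ.volume_preimage_eq_zero hv t hp

/-- Rademacher's theorem on small balls. Almost everywhere differentiability replaces the C¹
dependence on initial data. -/
theorem IsFlowOf.ae_differentiableAt (hΦ : IsFlowOf v Φ) (hv : ContDiff ℝ 1 v) (t : ℝ) :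
    ∀ᵐ x, DifferentiableAt ℝ (Φ t) x := by
  refine measure_null_of_locally_null _ fun x hx => ?_
  obtain ⟨δ, hδ, L, H⟩ := hΦ.exists_lipschitz hv x |t|
  have h1 := (H t ⟨neg_abs_le t, le_abs_self t⟩).ae_differentiableWithinAt_of_mem (μ := volume)
  refine ⟨{y | ¬ (y ∈ Metric.ball x δ → DifferentiableWithinAt ℝ (Φ t) (Metric.ball x δ) y)},
    ?_, h1⟩
  filter_upwards [self_mem_nhdsWithin, mem_nhdsWithin_of_mem_nhds (Metric.ball_mem_nhds x hδ)]
    with y hy hyb h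
  exact hy ((h hyb).differentiableAt (Metric.isOpen_ball.mem_nhds hyb))

theorem apply_eq_sum_stdVec (L : Sp d →L[ℝ] Sp d) (w : Sp d) (i : Fin d) :
    L w i = ∑ k, L (stdVec k) i * w k := by
  conv_lhs => rw [← sum_smul_stdVec w]
  rw [map_sum, WithLp.ofLp_sum, Finset.sum_apply]
  refine Finset.sum_congr rfl fun k _ => ?_
  rw [map_smul, PiLp.smul_apply, smul_eq_mul, mul_comm]

/-- The Jacobians of the flow maps `Φ_{-τ}` and `Φ_τ` are inverse to each other. -/
theorem IsFlowOf.flowJacobian_mul (hΦ : IsFlowOf v Φ) (hv : ContDiff ℝ 1 v) (t : ℝ) :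
    ∀ᵐ x, flowJacobian Φ t x * jacobian Φ (-t) x = 1 := by
  -- The chain rule needs Φ_{-t} differentiable at Φ_t(x), which holds for almost every x because
  -- Φ_t pulls null sets back to null sets.
  filter_upwards [hΦ.ae_differentiableAt hv t,
    hΦ.ae_comp hv t (hΦ.ae_differentiableAt hv (-t))] with x h1 h2
  have h3 := h2.hasFDerivAt.comp x h1.hasFDerivAt
  have e : Φ (-t) ∘ Φ t = id := funext fun y => hΦ.neg_apply hv t y
  rw [e] at h3
  have h4 := h3.unique (hasFDerivAt_id x)
  ext i j
  rw [Matrix.mul_apply, flowJacobian]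
  simp only [jacobian, Matrix.of_apply, neg_neg]
  rw [← apply_eq_sum_stdVec, ← ContinuousLinearMap.comp_apply, h4]
  simp [stdVec, Matrix.one_apply]

theorem IsFlowOf.measurable_jacobian (hΦ : IsFlowOf v Φ) (hv : ContDiff ℝ 1 v) (i j : Fin d) :
    Measurable fun p : ℝ × Sp d => jacobian Φ p.1 p.2 i j := by
  have hc : Continuous (Function.uncurry fun (t : ℝ) x => Φ (-t) x) := by
    have h : Continuous fun p : ℝ × Sp d => (-p.1, p.2) := by fun_prop
    exact (hΦ.continuous hv).comp h
  have h1 := measurable_fderiv_apply_const_with_param ℝ hc (stdVec j)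
  exact (EuclideanSpace.proj (𝕜 := ℝ) i).continuous.measurable.comp h1

theorem IsFlowOf.measurable_flowJacobian (hΦ : IsFlowOf v Φ) (hv : ContDiff ℝ 1 v) (i j : Fin d) :
    Measurable fun p : ℝ × Sp d => flowJacobian Φ p.1 p.2 i j :=
  (hΦ.measurable_jacobian hv i j).comp
    (measurable_fst.prodMk (hΦ.continuous hv).measurable)

end FlowMap

end MeanFlow
end

noncomputable section

namespace MeanFlow

/-! ### Fast time averages -/

section Average

variable {d : ℕ}

theorem toEuclideanLin_mul_apply (A B : Mat d) (x : Sp d) :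
    (A * B).toEuclideanLin x = A.toEuclideanLin (B.toEuclideanLin x) := by
  simp only [Matrix.toLpLin_apply, Matrix.mulVec_mulVec]

theorem inner_toEuclideanLin_transpose (A : Mat d) (x y : Sp d) :
    inner ℝ x (A.toEuclideanLin y) = inner ℝ (Aᵀ.toEuclideanLin x) y := by
  rw [real_inner_comm, real_inner_comm y, inner_toEuclideanLin_eq, real_inner_comm,
    inner_toEuclideanLin_eq, Finset.sum_comm]
  refine Finset.sum_congr rfl fun i _ => Finset.sum_congr rfl fun j _ => ?_
  rw [Matrix.transpose_apply, mul_comm (x j)]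

theorem norm_le_sum_abs (x : Sp d) : ‖x‖ ≤ ∑ i, |x i| := by
  conv_lhs => rw [← sum_smul_stdVec x]
  refine (norm_sum_le _ _).trans (Finset.sum_le_sum fun i _ => ?_)
  rw [norm_smul, norm_stdVec, mul_one, Real.norm_eq_abs]

theorem norm_toEuclideanLin_le {A : Mat d} {C : ℝ} (hA : ∀ i j, |A i j| ≤ C) (x : Sp d) :
    ‖A.toEuclideanLin x‖ ≤ d * (d * C) * ‖x‖ := by
  refine (norm_le_sum_abs _).trans ?_
  have h : ∀ i ∈ Finset.univ, |A.toEuclideanLin x i| ≤ d * C * ‖x‖ := by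
    intro i _
    rw [Matrix.toLpLin_apply]
    change |∑ j, A i j * x j| ≤ _
    refine (Finset.abs_sum_le_sum_abs _ _).trans ?_
    have h2 : ∀ j ∈ Finset.univ, |A i j * x j| ≤ C * ‖x‖ := fun j _ => by
      rw [abs_mul]
      exact mul_le_mul (hA i j) (PiLp.norm_apply_le x j) (abs_nonneg _)
        ((abs_nonneg _).trans (hA i j))
    refine (Finset.sum_le_card_nsmul _ _ _ h2).trans (le_of_eq ?_)
    rw [Finset.card_univ, Fintype.card_fin, nsmul_eq_mul, mul_assoc]
  refine (Finset.sum_le_card_nsmul _ _ _ h).trans (le_of_eq ?_)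
  rw [Finset.card_univ, Fintype.card_fin, nsmul_eq_mul]
  ring

theorem abs_mul_apply_le {A B : Mat d} {C R : ℝ} (hA : ∀ i j, |A i j| ≤ C)
    (hB : ∀ i j, |B i j| ≤ R) (i j : Fin d) : |(A * B) i j| ≤ d * (C * R) := by
  rw [Matrix.mul_apply]
  refine (Finset.abs_sum_le_sum_abs _ _).trans ?_
  have h : ∀ k ∈ Finset.univ, |A i k * B k j| ≤ C * R := fun k _ => by
    rw [abs_mul]
    exact mul_le_mul (hA i k) (hB k j) (abs_nonneg _) ((abs_nonneg _).trans (hA i k))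
  refine (Finset.sum_le_card_nsmul _ _ _ h).trans (le_of_eq ?_)
  rw [Finset.card_univ, Fintype.card_fin, nsmul_eq_mul]

/-- Congruence with an invertible matrix preserves coercivity. -/
theorem coercive_conj {J K Q : Mat d} {lam C : ℝ} (hlam : 0 ≤ lam) (hC : 0 ≤ C) (hJK : J * K = 1)
    (hK : ∀ i j, |K i j| ≤ C)
    (hQ : ∀ ξ : Sp d, lam * ‖ξ‖ ^ 2 ≤ inner ℝ ξ (Q.toEuclideanLin ξ)) (ξ : Sp d) :
    lam / (d * (d * C) + 1) ^ 2 * ‖ξ‖ ^ 2 ≤ inner ℝ ξ ((J * Q * Jᵀ).toEuclideanLin ξ) := by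
  rw [mul_assoc, toEuclideanLin_mul_apply, inner_toEuclideanLin_transpose,
    toEuclideanLin_mul_apply]
  refine le_trans ?_ (hQ _)
  have h1 : ξ = Kᵀ.toEuclideanLin (Jᵀ.toEuclideanLin ξ) := by
    rw [← toEuclideanLin_mul_apply, ← Matrix.transpose_mul, hJK, Matrix.transpose_one]
    simp
  -- The identity ξ = KᵀJᵀξ bounds |Jᵀξ| from below; the summand 1 keeps the constant positive when
  -- d or C is zero.
  have h2 : ‖ξ‖ ≤ (d * (d * C) + 1) * ‖Jᵀ.toEuclideanLin ξ‖ := by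
    conv_lhs => rw [h1]
    refine (norm_toEuclideanLin_le (C := C) (fun i j => hK j i) _).trans ?_
    gcongr
    linarith
  have hp : (0 : ℝ) < d * (d * C) + 1 := by positivity
  rw [div_mul_eq_mul_div, div_le_iff₀ (by positivity), mul_assoc]
  refine mul_le_mul_of_nonneg_left ?_ hlam
  calc ‖ξ‖ ^ 2 ≤ ((d * (d * C) + 1) * ‖Jᵀ.toEuclideanLin ξ‖) ^ 2 := by gcongr
    _ = _ := by ring

theorem le_average {f : ℝ → ℝ} {c ℓ : ℝ} (hℓ : 0 < ℓ) (hf : IntervalIntegrable f volume (-ℓ) ℓ)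
    (hc : ∀ᵐ t, c ≤ f t) : c ≤ 1 / (2 * ℓ) * ∫ t in (-ℓ)..ℓ, f t := by
  have h := intervalIntegral.integral_mono_ae (by linarith) intervalIntegrable_const hf hc
  rw [intervalIntegral.integral_const, smul_eq_mul] at h
  rw [div_mul_eq_mul_div, one_mul, le_div_iff₀ (by positivity)]
  linarith

variable {Q : Sp d → Mat d} {v : Sp d → Sp d} {Φ : ℝ → Sp d → Sp d}

/-- The integrand of the fast time averages. -/
def flowConj (Φ : ℝ → Sp d → Sp d) (Q : Sp d → Mat d) (τ : ℝ) (X : Sp d) : Mat d :=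
  flowJacobian Φ τ X * Q (Φ τ X) * (flowJacobian Φ τ X)ᵀ

theorem IsFlowOf.measurable_flowConj (hΦ : IsFlowOf v Φ) (hv : ContDiff ℝ 1 v)
    (hQ : ∀ i j, Measurable fun x => Q x i j) (i j : Fin d) :
    Measurable fun p : ℝ × Sp d => flowConj Φ Q p.1 p.2 i j := by
  simp only [flowConj, Matrix.mul_apply, Matrix.transpose_apply]
  refine Finset.measurable_sum _ fun k _ => (Finset.measurable_sum _ fun l _ =>
    (hΦ.measurable_flowJacobian hv i l).mul ((hQ l k).comp (hΦ.continuous hv).measurable)).mul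
      (hΦ.measurable_flowJacobian hv j k)

/-- Each Φ_τ pulls the exceptional set back to a null set, and Fubini exchanges the quantifiers over
τ and X. The exceptional set is first enlarged to a measurable null set, as Fubini requires. -/
theorem IsFlowOf.ae_ae_comp (hΦ : IsFlowOf v Φ) (hv : ContDiff ℝ 1 v) {p : Sp d → Prop}
    (hp : ∀ᵐ x, p x) : ∀ᵐ X, ∀ᵐ τ : ℝ, p (Φ τ X) := by
  have hm : MeasurableSet (toMeasurable volume {x | ¬ p x})ᶜ :=
    (measurableSet_toMeasurable _ _).compl
  have h0 : ∀ᵐ x, x ∈ (toMeasurable volume {x | ¬ p x})ᶜ := by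
    rw [ae_iff]
    simp only [Set.mem_compl_iff, not_not]
    exact (measure_toMeasurable _).trans hp
  have h1 : ∀ᵐ τ : ℝ, ∀ᵐ X, Φ τ X ∈ (toMeasurable volume {x | ¬ p x})ᶜ :=
    Eventually.of_forall fun τ => hΦ.ae_comp hv τ h0
  have h2 := (Measure.ae_ae_comm
    (p := fun τ X => Φ τ X ∈ (toMeasurable volume {x | ¬ p x})ᶜ) ((hΦ.continuous hv).measurable hm)).1 h1
  filter_upwards [h2] with X hX
  filter_upwards [hX] with τ hτ
  by_contra h
  exact hτ (subset_toMeasurable _ _ h)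

theorem IsFlowOf.ae_ae_flowJacobian_mul (hΦ : IsFlowOf v Φ) (hv : ContDiff ℝ 1 v) :
    ∀ᵐ X, ∀ᵐ τ : ℝ, flowJacobian Φ τ X * jacobian Φ (-τ) X = 1 := by
  refine (Measure.ae_ae_comm (p := fun (τ : ℝ) X => flowJacobian Φ τ X * jacobian Φ (-τ) X = 1)
    ?_).1 (Eventually.of_forall fun τ => hΦ.flowJacobian_mul hv τ)
  have : {p : ℝ × Sp d | flowJacobian Φ p.1 p.2 * jacobian Φ (-p.1) p.2 = 1}
      = ⋂ i, ⋂ j, {p : ℝ × Sp d | (flowJacobian Φ p.1 p.2 * jacobian Φ (-p.1) p.2) i j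
        = (1 : Mat d) i j} := by
    ext p
    simp only [Set.mem_iInter, Set.mem_ofPred_eq]
    exact ⟨fun h i j => by rw [h], fun h => Matrix.ext h⟩
  rw [this]
  refine MeasurableSet.iInter fun i => MeasurableSet.iInter fun j =>
    measurableSet_eq_fun ?_ measurable_const
  simp only [Matrix.mul_apply]
  refine Finset.measurable_sum _ fun k _ => (hΦ.measurable_flowJacobian hv i k).mul ?_
  exact (hΦ.measurable_jacobian hv k j).comp (measurable_fst.neg.prodMk measurable_snd)

/-- The bound on J covers all times of both signs, so it applies to J̃ and also to its inverse
J(-τ,X). The integrand is thus bounded and coercive with constants independent of τ and X, which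
averages and their limits inherit. -/
theorem isBoundedCoercive_average (hΦ : IsFlowOf v Φ) (hv : ContDiff ℝ 1 v) {lam C R : ℝ}
    (hJ : ∀ τ x i j, |jacobian Φ τ x i j| ≤ C) (hC : 0 ≤ C)
    (hQm : ∀ i j, AEMeasurable fun x => Q x i j) (hlam : 0 < lam)
    (hQ : ∀ᵐ x, (∀ ξ : Sp d, lam * ‖ξ‖ ^ 2 ≤ inner ℝ ξ ((Q x).toEuclideanLin ξ)) ∧
      ∀ i j, |Q x i j| ≤ R) {A : Sp d → Mat d}
    (hA : ∀ᵐ X, ∀ i j,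
      Tendsto (fun ℓ : ℝ => 1 / (2 * ℓ) * ∫ τ in (-ℓ)..ℓ, flowConj Φ Q τ X i j) atTop
        (𝓝 (A X i j))) : IsBoundedCoercive A := by
  -- A Borel version of Q makes the integrand jointly measurable in (τ, X), so that the averages are
  -- measurable in X; along almost every trajectory the two versions agree for almost every τ.
  set Q' : Sp d → Mat d := fun x => Matrix.of fun i j => (hQm i j).mk _ x with hQ'
  have hQ'm : ∀ i j, Measurable fun x => Q' x i j := fun i j => (hQm i j).measurable_mk
  have hQQ' : ∀ᵐ x, Q x = Q' x := by
    have : ∀ᵐ x, ∀ i j, Q x i j = (hQm i j).mk _ x :=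
      ae_all_iff.2 fun i => ae_all_iff.2 fun j => (hQm i j).ae_eq_mk
    filter_upwards [this] with x hx
    exact Matrix.ext hx
  have hm := hΦ.measurable_flowConj hv hQ'm
  have heq : ∀ᵐ X, ∀ᵐ τ : ℝ, flowConj Φ Q τ X = flowConj Φ Q' τ X := by
    filter_upwards [hΦ.ae_ae_comp hv hQQ'] with X hX
    filter_upwards [hX] with τ hτ
    rw [flowConj, hτ, flowConj]
  have hint : ∀ᵐ X, ∀ i j (ℓ : ℝ), ∫ τ in (-ℓ)..ℓ, flowConj Φ Q τ X i j
      = ∫ τ in (-ℓ)..ℓ, flowConj Φ Q' τ X i j := by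
    filter_upwards [heq] with X hX i j ℓ
    refine intervalIntegral.integral_congr_ae ?_
    filter_upwards [hX] with τ hτ _
    rw [hτ]
  constructor
  · intro i j
    have hmeas : ∀ ℓ : ℝ, AEMeasurable fun X =>
        1 / (2 * ℓ) * ∫ τ in (-ℓ)..ℓ, flowConj Φ Q τ X i j := by
      intro ℓ
      have h1 : ∀ a b : ℝ, Measurable fun X => ∫ τ in Set.Ioc a b, flowConj Φ Q' τ X i j :=
        fun a b => (StronglyMeasurable.integral_prod_left
          (f := fun τ X => flowConj Φ Q' τ X i j) (hm i j).stronglyMeasurable).measurable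
      refine AEMeasurable.const_mul (AEMeasurable.congr (f := fun X =>
        ∫ τ in (-ℓ)..ℓ, flowConj Φ Q' τ X i j) ?_ ?_) _
      · exact ((h1 _ _).sub (h1 _ _)).aemeasurable
      · filter_upwards [hint] with X hX
        exact (hX i j ℓ).symm
    refine aemeasurable_of_tendsto_metrizable_ae atTop hmeas ?_
    filter_upwards [hA] with X hX
    exact hX i j
  -- Each entry of J̃Q is at most dCR, and multiplication by J̃ᵀ contributes another factor dC.
  set S := d * (d * (C * R) * C) with hS
  refine ⟨lam / (d * (d * C) + 1) ^ 2, d * (d * S), by positivity, ?_⟩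
  filter_upwards [hA, heq, hΦ.ae_ae_comp hv hQ, hΦ.ae_ae_flowJacobian_mul hv] with X hlim he hq hJK
  have hbd : ∀ i j, ∀ᵐ τ : ℝ, |flowConj Φ Q τ X i j| ≤ S := by
    intro i j
    filter_upwards [hq] with τ h
    have := abs_mul_apply_le (abs_mul_apply_le (A := flowJacobian Φ τ X) (fun i j => hJ _ _ i j)
      h.2) (B := (flowJacobian Φ τ X)ᵀ) (C := d * (C * R)) (R := C) (fun i j => hJ _ _ j i) i j
    exact this
  have hii : ∀ i j (ℓ : ℝ),
      IntervalIntegrable (fun τ => flowConj Φ Q τ X i j) volume (-ℓ) ℓ := by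
    intro i j ℓ
    have h1 : AEStronglyMeasurable (fun τ => flowConj Φ Q τ X i j) volume := by
      refine ((hm i j).comp measurable_prodMk_right).aestronglyMeasurable.congr
        (f := fun τ => flowConj Φ Q' τ X i j) ?_
      filter_upwards [he] with τ hτ
      rw [hτ]
    refine (intervalIntegrable_const (c := S)).mono_fun h1.restrict ?_
    refine ae_restrict_of_ae ?_
    filter_upwards [hbd i j] with τ hτ
    exact hτ.trans (le_abs_self S)
  have hent : ∀ i j, |A X i j| ≤ S := by
    intro i j
    rw [abs_le]
    constructor
    · refine ge_of_tendsto (hlim i j) ?_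
      filter_upwards [eventually_gt_atTop 0] with ℓ hℓ
      refine le_average hℓ (hii i j ℓ) ?_
      filter_upwards [hbd i j] with τ hτ
      exact (abs_le.1 hτ).1
    · rw [← neg_le_neg_iff]
      refine ge_of_tendsto (hlim i j).neg ?_
      filter_upwards [eventually_gt_atTop 0] with ℓ hℓ
      have h := le_average (f := fun τ => -flowConj Φ Q τ X i j) (c := -S) hℓ (hii i j ℓ).neg (by
        filter_upwards [hbd i j] with τ hτ
        exact neg_le_neg (abs_le.1 hτ).2)
      rwa [intervalIntegral.integral_neg, mul_neg] at h
  intro ξ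
  refine ⟨?_, norm_toEuclideanLin_le hent ξ⟩
  have hsum : Tendsto (fun ℓ : ℝ => ∑ i, ∑ j, ξ i * ξ j *
      (1 / (2 * ℓ) * ∫ τ in (-ℓ)..ℓ, flowConj Φ Q τ X i j)) atTop
      (𝓝 (∑ i, ∑ j, ξ i * ξ j * A X i j)) :=
    tendsto_finsetSum _ fun i _ => tendsto_finsetSum _ fun j _ => (hlim i j).const_mul _
  rw [inner_toEuclideanLin_eq]
  refine ge_of_tendsto hsum ?_
  filter_upwards [eventually_gt_atTop 0] with ℓ hℓ
  have hi1 : ∀ i, IntervalIntegrable (fun τ => ∑ j, ξ i * ξ j * flowConj Φ Q τ X i j) volume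
      (-ℓ) ℓ := fun i => by
    have := IntervalIntegrable.sum Finset.univ
      (f := fun j τ => ξ i * ξ j * flowConj Φ Q τ X i j) fun j _ => (hii i j ℓ).const_mul _
    rwa [Finset.sum_fn] at this
  have hi2 : IntervalIntegrable (fun τ => ∑ i, ∑ j, ξ i * ξ j * flowConj Φ Q τ X i j) volume
      (-ℓ) ℓ := by
    have := IntervalIntegrable.sum Finset.univ
      (f := fun i τ => ∑ j, ξ i * ξ j * flowConj Φ Q τ X i j) fun i _ => hi1 i
    rwa [Finset.sum_fn] at this
  have e : ∑ i, ∑ j, ξ i * ξ j * (1 / (2 * ℓ) * ∫ τ in (-ℓ)..ℓ, flowConj Φ Q τ X i j)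
      = 1 / (2 * ℓ) * ∫ τ in (-ℓ)..ℓ, inner ℝ ξ ((flowConj Φ Q τ X).toEuclideanLin ξ) := by
    simp_rw [inner_toEuclideanLin_eq]
    rw [intervalIntegral.integral_finsetSum fun i _ => hi1 i, Finset.mul_sum]
    refine Finset.sum_congr rfl fun i _ => ?_
    rw [intervalIntegral.integral_finsetSum fun j _ => (hii i j ℓ).const_mul _, Finset.mul_sum]
    refine Finset.sum_congr rfl fun j _ => ?_
    rw [intervalIntegral.integral_const_mul]
    ring
  rw [e]
  refine le_average hℓ ?_ ?_
  · simp_rw [inner_toEuclideanLin_eq]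
    exact hi2
  · filter_upwards [hq, hJK] with τ h1 h2
    exact coercive_conj hlam.le hC h2 (fun i j => hJ _ _ i j) h1.1 ξ

end Average

end MeanFlow
end

noncomputable section

namespace MeanFlow

/-! ### Test functions on `ℝ^d` -/

section Euclidean

variable {d : ℕ}

/-- Smooth compactly supported functions. -/
def IsTest (φ : Sp d → ℝ) : Prop := ContDiff ℝ ∞ φ ∧ HasCompactSupport φ

/-- Partial derivatives. -/
def pderiv (i : Fin d) (φ : Sp d → ℝ) (x : Sp d) : ℝ := fderiv ℝ φ x (stdVec i)

/-- The gradient, through the partial derivatives. -/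
def spGrad (φ : Sp d → ℝ) (x : Sp d) : Sp d := WithLp.toLp 2 fun i => pderiv i φ x

@[simp] theorem spGrad_apply (φ : Sp d → ℝ) (x : Sp d) (i : Fin d) :
    spGrad φ x i = pderiv i φ x := rfl

theorem inner_spGrad (φ : Sp d → ℝ) (x v : Sp d) : inner ℝ v (spGrad φ x) = fderiv ℝ φ x v := by
  conv_rhs => rw [← sum_smul_stdVec v]
  simp [PiLp.inner_apply, pderiv, mul_comm]

theorem IsTest.differentiable {φ : Sp d → ℝ} (h : IsTest φ) : Differentiable ℝ φ :=
  h.1.differentiable (by simp)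

theorem IsTest.pderiv {φ : Sp d → ℝ} (h : IsTest φ) (i : Fin d) : IsTest (pderiv i φ) :=
  ⟨(h.1.fderiv_right (m := ∞) (by simp)).clm_apply contDiff_const, h.2.fderiv_apply ℝ (stdVec i)⟩

theorem IsTest.memLp {φ : Sp d → ℝ} (h : IsTest φ) : MemLp φ 2 volume :=
  h.1.continuous.memLp_of_hasCompactSupport h.2

theorem memLp_of_coord {X : Type*} [MeasurableSpace X] {μ : Measure X} {g : X → Sp d}
    (h : ∀ i, MemLp (fun x => g x i) 2 μ) : MemLp g 2 μ := by
  have e : g = fun x => ∑ i, g x i • stdVec i := funext fun x => (sum_smul_stdVec _).symm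
  rw [e]
  refine memLp_finsetSum _ fun i _ => ?_
  exact ((ContinuousLinearMap.id ℝ ℝ).smulRight (stdVec i)).comp_memLp' (h i)

theorem IsTest.memLp_spGrad {φ : Sp d → ℝ} (h : IsTest φ) : MemLp (spGrad φ) 2 volume :=
  memLp_of_coord fun i => (h.pderiv i).memLp

theorem IsTest.zero : IsTest (0 : Sp d → ℝ) := ⟨contDiff_const, HasCompactSupport.zero⟩

theorem IsTest.add {φ ψ : Sp d → ℝ} (h : IsTest φ) (h' : IsTest ψ) : IsTest (φ + ψ) :=
  ⟨h.1.add h'.1, h.2.add h'.2⟩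

theorem IsTest.smul {φ : Sp d → ℝ} (h : IsTest φ) (c : ℝ) : IsTest (c • φ) :=
  ⟨h.1.const_smul c, h.2.smul_left⟩

theorem IsTest.comp_sub_left {φ : Sp d → ℝ} (h : IsTest φ) (x : Sp d) :
    IsTest fun t => φ (x - t) :=
  ⟨h.1.comp (contDiff_const.sub contDiff_id), h.2.comp_homeomorph (Homeomorph.subLeft x)⟩

theorem pderiv_comp_sub_left {φ : Sp d → ℝ} (h : IsTest φ) (x : Sp d) (i : Fin d) :
    pderiv i (fun t => φ (x - t)) = fun t => -pderiv i φ (x - t) := by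
  ext t
  have h1 := (h.differentiable (x - t)).hasFDerivAt.comp t ((hasFDerivAt_id t).const_sub x)
  unfold pderiv
  rw [HasFDerivAt.fderiv (f := fun t => φ (x - t)) h1]
  simp

/-- Test functions on `ℝ^d` with their gradients. -/
def spTests (d : ℕ) : Set ((Sp d → ℝ) × (Sp d → Sp d)) := {t | IsTest t.1 ∧ t.2 = spGrad t.1}

theorem isTestSpace_sp : IsTestSpace volume (spTests d) where
  zero_mem := ⟨IsTest.zero, by ext x i; simp [pderiv]⟩
  add_mem := by
    rintro s ⟨hs, hs'⟩ t ⟨ht, ht'⟩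
    refine ⟨hs.add ht, ?_⟩
    ext x i
    simp only [Prod.snd_add, Pi.add_apply, hs', ht', PiLp.add_apply, spGrad_apply, pderiv,
      Prod.fst_add]
    rw [fderiv_add (hs.differentiable x) (ht.differentiable x)]
    rfl
  smul_mem := by
    rintro c t ⟨ht, ht'⟩
    refine ⟨ht.smul c, ?_⟩
    ext x i
    simp only [Prod.smul_snd, Pi.smul_apply, ht', PiLp.smul_apply, spGrad_apply, pderiv,
      Prod.smul_fst]
    rw [fderiv_const_smul (ht.differentiable x)]
    rfl
  memLp := by
    rintro t ⟨ht, ht'⟩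
    rw [ht']
    exact ⟨ht.memLp, ht.memLp_spGrad⟩
  parts := by
    rintro s ⟨hs, hs'⟩ t ⟨ht, ht'⟩ i
    rw [hs', ht']
    exact integral_mul_fderiv_eq_neg_fderiv_mul_of_integrable
      (integrable_mul_of_memLp (hs.pderiv i).memLp ht.memLp)
      (integrable_mul_of_memLp hs.memLp (ht.pderiv i).memLp)
      (integrable_mul_of_memLp hs.memLp ht.memLp)
      (fun x _ => hs.differentiable x) (fun x _ => ht.differentiable x)

theorem mem_spWeakGradSpace {f : Lp (Jet d) 2 (volume : Measure (Sp d))} :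
    f ∈ weakGradSpace volume (spTests d) ↔
      HasWeakGrad (fun x => (f x).fst) (fun x => (f x).snd) := by
  rw [mem_weakGradSpace isTestSpace_sp.memLp]
  constructor
  · intro h φ hφ hφ' i
    exact h (φ, spGrad φ) ⟨⟨hφ, hφ'⟩, rfl⟩ i
  · rintro h t ⟨⟨h1, h2⟩, h3⟩ i
    rw [h3]
    exact h t.1 h1 h2 i

/-- A positive second derivative would make the point a local minimum as well. The function would
then be locally constant, with second derivative zero. -/
theorem deriv_deriv_nonpos_of_isLocalMax {f : ℝ → ℝ} {x : ℝ} (h : IsLocalMax f x)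
    (hc : ContinuousAt f x) : deriv (deriv f) x ≤ 0 := by
  by_contra! hpos
  have hmin := isLocalMin_of_deriv_deriv_pos hpos h.deriv_eq_zero hc
  have hconst : f =ᶠ[𝓝 x] fun _ => f x := by
    filter_upwards [h, hmin] with y h1 h2
    exact le_antisymm h1 h2
  have h2 : deriv f =ᶠ[𝓝 x] deriv fun _ => f x := hconst.deriv
  have h3 := h2.deriv_eq
  simp only [deriv_const'] at h3
  rw [h3] at hpos
  exact lt_irrefl _ hpos

/-- The convolution with a test function. -/
def conv (w φ : Sp d → ℝ) (x : Sp d) : ℝ := ∫ t, w t * φ (x - t)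

theorem hasFDerivAt_conv {w φ : Sp d → ℝ} (hw : MemLp w 2 volume) (hφ : IsTest φ) (x : Sp d) :
    ∃ L : Sp d →L[ℝ] ℝ, HasFDerivAt (conv w φ) L x ∧
      ∀ i, L (stdVec i) = conv w (pderiv i φ) x := by
  have hl : LocallyIntegrable w volume := hw.locallyIntegrable one_le_two
  have h1 := hφ.2.hasFDerivAt_convolution_right (ContinuousLinearMap.mul ℝ ℝ) hl
    (hφ.1.of_le (by simp)) x
  refine ⟨_, h1, fun i => ?_⟩
  rw [convolution_precompR_apply _ hl (hφ.2.fderiv ℝ)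
    (hφ.1.continuous_fderiv (by simp))]
  rfl

theorem hasDerivAt_conv_line {w φ : Sp d → ℝ} (hw : MemLp w 2 volume) (hφ : IsTest φ) (x : Sp d)
    (i : Fin d) (s : ℝ) :
    HasDerivAt (fun s : ℝ => conv w φ (x + s • stdVec i))
      (conv w (pderiv i φ) (x + s • stdVec i)) s := by
  obtain ⟨L, hL, hi⟩ := hasFDerivAt_conv hw hφ (x + s • stdVec i)
  rw [← hi]
  have h1 : HasDerivAt (fun s : ℝ => x + s • stdVec (d := d) i) (stdVec i) s := by
    simpa using ((hasDerivAt_id s).smul_const (stdVec (d := d) i)).const_add x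
  exact hL.comp_hasDerivAt s h1

/-- Only the uniform boundedness of the convolution matters; it replaces compactness of the domain
in the maximum principle. -/
theorem abs_conv_le {w φ : Sp d → ℝ} (hw : MemLp w 2 volume) (hφ : IsTest φ) (x : Sp d) :
    |conv w φ x| ≤ (∫ t, w t ^ 2) + ∫ t, φ t ^ 2 := by
  have h2 := hφ.comp_sub_left x
  have e : ∫ t, φ t ^ 2 = ∫ t, φ (x - t) ^ 2 :=
    (integral_sub_left_eq_self (fun t => φ t ^ 2) volume x).symm
  rw [e, ← integral_add hw.integrable_sq h2.memLp.integrable_sq]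
  refine (abs_integral_le_integral_abs).trans (integral_mono
    (integrable_mul_of_memLp hw h2.memLp).abs (hw.integrable_sq.add h2.memLp.integrable_sq)
    fun t => ?_)
  simp only
  rw [abs_mul]
  nlinarith [sq_abs (w t), sq_abs (φ (x - t)), sq_nonneg (|w t| - |φ (x - t)|),
    sq_nonneg (w t), sq_nonneg (φ (x - t))]

/-- A maximum principle for `Δf = f`. -/
theorem conv_nonpos {w φ : Sp d → ℝ} (hw : MemLp w 2 volume) (hφ : IsTest φ)
    (heq : ∀ x, conv w φ x = ∑ i, conv w (pderiv i (pderiv i φ)) x) (x : Sp d) :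
    conv w φ x ≤ 0 := by
  set M := (∫ t, w t ^ 2) + ∫ t, φ t ^ 2
  have hM : ∀ x, |conv w φ x| ≤ M := abs_conv_le hw hφ
  have hcont : Continuous (conv w φ) := continuous_iff_continuousAt.2 fun x => by
    obtain ⟨L, hL, -⟩ := hasFDerivAt_conv hw hφ x
    exact hL.continuousAt
  -- Subtracting δ|x|² from the bounded function forces a maximum at some x₀. There each pure second
  -- derivative is at most 2δ, so the equation gives a value at most 2dδ. Comparison with x gives
  -- the bound, and δ then tends to 0.
  have key : ∀ δ : ℝ, 0 < δ → conv w φ x ≤ δ * (2 * d + ‖x‖ ^ 2) := by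
    intro δ hδ
    obtain ⟨x₀, hx₀⟩ : ∃ x₀, ∀ y, conv w φ y - δ * ‖y‖ ^ 2 ≤ conv w φ x₀ - δ * ‖x₀‖ ^ 2 := by
      refine Continuous.exists_forall_ge (by fun_prop) ?_
      have h1 : Tendsto (fun y : Sp d => M - δ * ‖y‖ ^ 2) (cocompact _) atBot := by
        refine tendsto_atBot_add_const_left _ M (tendsto_neg_atTop_atBot.comp
          (Tendsto.const_mul_atTop hδ ?_))
        exact (tendsto_pow_atTop two_ne_zero).comp tendsto_norm_cocompact_atTop
      exact tendsto_atBot_mono (fun y => sub_le_sub_right ((le_abs_self _).trans (hM y)) _) h1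
    have hi : ∀ i, conv w (pderiv i (pderiv i φ)) x₀ ≤ 2 * δ := by
      intro i
      have hn : ∀ s : ℝ, ‖x₀ + s • stdVec i‖ ^ 2 = ‖x₀‖ ^ 2 + 2 * (s * x₀ i) + s ^ 2 := by
        intro s
        rw [norm_add_sq_real, real_inner_smul_right, inner_stdVec, norm_smul, norm_stdVec,
          mul_one, Real.norm_eq_abs, sq_abs]
      have hd1 : ∀ s : ℝ, HasDerivAt
          (fun s : ℝ => conv w φ (x₀ + s • stdVec i) - δ * ‖x₀ + s • stdVec i‖ ^ 2)
          (conv w (pderiv i φ) (x₀ + s • stdVec i) - δ * (2 * x₀ i + 2 * s)) s := by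
        intro s
        simp_rw [hn]
        refine (hasDerivAt_conv_line hw hφ x₀ i s).sub (HasDerivAt.const_mul δ ?_)
        have := ((((hasDerivAt_id s).mul_const (x₀ i)).const_mul 2).const_add (‖x₀‖ ^ 2)).add
          ((hasDerivAt_id s).pow 2)
        refine (this.congr_deriv (by simp)).congr_of_eventuallyEq (Eventually.of_forall fun y => ?_)
        simp
      have hd2 : HasDerivAt
          (fun s : ℝ => conv w (pderiv i φ) (x₀ + s • stdVec i) - δ * (2 * x₀ i + 2 * s))
          (conv w (pderiv i (pderiv i φ)) (x₀ + (0 : ℝ) • stdVec i) - δ * 2) 0 := by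
        refine (hasDerivAt_conv_line hw (hφ.pderiv i) x₀ i 0).sub (HasDerivAt.const_mul δ ?_)
        simpa using ((hasDerivAt_id (0 : ℝ)).const_mul 2).const_add (2 * x₀ i)
      have hmax : IsLocalMax
          (fun s : ℝ => conv w φ (x₀ + s • stdVec i) - δ * ‖x₀ + s • stdVec i‖ ^ 2) 0 := by
        refine Eventually.of_forall fun s => ?_
        simpa using hx₀ (x₀ + s • stdVec i)
      have h3 := deriv_deriv_nonpos_of_isLocalMax hmax (hd1 0).continuousAt
      rw [show deriv _ = _ from funext fun s => (hd1 s).deriv, hd2.deriv, zero_smul,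
        add_zero] at h3
      linarith
    have h4 : conv w φ x₀ ≤ d * (2 * δ) := by
      rw [heq]
      refine (Finset.sum_le_card_nsmul _ _ _ fun i _ => hi i).trans (le_of_eq ?_)
      rw [Finset.card_univ, Fintype.card_fin, nsmul_eq_mul]
    have h5 := hx₀ x
    have h6 : 0 ≤ δ * ‖x₀‖ ^ 2 := by positivity
    linarith
  have hlim : Tendsto (fun δ : ℝ => δ * (2 * d + ‖x‖ ^ 2)) (𝓝[>] 0) (𝓝 0) := by
    have : Tendsto (fun δ : ℝ => δ * (2 * d + ‖x‖ ^ 2)) (𝓝 0) (𝓝 (0 * (2 * d + ‖x‖ ^ 2))) :=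
      (continuous_id.mul continuous_const).tendsto 0
    rw [zero_mul] at this
    exact this.mono_left nhdsWithin_le_nhds
  refine ge_of_tendsto hlim ?_
  filter_upwards [self_mem_nhdsWithin] with δ hδ
  exact key δ hδ

theorem conv_neg (w φ : Sp d → ℝ) (x : Sp d) : conv w (fun t => -φ t) x = -conv w φ x := by
  simp only [conv, mul_neg, integral_neg]

theorem pderiv_neg (i : Fin d) (φ : Sp d → ℝ) : pderiv i (fun t => -φ t) = fun t => -pderiv i φ t := by
  ext x
  simp [pderiv]

/-- An orthogonal pair h solves Δh = h in the distributional sense. Its convolutions with test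
functions solve the same equation classically and vanish by the maximum principle applied to φ and
-φ. Hence h, and then its gradient, is zero. -/
theorem mem_closure_testJets_sp {f : Lp (Jet d) 2 (volume : Measure (Sp d))}
    (hf : f ∈ weakGradSpace volume (spTests d)) : f ∈ closure (testJets volume (spTests d)) := by
  refine isTestSpace_sp.mem_closure_testJets (fun h hh ho => ?_) hf
  rw [mem_spWeakGradSpace] at hh
  have hw := memLp_fst h
  have hg := memLp_snd h
  have hpde : ∀ ψ, IsTest ψ →
      ∫ x, (h x).fst * ψ x = ∑ i, ∫ x, (h x).fst * pderiv i (pderiv i ψ) x := by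
    intro ψ hψ
    have h1 := ho (ψ, spGrad ψ) ⟨hψ, rfl⟩
    have h2 : ∫ x, inner ℝ (h x).snd (spGrad ψ x) = ∑ i, ∫ x, (h x).snd i * pderiv i ψ x := by
      rw [← integral_finsetSum _ fun i _ =>
        integrable_mul_of_memLp (memLp_coord hg i) (hψ.pderiv i).memLp]
      refine integral_congr_ae (ae_of_all _ fun x => ?_)
      simp [PiLp.inner_apply, mul_comm]
    simp only at h1
    rw [h2] at h1
    have h3 : ∀ i, ∫ x, (h x).fst * pderiv i (pderiv i ψ) x
        = -∫ x, (h x).snd i * pderiv i ψ x := fun i =>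
      hh (pderiv i ψ) (hψ.pderiv i).1 (hψ.pderiv i).2 i
    simp_rw [h3, Finset.sum_neg_distrib]
    linarith
  have hconv : ∀ φ, IsTest φ → ∀ x, conv (fun t => (h t).fst) φ x
      = ∑ i, conv (fun t => (h t).fst) (pderiv i (pderiv i φ)) x := by
    intro φ hφ x
    have := hpde _ (hφ.comp_sub_left x)
    simp_rw [pderiv_comp_sub_left hφ, pderiv_neg, pderiv_comp_sub_left (hφ.pderiv _),
      neg_neg] at this
    exact this
  have hzero : ∀ φ, IsTest φ → ∀ x, conv (fun t => (h t).fst) φ x = 0 := by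
    intro φ hφ x
    refine le_antisymm (conv_nonpos hw hφ (hconv φ hφ) x) ?_
    have hn : IsTest fun t => -φ t := ⟨hφ.1.neg, hφ.2.neg⟩
    have := conv_nonpos hw hn (hconv _ hn) x
    rw [conv_neg] at this
    linarith
  have hw0 : ∀ᵐ x, (h x).fst = 0 := by
    refine ae_eq_zero_of_integral_contDiff_smul_eq_zero (hw.locallyIntegrable one_le_two)
      fun φ h1 h2 => ?_
    have h3 := hzero _ (IsTest.comp_sub_left ⟨h1, h2⟩ 0) 0
    simp only [conv, sub_sub_cancel] at h3
    simp_rw [smul_eq_mul, mul_comm (φ _)]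
    exact h3
  have hg0 : ∀ i, ∀ᵐ x, (h x).snd i = 0 := by
    intro i
    refine ae_eq_zero_of_integral_contDiff_smul_eq_zero
      ((memLp_coord hg i).locallyIntegrable one_le_two) fun φ h1 h2 => ?_
    have h3 := hh φ h1 h2 i
    have h4 : ∫ x, (h x).fst * fderiv ℝ φ x (stdVec i) = 0 := by
      refine integral_eq_zero_of_ae ?_
      filter_upwards [hw0] with x hx
      rw [hx, zero_mul, Pi.zero_apply]
    simp_rw [smul_eq_mul, mul_comm (φ _)]
    linarith
  refine (Lp.eq_zero_iff_ae_eq_zero).2 ?_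
  filter_upwards [hw0, ae_all_iff.2 hg0] with x h1 h2
  have h3 : ‖h x‖ ^ 2 = 0 := by
    rw [jet_norm_sq, h1, show (h x).snd = 0 from by ext i; exact h2 i]
    simp
  simpa using h3

end Euclidean

end MeanFlow
end

noncomputable section

namespace MeanFlow

/-! ### Yosida approximation of coercive forms -/

section Yosida

set_option linter.unusedSectionVars false

variable {H V : Type*} [NormedAddCommGroup H] [InnerProductSpace ℝ H] [CompleteSpace H]
  [NormedAddCommGroup V] [InnerProductSpace ℝ V] [CompleteSpace V]

/-- A bounded form `⟪B v, w⟫` on `V`, coercive relatively to the space `H` into which `V` is densely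
mapped by `ι`. -/
structure IsFormPair (ι : V →L[ℝ] H) (B : V →L[ℝ] V) (c : ℝ) : Prop where
  pos : 0 < c
  norm_le : ∀ v, ‖ι v‖ ≤ ‖v‖
  coercive : ∀ v, c * (‖v‖ ^ 2 - ‖ι v‖ ^ 2) ≤ inner ℝ (B v) v
  dense : ∀ h, (∀ v, inner ℝ h (ι v) = 0) → h = 0

variable {ι : V →L[ℝ] H} {B : V →L[ℝ] V} {c : ℝ}

theorem IsFormPair.nonneg (hF : IsFormPair ι B c) (v : V) : 0 ≤ inner ℝ (B v) v := by
  refine le_trans ?_ (hF.coercive v)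
  have := hF.norm_le v
  have h : ‖ι v‖ ^ 2 ≤ ‖v‖ ^ 2 := by gcongr
  exact mul_nonneg hF.pos.le (by linarith)

/-- Lax–Milgram for n ι*ι + B: the condition n ≥ c absorbs the negative term of the Gårding
inequality. For the operator L of the form, R is n(n + L)⁻¹, normalised so that ιR is a contraction
of H. -/
theorem IsFormPair.exists_resolvent (hF : IsFormPair ι B c) {n : ℝ} (hn : c ≤ n) :
    ∃ R : H →L[ℝ] V, ∀ h w, n * inner ℝ (ι (R h)) (ι w) + inner ℝ (B (R h)) w
      = n * inner ℝ h (ι w) := by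
  let T : V →L[ℝ] V := n • (ContinuousLinearMap.adjoint ι).comp ι + B
  have hT : ∀ v w, inner ℝ (T v) w = n * inner ℝ (ι v) (ι w) + inner ℝ (B v) w := by
    intro v w
    simp only [T, _root_.add_apply, _root_.smul_apply, ContinuousLinearMap.comp_apply,
      inner_add_left, real_inner_smul_left, ContinuousLinearMap.adjoint_inner_left]
  let b : V →L[ℝ] V →L[ℝ] ℝ := (innerSL ℝ).comp T
  have hb : IsCoercive b := ⟨c, hF.pos, fun v => by
    change c * ‖v‖ * ‖v‖ ≤ inner ℝ (T v) v
    rw [hT, real_inner_self_eq_norm_sq]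
    nlinarith [hF.coercive v, sq_nonneg ‖ι v‖]⟩
  let e := hb.continuousLinearEquivOfBilin
  refine ⟨n • (e.symm : V →L[ℝ] V).comp (ContinuousLinearMap.adjoint ι), fun h w => ?_⟩
  rw [← hT]
  have := hb.continuousLinearEquivOfBilin_apply (e.symm (ContinuousLinearMap.adjoint ι h)) w
  rw [ContinuousLinearEquiv.apply_symm_apply, ContinuousLinearMap.adjoint_inner_left] at this
  simp only [_root_.smul_apply, ContinuousLinearMap.comp_apply, map_smul, real_inner_smul_left]
  rw [this]
  rfl

/-- The resolvent of the form. -/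
def resolvent (ι : V →L[ℝ] H) (B : V →L[ℝ] V) (n : ℝ) : H →L[ℝ] V :=
  Classical.epsilon fun R => ∀ h w, n * inner ℝ (ι (R h)) (ι w) + inner ℝ (B (R h)) w
      = n * inner ℝ h (ι w)

theorem IsFormPair.resolvent_spec (hF : IsFormPair ι B c) {n : ℝ} (hn : c ≤ n) (h : H) (w : V) :
    n * inner ℝ (ι (resolvent ι B n h)) (ι w) + inner ℝ (B (resolvent ι B n h)) w
      = n * inner ℝ h (ι w) :=
  Classical.epsilon_spec (hF.exists_resolvent hn) h w

theorem IsFormPair.eq_zero_of_resolvent (hF : IsFormPair ι B c) {n : ℝ} (hn : c ≤ n) {v : V}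
    (hv : ∀ w, n * inner ℝ (ι v) (ι w) + inner ℝ (B v) w = 0) : v = 0 := by
  have h := hv v
  rw [real_inner_self_eq_norm_sq] at h
  have h1 := hF.coercive v
  have h2 : c * ‖ι v‖ ^ 2 ≤ n * ‖ι v‖ ^ 2 := by gcongr
  have h3 : ‖v‖ ^ 2 ≤ 0 := by
    by_contra! h4
    nlinarith [mul_pos hF.pos h4]
  simpa using le_antisymm h3 (sq_nonneg _)

theorem IsFormPair.norm_resolvent_le (hF : IsFormPair ι B c) {n : ℝ} (hn : c ≤ n) (h : H) :
    ‖ι (resolvent ι B n h)‖ ≤ ‖h‖ := by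
  have hn0 : 0 < n := hF.pos.trans_le hn
  have h1 := hF.resolvent_spec hn h (resolvent ι B n h)
  rw [real_inner_self_eq_norm_sq] at h1
  have h2 := hF.nonneg (resolvent ι B n h)
  have h3 := mul_le_mul_of_nonneg_left (real_inner_le_norm h (ι (resolvent ι B n h))) hn0.le
  have h4 : n * ‖ι (resolvent ι B n h)‖ ^ 2 ≤ n * (‖h‖ * ‖ι (resolvent ι B n h)‖) := by linarith
  have h5 := le_of_mul_le_mul_left h4 hn0
  by_contra! h6
  nlinarith [norm_nonneg h]

/-- The Yosida approximation. -/
def yosida (ι : V →L[ℝ] H) (B : V →L[ℝ] V) (n : ℝ) : H →L[ℝ] H :=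
  n • (1 - ι.comp (resolvent ι B n))

theorem yosida_apply (n : ℝ) (h : H) : yosida ι B n h = n • (h - ι (resolvent ι B n h)) := rfl

/-- The Yosida approximation is L composed with the resolvent, so tested against V it is the form
evaluated at R h. -/
theorem IsFormPair.inner_yosida (hF : IsFormPair ι B c) {n : ℝ} (hn : c ≤ n) (h : H) (w : V) :
    inner ℝ (yosida ι B n h) (ι w) = inner ℝ (B (resolvent ι B n h)) w := by
  rw [yosida_apply, real_inner_smul_left, inner_sub_left, mul_sub, ← hF.resolvent_spec hn]
  ring

theorem IsFormPair.sub_resolvent (hF : IsFormPair ι B c) {n : ℝ} (hn : c ≤ n) (h : H) :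
    h = ι (resolvent ι B n h) + n⁻¹ • yosida ι B n h := by
  have hn0 : n ≠ 0 := (hF.pos.trans_le hn).ne'
  rw [yosida_apply, smul_smul, inv_mul_cancel₀ hn0, one_smul]
  abel

/-- On the domain of the operator the Yosida approximations are bounded. -/
theorem IsFormPair.norm_yosida_le (hF : IsFormPair ι B c) {n : ℝ} (hn : c ≤ n) {z : V} {y : H}
    (hz : ∀ w, inner ℝ (B z) w = inner ℝ y (ι w)) : ‖yosida ι B n (ι z)‖ ≤ ‖y‖ := by
  have hn0 : n ≠ 0 := (hF.pos.trans_le hn).ne'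
  -- On the domain L_n ιz = ιR(Lz). This follows from uniqueness for the resolvent equation, and the
  -- contraction property of ιR gives the bound.
  have h0 : n • (z - resolvent ι B n (ι z)) - resolvent ι B n y = 0 := by
    refine hF.eq_zero_of_resolvent hn fun w => ?_
    have h1 := hF.resolvent_spec hn (ι z) w
    have h2 := hF.resolvent_spec hn y w
    have h3 := hz w
    simp only [map_sub, map_smul, inner_sub_left, real_inner_smul_left]
    linear_combination (-n) * h1 - h2 + n * h3
  have h1 : yosida ι B n (ι z) = ι (resolvent ι B n y) := by
    rw [yosida_apply, ← map_sub, ← map_smul, sub_eq_zero.1 h0]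
  rw [h1]
  exact hF.norm_resolvent_le hn y

/-- Splitting h = ιRh + n⁻¹L_n h yields, besides the form, the term n⁻¹‖L_n h‖²; this extra
dissipation controls the gap between the approximate path and its image under ιR. -/
theorem IsFormPair.inner_yosida_self (hF : IsFormPair ι B c) {n : ℝ} (hn : c ≤ n) (h : H) :
    inner ℝ (yosida ι B n h) h = inner ℝ (B (resolvent ι B n h)) (resolvent ι B n h)
      + n⁻¹ * ‖yosida ι B n h‖ ^ 2 := by
  have e : inner ℝ (yosida ι B n h) h
      = inner ℝ (yosida ι B n h) (ι (resolvent ι B n h) + n⁻¹ • yosida ι B n h) := by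
    rw [← hF.sub_resolvent hn h]
  rw [e, inner_add_right, hF.inner_yosida hn, real_inner_smul_right, real_inner_self_eq_norm_sq]

/-- The approximate evolution `exp(-tL_n) x`. -/
def yosidaPath (ι : V →L[ℝ] H) (B : V →L[ℝ] V) (n : ℝ) (x : H) (t : ℝ) : H :=
  NormedSpace.exp (t • -yosida ι B n) x

theorem yosidaPath_zero (n : ℝ) (x : H) : yosidaPath ι B n x 0 = x := by
  simp [yosidaPath]

theorem hasDerivAt_yosidaPath (n : ℝ) (x : H) (t : ℝ) :
    HasDerivAt (yosidaPath ι B n x) (-yosida ι B n (yosidaPath ι B n x t)) t := by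
  have := (hasDerivAt_exp_smul_const' (-yosida ι B n) t).clm_apply (hasDerivAt_const t x)
  rw [map_zero, add_zero] at this
  exact this

theorem continuous_yosidaPath (n : ℝ) (x : H) : Continuous (yosidaPath ι B n x) :=
  continuous_iff_continuousAt.2 fun t => (hasDerivAt_yosidaPath n x t).continuousAt

theorem yosida_yosidaPath (n : ℝ) (x : H) (t : ℝ) :
    yosida ι B n (yosidaPath ι B n x t) = yosidaPath ι B n (yosida ι B n x) t := by
  have h : Commute (yosida ι B n) (NormedSpace.exp (t • -yosida ι B n)) :=
    Commute.exp_right (((Commute.refl _).neg_right).smul_right t)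
  exact DFunLike.congr_fun h.eq x

theorem yosidaPath_sub (n : ℝ) (x x' : H) (t : ℝ) :
    yosidaPath ι B n x t - yosidaPath ι B n x' t = yosidaPath ι B n (x - x') t :=
  (map_sub _ _ _).symm

/-- An integrated differential inequality. -/
theorem add_integral_le_of_deriv_le {f f' g : ℝ → ℝ} {C t : ℝ} (ht : 0 ≤ t)
    (hf : ∀ s, HasDerivAt f (f' s) s) (hf' : Continuous f') (hg : Continuous g)
    (h : ∀ s ∈ Set.Icc 0 t, f' s + g s ≤ C) : f t + ∫ s in 0..t, g s ≤ f 0 + C * t := by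
  have h1 := intervalIntegral.integral_eq_sub_of_hasDerivAt (a := 0) (b := t)
    (fun s _ => hf s) (hf'.intervalIntegrable _ _)
  have h2 := intervalIntegral.integral_mono_on ht
    ((hf'.intervalIntegrable 0 t).add (hg.intervalIntegrable 0 t)) (intervalIntegrable_const (μ := volume)) h
  rw [intervalIntegral.integral_const, intervalIntegral.integral_add (hf'.intervalIntegrable 0 t)
    (hg.intervalIntegrable 0 t), h1, smul_eq_mul] at h2
  linarith

/-- The approximate evolution in the form domain. -/
def yosidaForm (ι : V →L[ℝ] H) (B : V →L[ℝ] V) (n : ℝ) (x : H) (t : ℝ) : V :=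
  resolvent ι B n (yosidaPath ι B n x t)

theorem continuous_yosidaForm (n : ℝ) (x : H) : Continuous (yosidaForm ι B n x) :=
  (resolvent ι B n).continuous.comp (continuous_yosidaPath n x)

theorem yosidaForm_sub (n : ℝ) (x x' : H) (t : ℝ) :
    yosidaForm ι B n x t - yosidaForm ι B n x' t = yosidaForm ι B n (x - x') t := by
  rw [yosidaForm, yosidaForm, ← map_sub, yosidaPath_sub, yosidaForm]

theorem IsFormPair.energy (hF : IsFormPair ι B c) {n : ℝ} (hn : c ≤ n) (x : H) {t : ℝ}
    (ht : 0 ≤ t) :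
    1 / 2 * ‖yosidaPath ι B n x t‖ ^ 2
      + ∫ s in 0..t, (inner ℝ (B (yosidaForm ι B n x s)) (yosidaForm ι B n x s)
        + n⁻¹ * ‖yosida ι B n (yosidaPath ι B n x s)‖ ^ 2) ≤ 1 / 2 * ‖x‖ ^ 2 := by
  have hc := continuous_yosidaPath (ι := ι) (B := B) n x
  have hc' := continuous_yosidaForm (ι := ι) (B := B) n x
  have := add_integral_le_of_deriv_le (C := 0) ht
    (f := fun t => 1 / 2 * ‖yosidaPath ι B n x t‖ ^ 2)
    (g := fun s => inner ℝ (B (yosidaForm ι B n x s)) (yosidaForm ι B n x s)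
        + n⁻¹ * ‖yosida ι B n (yosidaPath ι B n x s)‖ ^ 2)
    (fun s => ((hasDerivAt_yosidaPath n x s).norm_sq).const_mul (1 / 2)) (by fun_prop)
    (by fun_prop) (fun s _ => by
      have := hF.inner_yosida_self hn (yosidaPath ι B n x s)
      rw [inner_neg_right, real_inner_comm, this, yosidaForm]
      linarith)
  simpa [yosidaPath_zero] using this

theorem IsFormPair.norm_yosidaPath_le (hF : IsFormPair ι B c) {n : ℝ} (hn : c ≤ n) (x : H) {t : ℝ}
    (ht : 0 ≤ t) : ‖yosidaPath ι B n x t‖ ≤ ‖x‖ := by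
  have h := hF.energy hn x ht
  have hn0 : 0 ≤ n := hF.pos.le.trans hn
  have h2 : 0 ≤ ∫ s in 0..t, (inner ℝ (B (yosidaForm ι B n x s)) (yosidaForm ι B n x s)
        + n⁻¹ * ‖yosida ι B n (yosidaPath ι B n x s)‖ ^ 2) :=
    intervalIntegral.integral_nonneg ht fun s _ =>
      add_nonneg (hF.nonneg _) (by positivity)
  refine le_of_sq_le_sq ?_ (norm_nonneg _)
  linarith

/-- The form controls the V-norm only modulo the H-norm. The H-norm is at most ‖x‖ at all times,
which accounts for the term t‖x‖². -/
theorem IsFormPair.integral_yosidaForm_le (hF : IsFormPair ι B c) {n : ℝ} (hn : c ≤ n) (x : H)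
    {t : ℝ} (ht : 0 ≤ t) :
    ∫ s in 0..t, ‖yosidaForm ι B n x s‖ ^ 2 ≤ (1 / (2 * c) + t) * ‖x‖ ^ 2 := by
  have hc := continuous_yosidaPath (ι := ι) (B := B) n x
  have hc' := continuous_yosidaForm (ι := ι) (B := B) n x
  have hn0 : 0 ≤ n := hF.pos.le.trans hn
  have h1 : ∫ s in 0..t, c * ‖yosidaForm ι B n x s‖ ^ 2
      ≤ ∫ s in 0..t, ((inner ℝ (B (yosidaForm ι B n x s)) (yosidaForm ι B n x s)
        + n⁻¹ * ‖yosida ι B n (yosidaPath ι B n x s)‖ ^ 2) + c * ‖x‖ ^ 2) := by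
    refine intervalIntegral.integral_mono_on ht (Continuous.intervalIntegrable (by fun_prop) _ _)
      (Continuous.intervalIntegrable (by fun_prop) _ _) fun s hs => ?_
    have h2 := hF.coercive (yosidaForm ι B n x s)
    have h3 : ‖ι (yosidaForm ι B n x s)‖ ≤ ‖x‖ :=
      (hF.norm_resolvent_le hn _).trans (hF.norm_yosidaPath_le hn x hs.1)
    have h4 : ‖ι (yosidaForm ι B n x s)‖ ^ 2 ≤ ‖x‖ ^ 2 := by gcongr
    have h5 : 0 ≤ n⁻¹ * ‖yosida ι B n (yosidaPath ι B n x s)‖ ^ 2 := by positivity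
    nlinarith [hF.pos]
  rw [intervalIntegral.integral_const_mul, intervalIntegral.integral_add
    (Continuous.intervalIntegrable (by fun_prop) _ _)
    (Continuous.intervalIntegrable (by fun_prop) _ _), intervalIntegral.integral_const,
    smul_eq_mul, sub_zero] at h1
  have h2 := hF.energy hn x ht
  have h3 := sq_nonneg ‖yosidaPath ι B n x t‖
  have hc0 := hF.pos
  have e : (1 / (2 * c) + t) * ‖x‖ ^ 2 = (1 / 2 * ‖x‖ ^ 2 + t * (c * ‖x‖ ^ 2)) / c := by
    field_simp
  rw [e, le_div_iff₀ hc0]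
  linarith

theorem IsFormPair.integral_sub_le (hF : IsFormPair ι B c) {n : ℝ} (hn : c ≤ n) (x : H)
    {t : ℝ} (ht : 0 ≤ t) :
    ∫ s in 0..t, ‖yosidaPath ι B n x s - ι (yosidaForm ι B n x s)‖ ^ 2 ≤ n⁻¹ * ‖x‖ ^ 2 := by
  have hc := continuous_yosidaPath (ι := ι) (B := B) n x
  have hc' := continuous_yosidaForm (ι := ι) (B := B) n x
  have hn0 : 0 < n := hF.pos.trans_le hn
  have h1 : ∫ s in 0..t, ‖yosidaPath ι B n x s - ι (yosidaForm ι B n x s)‖ ^ 2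
      ≤ ∫ s in 0..t, n⁻¹ * (inner ℝ (B (yosidaForm ι B n x s)) (yosidaForm ι B n x s)
        + n⁻¹ * ‖yosida ι B n (yosidaPath ι B n x s)‖ ^ 2) := by
    refine intervalIntegral.integral_mono_on ht (Continuous.intervalIntegrable (by fun_prop) _ _)
      (Continuous.intervalIntegrable (by fun_prop) _ _) fun s hs => ?_
    have h2 : yosidaPath ι B n x s - ι (yosidaForm ι B n x s)
        = n⁻¹ • yosida ι B n (yosidaPath ι B n x s) := by
      rw [sub_eq_iff_eq_add, add_comm]
      exact hF.sub_resolvent hn _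
    rw [h2, norm_smul, mul_pow, Real.norm_eq_abs, sq_abs, sq, mul_assoc]
    gcongr
    exact le_add_of_nonneg_left (hF.nonneg _)
  rw [intervalIntegral.integral_const_mul] at h1
  refine h1.trans (mul_le_mul_of_nonneg_left ?_ (by positivity))
  have h2 := hF.energy hn x ht
  nlinarith [sq_nonneg ‖yosidaPath ι B n x t‖, sq_nonneg ‖x‖]

/-- The comparison of two Yosida approximations, for initial data in the domain. -/
theorem IsFormPair.energy_sub (hF : IsFormPair ι B c) {n m : ℝ} (hn : c ≤ n) (hm : c ≤ m) {z : V}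
    {y : H} (hz : ∀ w, inner ℝ (B z) w = inner ℝ y (ι w)) {t : ℝ} (ht : 0 ≤ t) :
    1 / 2 * ‖yosidaPath ι B n (ι z) t - yosidaPath ι B m (ι z) t‖ ^ 2
      + ∫ s in 0..t, inner ℝ (B (yosidaForm ι B n (ι z) s - yosidaForm ι B m (ι z) s))
        (yosidaForm ι B n (ι z) s - yosidaForm ι B m (ι z) s)
      ≤ 2 * ‖y‖ ^ 2 * (n⁻¹ + m⁻¹) * t := by
  have hc := continuous_yosidaPath (ι := ι) (B := B) n (ι z)
  have hc' := continuous_yosidaForm (ι := ι) (B := B) n (ι z)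
  have hd := continuous_yosidaPath (ι := ι) (B := B) m (ι z)
  have hd' := continuous_yosidaForm (ι := ι) (B := B) m (ι z)
  have hn0 : 0 < n := hF.pos.trans_le hn
  have hm0 : 0 < m := hF.pos.trans_le hm
  have := add_integral_le_of_deriv_le (C := 2 * ‖y‖ ^ 2 * (n⁻¹ + m⁻¹)) ht
    (f := fun t => 1 / 2 * ‖yosidaPath ι B n (ι z) t - yosidaPath ι B m (ι z) t‖ ^ 2)
    (g := fun s => inner ℝ (B (yosidaForm ι B n (ι z) s - yosidaForm ι B m (ι z) s))
        (yosidaForm ι B n (ι z) s - yosidaForm ι B m (ι z) s))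
    (fun s => (((hasDerivAt_yosidaPath n (ι z) s).sub
      (hasDerivAt_yosidaPath m (ι z) s)).norm_sq).const_mul (1 / 2)) (by fun_prop)
    (by fun_prop) (fun s hs => by
      set p := yosidaPath ι B n (ι z) s with hp
      set q := yosidaPath ι B m (ι z) s with hq
      have ep : p = ι (yosidaForm ι B n (ι z) s) + n⁻¹ • yosida ι B n p := hF.sub_resolvent hn _
      have eq : q = ι (yosidaForm ι B m (ι z) s) + m⁻¹ • yosida ι B m q := hF.sub_resolvent hm _
      -- The difference of the paths is the image of a difference in V, which produces the
      -- nonnegative form, plus a remainder of size (n⁻¹ + m⁻¹)‖y‖. The remainder is paired with L_n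
      -- p - L_m q, of norm at most 2‖y‖ since L_n commutes with its own semigroup.
      have e : p - q = ι (yosidaForm ι B n (ι z) s - yosidaForm ι B m (ι z) s)
          + (n⁻¹ • yosida ι B n p - m⁻¹ • yosida ι B m q) := by
        rw [map_sub]
        conv_lhs => rw [ep, eq]
        abel
      have e2 : inner ℝ (yosida ι B n p - yosida ι B m q)
          (ι (yosidaForm ι B n (ι z) s - yosidaForm ι B m (ι z) s))
          = inner ℝ (B (yosidaForm ι B n (ι z) s - yosidaForm ι B m (ι z) s))
            (yosidaForm ι B n (ι z) s - yosidaForm ι B m (ι z) s) := by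
        rw [inner_sub_left, hF.inner_yosida hn, hF.inner_yosida hm, map_sub B, inner_sub_left]
        rfl
      have b1 : ‖yosida ι B n p‖ ≤ ‖y‖ := by
        rw [hp, yosida_yosidaPath]
        exact (hF.norm_yosidaPath_le hn _ hs.1).trans (hF.norm_yosida_le hn hz)
      have b2 : ‖yosida ι B m q‖ ≤ ‖y‖ := by
        rw [hq, yosida_yosidaPath]
        exact (hF.norm_yosidaPath_le hm _ hs.1).trans (hF.norm_yosida_le hm hz)
      have b3 : ‖yosida ι B n p - yosida ι B m q‖ ≤ 2 * ‖y‖ := by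
        refine (norm_sub_le _ _).trans (by linarith)
      have b4 : ‖n⁻¹ • yosida ι B n p - m⁻¹ • yosida ι B m q‖ ≤ (n⁻¹ + m⁻¹) * ‖y‖ := by
        refine (norm_sub_le _ _).trans ?_
        rw [norm_smul, norm_smul, Real.norm_of_nonneg (by positivity),
          Real.norm_of_nonneg (by positivity), add_mul]
        gcongr
      have b5 := abs_real_inner_le_norm (yosida ι B n p - yosida ι B m q)
        (n⁻¹ • yosida ι B n p - m⁻¹ • yosida ι B m q)
      have b6 : ‖yosida ι B n p - yosida ι B m q‖
          * ‖n⁻¹ • yosida ι B n p - m⁻¹ • yosida ι B m q‖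
          ≤ 2 * ‖y‖ * ((n⁻¹ + m⁻¹) * ‖y‖) := by gcongr
      have b7 := (abs_le.1 (b5.trans b6)).1
      have e3 : -yosida ι B n p - -yosida ι B m q = -(yosida ι B n p - yosida ι B m q) := by abel
      rw [e3, inner_neg_right, real_inner_comm, Pi.sub_apply, ← hp, ← hq, e, inner_add_right, e2]
      linarith)
  simpa [yosidaPath_zero] using this

end Yosida

end MeanFlow
end

noncomputable section

namespace MeanFlow

/-! ### The abstract parabolic Cauchy problem -/

section PathSpaces

variable {F : Type*} [NormedAddCommGroup F] {f : ℝ → F} {T : ℝ}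

theorem memLp_Ioo_of_continuous (hf : Continuous f) (T : ℝ) :
    MemLp f 2 (volume.restrict (Set.Ioo 0 T)) := by
  obtain ⟨C, hC⟩ := (isCompact_Icc (a := (0 : ℝ)) (b := T)).exists_bound_of_continuousOn
    hf.continuousOn
  exact MemLp.of_bound hf.aestronglyMeasurable C ((ae_restrict_iff' measurableSet_Ioo).2
    (ae_of_all _ fun t ht => hC t (Set.Ioo_subset_Icc_self ht)))

theorem setIntegral_Ioo_eq {g : ℝ → ℝ} (hT : 0 ≤ T) :
    ∫ s in Set.Ioo 0 T, g s = ∫ s in 0..T, g s := by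
  rw [intervalIntegral.integral_of_le hT, integral_Ioc_eq_integral_Ioo]

theorem norm_sq_toLp_Ioo [InnerProductSpace ℝ F] (hf : Continuous f) (hT : 0 ≤ T) :
    ‖(memLp_Ioo_of_continuous hf T).toLp f‖ ^ 2 = ∫ s in 0..T, ‖f s‖ ^ 2 := by
  rw [← real_inner_self_eq_norm_sq, L2.inner_def, ← setIntegral_Ioo_eq hT]
  refine integral_congr_ae ?_
  filter_upwards [(memLp_Ioo_of_continuous hf T).coeFn_toLp] with s hs
  rw [hs, real_inner_self_eq_norm_sq]

/-- An equi-Lipschitz sequence of maps which is Cauchy on a dense set is Cauchy everywhere. -/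
theorem cauchySeq_of_dense {X Y : Type*} [PseudoMetricSpace X] [PseudoMetricSpace Y]
    {S : ℕ → X → Y} {K : ℝ} (hS : ∀ k x x', dist (S k x) (S k x') ≤ K * dist x x') {D : Set X}
    (hD : Dense D) (h : ∀ x ∈ D, CauchySeq fun k => S k x) (x : X) : CauchySeq fun k => S k x := by
  rw [Metric.cauchySeq_iff]
  intro ε hε
  obtain ⟨x', hx', hd⟩ := hD.exists_dist_lt x (ε := ε / (3 * (|K| + 1))) (by positivity)
  obtain ⟨N, hN⟩ := Metric.cauchySeq_iff.1 (h x' hx') (ε / 3) (by positivity)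
  have hk : ∀ k, dist (S k x) (S k x') < ε / 3 := fun k => by
    have h1 : dist x x' * (|K| + 1) < ε / 3 := by
      rw [lt_div_iff₀ (by positivity)] at hd
      linarith
    have h2 := mul_le_mul_of_nonneg_right (le_abs_self K) (dist_nonneg (x := x) (y := x'))
    have h3 := hS k x x'
    nlinarith [dist_nonneg (x := x) (y := x')]
  refine ⟨N, fun k hkN l hl => ?_⟩
  have h1 := hk k
  have h2 := hk l
  have h3 := hN k hkN l hl
  have h4 := dist_triangle4 (S k x) (S k x') (S l x') (S l x)
  rw [dist_comm (S l x')] at h4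
  linarith

end PathSpaces

/-! ### Convergence of the Yosida approximations and existence. -/

section Parabolic

set_option linter.unusedSectionVars false

variable {H V : Type*} [NormedAddCommGroup H] [InnerProductSpace ℝ H] [CompleteSpace H]
  [NormedAddCommGroup V] [InnerProductSpace ℝ V] [CompleteSpace V]
  {ι : V →L[ℝ] H} {B : V →L[ℝ] V} {c : ℝ}

/-- If h is orthogonal to the range, then ⟨h, ιRh⟩ = 0 and the resolvent equation tested with Rh
gives Rh = 0. Hence h is orthogonal to ι(V), and so zero. -/
theorem IsFormPair.dense_domain (hF : IsFormPair ι B c) :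
    Dense (Set.range fun y => ι (resolvent ι B c y)) := by
  have h : (LinearMap.range (ι.comp (resolvent ι B c)).toLinearMap).topologicalClosure = ⊤ := by
    rw [Submodule.topologicalClosure_eq_top_iff, Submodule.eq_bot_iff]
    intro h hh
    have h0 : inner ℝ h (ι (resolvent ι B c h)) = 0 := by
      rw [real_inner_comm]
      exact hh _ ⟨h, rfl⟩
    have h1 := hF.resolvent_spec le_rfl h (resolvent ι B c h)
    rw [h0, real_inner_self_eq_norm_sq] at h1
    have h2 := hF.coercive (resolvent ι B c h)
    have h3 : resolvent ι B c h = 0 := by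
      have h4 : ‖resolvent ι B c h‖ ^ 2 ≤ 0 := by
        by_contra! h5
        nlinarith [mul_pos hF.pos h5]
      simpa using le_antisymm h4 (sq_nonneg _)
    refine hF.dense h fun w => ?_
    have h4 := hF.resolvent_spec le_rfl h w
    rw [h3, map_zero, map_zero, inner_zero_left, inner_zero_left] at h4
    have h5 : c * inner ℝ h (ι w) = 0 := by linarith
    exact (mul_eq_zero.1 h5).resolve_left hF.pos.ne'
  exact (Submodule.dense_iff_topologicalClosure_eq_top).2 h

/-- Points of the dense set lie in the domain of L, with Lz given explicitly; they are initial data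
to which the comparison of two approximations applies. -/
theorem IsFormPair.inner_domain (hF : IsFormPair ι B c) (y : H) (w : V) :
    inner ℝ (B (resolvent ι B c y)) w
      = inner ℝ (c • (y - ι (resolvent ι B c y))) (ι w) := by
  rw [real_inner_smul_left, inner_sub_left]
  linarith [hF.resolvent_spec le_rfl y w]

/-- The approximate evolution as an element of `C([0,T]; H)`. -/
def yosidaCurve (ι : V →L[ℝ] H) (B : V →L[ℝ] V) (T n : ℝ) (x : H) : C(Set.Icc (0 : ℝ) T, H) :=
  ⟨fun t => yosidaPath ι B n x t, (continuous_yosidaPath n x).comp continuous_subtype_val⟩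

/-- The approximate evolution as an element of `L²(0,T; V)`. -/
def yosidaLp (ι : V →L[ℝ] H) (B : V →L[ℝ] V) (T n : ℝ) (x : H) :
    Lp V 2 (volume.restrict (Set.Ioo 0 T)) :=
  (memLp_Ioo_of_continuous (continuous_yosidaForm (ι := ι) (B := B) n x) T).toLp _

theorem yosidaLp_sub (T n : ℝ) (x x' : H) :
    yosidaLp ι B T n x - yosidaLp ι B T n x' = yosidaLp ι B T n (x - x') := by
  rw [yosidaLp, yosidaLp, ← MemLp.toLp_sub]
  exact MemLp.toLp_congr _ _ (ae_of_all _ fun t => yosidaForm_sub n x x' t)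

theorem norm_sq_yosidaLp {T : ℝ} (hT : 0 ≤ T) (n : ℝ) (x : H) :
    ‖yosidaLp ι B T n x‖ ^ 2 = ∫ s in 0..T, ‖yosidaForm ι B n x s‖ ^ 2 :=
  norm_sq_toLp_Ioo (continuous_yosidaForm n x) hT

theorem dist_sq_yosidaLp {T : ℝ} (hT : 0 ≤ T) (n m : ℝ) (x : H) :
    dist (yosidaLp ι B T n x) (yosidaLp ι B T m x) ^ 2
      = ∫ s in 0..T, ‖yosidaForm ι B n x s - yosidaForm ι B m x s‖ ^ 2 := by
  rw [dist_eq_norm, yosidaLp, yosidaLp, ← MemLp.toLp_sub]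
  exact norm_sq_toLp_Ioo ((continuous_yosidaForm n x).sub (continuous_yosidaForm m x)) hT

theorem tendsto_inv_add (c : ℝ) : Tendsto (fun k : ℕ => (c + k)⁻¹) atTop (𝓝 0) :=
  tendsto_inv_atTop_zero.comp (tendsto_atTop_add_const_left _ c tendsto_natCast_atTop_atTop)

theorem cauchySeq_of_sq_le {X : Type*} [PseudoMetricSpace X] {s : ℕ → X} {c C : ℝ} (hc : 0 < c)
    (hC : 0 ≤ C) (h : ∀ k l : ℕ, dist (s k) (s l) ^ 2 ≤ C * ((c + k)⁻¹ + (c + l)⁻¹)) :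
    CauchySeq s := by
  refine cauchySeq_of_le_tendsto_0 (fun N : ℕ => Real.sqrt (C * (2 * (c + N)⁻¹))) ?_ ?_
  · intro k l N hk hl
    refine Real.le_sqrt_of_sq_le ((h k l).trans ?_)
    have h1 : ∀ k : ℕ, N ≤ k → (c + k : ℝ)⁻¹ ≤ (c + N)⁻¹ := fun k hk => by
      have : (N : ℝ) ≤ k := by exact_mod_cast hk
      gcongr
    refine mul_le_mul_of_nonneg_left ?_ hC
    linarith [h1 k hk, h1 l hl]
  · have := (((tendsto_inv_add c).const_mul 2).const_mul C).sqrt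
    simpa using this

theorem IsFormPair.dist_yosidaCurve_le (hF : IsFormPair ι B c) {n : ℝ} (hn : c ≤ n) (T : ℝ)
    (x x' : H) : dist (yosidaCurve ι B T n x) (yosidaCurve ι B T n x') ≤ 1 * dist x x' := by
  rw [one_mul, ContinuousMap.dist_le dist_nonneg]
  intro t
  rw [dist_eq_norm, dist_eq_norm]
  change ‖yosidaPath ι B n x t - yosidaPath ι B n x' t‖ ≤ _
  rw [yosidaPath_sub]
  exact hF.norm_yosidaPath_le hn _ t.2.1

theorem IsFormPair.dist_yosidaLp_le (hF : IsFormPair ι B c) {n : ℝ} (hn : c ≤ n) {T : ℝ}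
    (hT : 0 ≤ T) (x x' : H) :
    dist (yosidaLp ι B T n x) (yosidaLp ι B T n x') ≤ √(1 / (2 * c) + T) * dist x x' := by
  have hc := hF.pos
  rw [dist_eq_norm, yosidaLp_sub, dist_eq_norm]
  refine le_of_sq_le_sq ?_ (by positivity)
  rw [norm_sq_yosidaLp hT, mul_pow, Real.sq_sqrt (by positivity)]
  exact hF.integral_yosidaForm_le hn _ hT

theorem IsFormPair.sq_dist_path_le (hF : IsFormPair ι B c) {n m : ℝ} (hn : c ≤ n) (hm : c ≤ m)
    {z : V} {y : H} (hz : ∀ w, inner ℝ (B z) w = inner ℝ y (ι w)) {t T : ℝ}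
    (ht : t ∈ Set.Icc 0 T) :
    ‖yosidaPath ι B n (ι z) t - yosidaPath ι B m (ι z) t‖ ^ 2
      ≤ 4 * ‖y‖ ^ 2 * T * (n⁻¹ + m⁻¹) := by
  have hn0 : 0 < n := hF.pos.trans_le hn
  have hm0 : 0 < m := hF.pos.trans_le hm
  have h1 := hF.energy_sub hn hm hz ht.1
  have h2 := intervalIntegral.integral_nonneg (μ := volume) ht.1 fun s _ =>
    hF.nonneg (yosidaForm ι B n (ι z) s - yosidaForm ι B m (ι z) s)
  have h3 : 2 * ‖y‖ ^ 2 * (n⁻¹ + m⁻¹) * t ≤ 2 * ‖y‖ ^ 2 * (n⁻¹ + m⁻¹) * T := by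
    have := ht.2
    gcongr
  linarith

/-- By the Gårding inequality the V-distance is controlled by the form and the H-distance. The
latter splits into the distance of the paths and the two gaps between a path and its form-domain
version, whence the factors 3. -/
theorem IsFormPair.sq_dist_form_le (hF : IsFormPair ι B c) {n m : ℝ} (hn : c ≤ n) (hm : c ≤ m)
    {z : V} {y : H} (hz : ∀ w, inner ℝ (B z) w = inner ℝ y (ι w)) {T : ℝ} (hT : 0 ≤ T) :
    ∫ s in 0..T, ‖yosidaForm ι B n (ι z) s - yosidaForm ι B m (ι z) s‖ ^ 2
      ≤ (2 * ‖y‖ ^ 2 * T / c + 3 * ‖ι z‖ ^ 2 + 12 * T ^ 2 * ‖y‖ ^ 2) * (n⁻¹ + m⁻¹) := by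
  have hc0 := hF.pos
  have hn0 : 0 < n := hc0.trans_le hn
  have hm0 : 0 < m := hc0.trans_le hm
  have hc := continuous_yosidaPath (ι := ι) (B := B) n (ι z)
  have hc' := continuous_yosidaForm (ι := ι) (B := B) n (ι z)
  have hd := continuous_yosidaPath (ι := ι) (B := B) m (ι z)
  have hd' := continuous_yosidaForm (ι := ι) (B := B) m (ι z)
  set P := 4 * ‖y‖ ^ 2 * T * (n⁻¹ + m⁻¹) with hP
  set a : ℝ → ℝ := fun s => inner ℝ (B (yosidaForm ι B n (ι z) s - yosidaForm ι B m (ι z) s))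
        (yosidaForm ι B n (ι z) s - yosidaForm ι B m (ι z) s) with ha
  set f : ℝ → ℝ := fun s => ‖yosidaPath ι B n (ι z) s - ι (yosidaForm ι B n (ι z) s)‖ ^ 2 with hf
  set g : ℝ → ℝ := fun s => ‖yosidaPath ι B m (ι z) s - ι (yosidaForm ι B m (ι z) s)‖ ^ 2 with hg
  have ca : Continuous a := by fun_prop
  have cf : Continuous f := by fun_prop
  have cg : Continuous g := by fun_prop
  have h1 : ∫ s in 0..T, ‖yosidaForm ι B n (ι z) s - yosidaForm ι B m (ι z) s‖ ^ 2
      ≤ ∫ s in 0..T, (c⁻¹ * a s + 3 * (f s + g s + P)) := by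
    refine intervalIntegral.integral_mono_on hT (Continuous.intervalIntegrable (by fun_prop) _ _)
      (Continuous.intervalIntegrable (by fun_prop) _ _) fun s hs => ?_
    have h2 := hF.coercive (yosidaForm ι B n (ι z) s - yosidaForm ι B m (ι z) s)
    have h3 := hF.sq_dist_path_le hn hm hz hs
    have h4 : ‖ι (yosidaForm ι B n (ι z) s - yosidaForm ι B m (ι z) s)‖ ^ 2
        ≤ 3 * (f s + g s + P) := by
      set p := yosidaPath ι B n (ι z) s - ι (yosidaForm ι B n (ι z) s)
      set q := yosidaPath ι B m (ι z) s - ι (yosidaForm ι B m (ι z) s)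
      set r := yosidaPath ι B n (ι z) s - yosidaPath ι B m (ι z) s
      have e : ι (yosidaForm ι B n (ι z) s - yosidaForm ι B m (ι z) s) = r - p + q := by
        rw [map_sub]; simp only [p, q, r]; abel
      have h5 : ‖r - p + q‖ ≤ ‖r‖ + ‖p‖ + ‖q‖ :=
        (norm_add_le _ _).trans (add_le_add_left (norm_sub_le _ _) _)
      rw [e]
      calc ‖r - p + q‖ ^ 2 ≤ (‖r‖ + ‖p‖ + ‖q‖) ^ 2 := by gcongr
        _ ≤ 3 * (‖p‖ ^ 2 + ‖q‖ ^ 2 + ‖r‖ ^ 2) := by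
          nlinarith [sq_nonneg (‖p‖ - ‖q‖), sq_nonneg (‖p‖ - ‖r‖), sq_nonneg (‖q‖ - ‖r‖)]
        _ ≤ 3 * (‖p‖ ^ 2 + ‖q‖ ^ 2 + P) := by gcongr
    have h6 : c * (‖yosidaForm ι B n (ι z) s - yosidaForm ι B m (ι z) s‖ ^ 2
        - ‖ι (yosidaForm ι B n (ι z) s - yosidaForm ι B m (ι z) s)‖ ^ 2) ≤ a s := h2
    rw [← le_div_iff₀' hc0, div_eq_inv_mul] at h6
    linarith
  have i1 : ∀ {k : ℝ → ℝ}, Continuous k → IntervalIntegrable k volume 0 T :=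
    fun h => h.intervalIntegrable _ _
  rw [intervalIntegral.integral_add (i1 (by fun_prop)) (i1 (by fun_prop)),
    intervalIntegral.integral_const_mul, intervalIntegral.integral_const_mul,
    intervalIntegral.integral_add (i1 (by fun_prop)) (i1 (by fun_prop)),
    intervalIntegral.integral_add (i1 (by fun_prop)) (i1 (by fun_prop)),
    intervalIntegral.integral_const, smul_eq_mul, sub_zero] at h1
  have h2 := hF.energy_sub hn hm hz hT
  have h3 := sq_nonneg ‖yosidaPath ι B n (ι z) T - yosidaPath ι B m (ι z) T‖
  have h4 : ∫ s in 0..T, a s ≤ 2 * ‖y‖ ^ 2 * (n⁻¹ + m⁻¹) * T := by linarith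
  have h5 : ∫ s in 0..T, f s ≤ n⁻¹ * ‖ι z‖ ^ 2 := hF.integral_sub_le hn _ hT
  have h6 : ∫ s in 0..T, g s ≤ m⁻¹ * ‖ι z‖ ^ 2 := hF.integral_sub_le hm _ hT
  have h7 := mul_le_mul_of_nonneg_left h4 (inv_nonneg.2 hc0.le)
  refine h1.trans ?_
  have e : (2 * ‖y‖ ^ 2 * T / c + 3 * ‖ι z‖ ^ 2 + 12 * T ^ 2 * ‖y‖ ^ 2) * (n⁻¹ + m⁻¹)
      = c⁻¹ * (2 * ‖y‖ ^ 2 * (n⁻¹ + m⁻¹) * T)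
        + 3 * (n⁻¹ * ‖ι z‖ ^ 2 + m⁻¹ * ‖ι z‖ ^ 2 + T * P) := by
    rw [hP]; ring
  rw [e]
  linarith

theorem IsFormPair.cauchySeq_yosidaCurve (hF : IsFormPair ι B c) {T : ℝ} (hT : 0 ≤ T) (x : H) :
    CauchySeq fun k : ℕ => yosidaCurve ι B T (c + k) x := by
  refine cauchySeq_of_dense (S := fun k : ℕ => yosidaCurve ι B T (c + k))
    (fun k x x' => hF.dist_yosidaCurve_le (by simp) T x x') hF.dense_domain ?_ x
  rintro _ ⟨y, rfl⟩
  refine cauchySeq_of_sq_le hF.pos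
    (C := 4 * ‖c • (y - ι (resolvent ι B c y))‖ ^ 2 * T) (by positivity) fun k l => ?_
  have hc := hF.pos
  rw [← Real.sqrt_le_sqrt_iff (by positivity), Real.sqrt_sq dist_nonneg,
    ContinuousMap.dist_le (Real.sqrt_nonneg _)]
  intro t
  refine Real.le_sqrt_of_sq_le ?_
  rw [dist_eq_norm]
  exact hF.sq_dist_path_le (by simp) (by simp) (hF.inner_domain y) t.2

theorem IsFormPair.cauchySeq_yosidaLp (hF : IsFormPair ι B c) {T : ℝ} (hT : 0 ≤ T) (x : H) :
    CauchySeq fun k : ℕ => yosidaLp ι B T (c + k) x := by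
  refine cauchySeq_of_dense (S := fun k : ℕ => yosidaLp ι B T (c + k))
    (fun k x x' => hF.dist_yosidaLp_le (by simp) hT x x') hF.dense_domain ?_ x
  rintro _ ⟨y, rfl⟩
  have hc := hF.pos
  refine cauchySeq_of_sq_le hF.pos (C := 2 * ‖c • (y - ι (resolvent ι B c y))‖ ^ 2 * T / c
    + 3 * ‖ι (resolvent ι B c y)‖ ^ 2
    + 12 * T ^ 2 * ‖c • (y - ι (resolvent ι B c y))‖ ^ 2) (by positivity) fun k l => ?_
  rw [dist_sq_yosidaLp hT]
  exact hF.sq_dist_form_le (by simp) (by simp) (hF.inner_domain y) hT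

/-- Integration by parts for the approximate evolution. -/
theorem IsFormPair.weak_yosida (hF : IsFormPair ι B c) {n T : ℝ} (hn : c ≤ n) (hT : 0 ≤ T) (x : H)
    {p : ℝ → V} {q : ℝ → H} (hp : Continuous p) (hq : Continuous q)
    (hpq : ∀ t, HasDerivAt (fun s => ι (p s)) (q t) t) (hpT : p T = 0) :
    -(∫ t in Set.Ioo 0 T, inner ℝ (yosidaPath ι B n x t) (q t))
      + (∫ t in Set.Ioo 0 T, inner ℝ (B (yosidaForm ι B n x t)) (p t)) - inner ℝ x (ι (p 0))
      = 0 := by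
  have hc := continuous_yosidaPath (ι := ι) (B := B) n x
  have hc' := continuous_yosidaForm (ι := ι) (B := B) n x
  have hd : ∀ t, HasDerivAt (fun t => inner ℝ (yosidaPath ι B n x t) (ι (p t)))
      (inner ℝ (yosidaPath ι B n x t) (q t) - inner ℝ (B (yosidaForm ι B n x t)) (p t)) t := by
    intro t
    refine ((hasDerivAt_yosidaPath n x t).inner ℝ (hpq t)).congr_deriv ?_
    rw [inner_neg_left, hF.inner_yosida hn]
    rfl
  have h1 := intervalIntegral.integral_eq_sub_of_hasDerivAt (a := 0) (b := T)
    (fun t _ => hd t) (Continuous.intervalIntegrable (by fun_prop) _ _)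
  rw [intervalIntegral.integral_sub (Continuous.intervalIntegrable (by fun_prop) _ _)
    (Continuous.intervalIntegrable (by fun_prop) _ _), hpT, map_zero, inner_zero_right,
    yosidaPath_zero] at h1
  rw [setIntegral_Ioo_eq hT, setIntegral_Ioo_eq hT]
  linarith

/-- Existence for the abstract parabolic Cauchy problem. -/
theorem IsFormPair.exists_solution (hF : IsFormPair ι B c) {T : ℝ} (hT : 0 < T) (x : H) :
    ∃ (u : C(Set.Icc (0 : ℝ) T, H)) (v : Lp V 2 (volume.restrict (Set.Ioo 0 T))),
      u (Set.projIcc 0 T hT.le 0) = x ∧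
      (∀ᵐ t ∂(volume.restrict (Set.Ioo 0 T)), ι (v t) = u (Set.projIcc 0 T hT.le t)) ∧
      ∀ (p : ℝ → V) (q : ℝ → H), Continuous p → Continuous q →
        (∀ t, HasDerivAt (fun s => ι (p s)) (q t) t) → p T = 0 →
        -(∫ t in Set.Ioo 0 T, inner ℝ (u (Set.projIcc 0 T hT.le t)) (q t))
          + (∫ t in Set.Ioo 0 T, inner ℝ (B (v t)) (p t)) - inner ℝ x (ι (p 0)) = 0 := by
  have hc0 := hF.pos
  have hn : ∀ k : ℕ, c ≤ c + k := fun k => by simp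
  obtain ⟨u, hu⟩ := cauchySeq_tendsto_of_complete (hF.cauchySeq_yosidaCurve hT.le x)
  obtain ⟨v, hv⟩ := cauchySeq_tendsto_of_complete (hF.cauchySeq_yosidaLp hT.le x)
  have hproj : Continuous fun t => u (Set.projIcc 0 T hT.le t) :=
    u.continuous.comp continuous_projIcc
  have hut : ∀ t ∈ Set.Icc 0 T, Tendsto (fun k : ℕ => yosidaPath ι B (c + k) x t) atTop
      (𝓝 (u (Set.projIcc 0 T hT.le t))) := by
    intro t ht
    have h1 := ((continuous_eval_const (F := C(Set.Icc (0 : ℝ) T, H)) ⟨t, ht⟩).tendsto u).comp hu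
    rw [Set.projIcc_of_mem hT.le ht]
    exact h1
  refine ⟨u, v, ?_, ?_, ?_⟩
  · refine tendsto_nhds_unique (hut 0 ⟨le_rfl, hT.le⟩) ?_
    simp_rw [yosidaPath_zero]
    exact tendsto_const_nhds
  -- The limits in C([0,T];H) and in L²(0,T;V) are matched in L²(0,T;H): the gap between path and
  -- regularised path there is at most of order n^(-1/2).
  · set U : Lp H 2 (volume.restrict (Set.Ioo 0 T)) :=
      (memLp_Ioo_of_continuous hproj T).toLp _ with hU
    let Uk : ℕ → Lp H 2 (volume.restrict (Set.Ioo 0 T)) := fun k =>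
      (memLp_Ioo_of_continuous (continuous_yosidaPath (ι := ι) (B := B) (c + k) x) T).toLp _
    have h1 : Tendsto Uk atTop (𝓝 U) := by
      rw [tendsto_iff_dist_tendsto_zero]
      have h2 : ∀ k, dist (Uk k) U ≤ (measureUnivNNReal (volume.restrict (Set.Ioo 0 T)))
          ^ (2 : ENNReal).toReal⁻¹ * dist (yosidaCurve ι B T (c + k) x) u := by
        intro k
        rw [dist_eq_norm, ← MemLp.toLp_sub]
        refine Lp.norm_le_of_ae_bound dist_nonneg ?_
        filter_upwards [(((memLp_Ioo_of_continuous (continuous_yosidaPath (ι := ι) (B := B)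
          (c + k) x) T)).sub (memLp_Ioo_of_continuous hproj T)).coeFn_toLp,
          ae_restrict_mem measurableSet_Ioo] with t ht htm
        rw [ht, Pi.sub_apply, ← dist_eq_norm, Set.projIcc_of_mem hT.le
          (Set.Ioo_subset_Icc_self htm)]
        exact ContinuousMap.dist_apply_le_dist (f := yosidaCurve ι B T (c + k) x) (g := u)
          ⟨t, Set.Ioo_subset_Icc_self htm⟩
      refine squeeze_zero (fun _ => dist_nonneg) h2 ?_
      simpa using (tendsto_iff_dist_tendsto_zero.1 hu).const_mul
        ((measureUnivNNReal (volume.restrict (Set.Ioo 0 T)) : ℝ) ^ (2 : ENNReal).toReal⁻¹)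
    have h2 : Tendsto (fun k : ℕ => ι.compLp (yosidaLp ι B T (c + k) x)) atTop
        (𝓝 (ι.compLp v)) :=
      ((ι.compLpL 2 (volume.restrict (Set.Ioo 0 T))).continuous.tendsto v).comp hv
    have h3 : Tendsto (fun k : ℕ => Uk k - ι.compLp (yosidaLp ι B T (c + k) x)) atTop (𝓝 0) := by
      rw [tendsto_zero_iff_norm_tendsto_zero]
      have h4 : ∀ k : ℕ, ‖Uk k - ι.compLp (yosidaLp ι B T (c + k) x)‖
          ≤ √((c + k)⁻¹ * ‖x‖ ^ 2) := by
        intro k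
        have hcon := (continuous_yosidaPath (ι := ι) (B := B) (c + k) x).sub
          (ι.continuous.comp (continuous_yosidaForm (ι := ι) (B := B) (c + k) x))
        have e : Uk k - ι.compLp (yosidaLp ι B T (c + k) x)
            = (memLp_Ioo_of_continuous hcon T).toLp _ := by
          refine Lp.ext ?_
          filter_upwards [Lp.coeFn_sub (Uk k) (ι.compLp (yosidaLp ι B T (c + k) x)),
            (memLp_Ioo_of_continuous hcon T).coeFn_toLp,
            ι.coeFn_compLp (yosidaLp ι B T (c + k) x),
            (memLp_Ioo_of_continuous (continuous_yosidaForm (ι := ι) (B := B) (c + k) x)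
              T).coeFn_toLp,
            (memLp_Ioo_of_continuous (continuous_yosidaPath (ι := ι) (B := B) (c + k) x)
              T).coeFn_toLp] with t a1 a2 a3 a4 a5
          rw [a1, a2, Pi.sub_apply, a3, yosidaLp, a4, a5]
          rfl
        refine Real.le_sqrt_of_sq_le ?_
        rw [e, norm_sq_toLp_Ioo hcon hT.le]
        exact hF.integral_sub_le (hn k) x hT.le
      refine squeeze_zero (fun _ => norm_nonneg _) h4 ?_
      have h5 := ((tendsto_inv_add c).mul_const (‖x‖ ^ 2)).sqrt
      rw [zero_mul, Real.sqrt_zero] at h5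
      exact h5
    have h4 : U - ι.compLp v = 0 := tendsto_nhds_unique (h1.sub h2) h3
    have h5 : ι.compLp v = U := (sub_eq_zero.1 h4).symm
    filter_upwards [ι.coeFn_compLp v, (memLp_Ioo_of_continuous hproj T).coeFn_toLp] with t a1 a2
    rw [← a1, h5, hU, a2]
  · intro p q hp hq hpq hpT
    have h1 : Tendsto (fun k : ℕ => ∫ t in Set.Ioo 0 T,
        inner ℝ (yosidaPath ι B (c + k) x t) (q t)) atTop
        (𝓝 (∫ t in Set.Ioo 0 T, inner ℝ (u (Set.projIcc 0 T hT.le t)) (q t))) := by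
      refine tendsto_integral_of_dominated_convergence (fun t => ‖x‖ * ‖q t‖) (fun k => ?_) ?_
        (fun k => ?_) ?_
      · exact ((continuous_yosidaPath _ x).inner hq).aestronglyMeasurable
      · exact (((memLp_Ioo_of_continuous hq T).integrable one_le_two).norm).const_mul _
      · filter_upwards [ae_restrict_mem measurableSet_Ioo] with t ht
        refine (norm_inner_le_norm _ _).trans ?_
        gcongr
        exact hF.norm_yosidaPath_le (hn k) x ht.1.le
      · filter_upwards [ae_restrict_mem measurableSet_Ioo] with t ht
        exact (hut t (Set.Ioo_subset_Icc_self ht)).inner tendsto_const_nhds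
    -- Moving B onto the test path turns the form term into an inner product in L²(0,T;V), which
    -- passes to the limit.
    have hBp : Continuous fun t => ContinuousLinearMap.adjoint B (p t) := by fun_prop
    have hin : ∀ w : Lp V 2 (volume.restrict (Set.Ioo 0 T)),
        ∫ t in Set.Ioo 0 T, inner ℝ (B (w t)) (p t)
        = inner ℝ w ((memLp_Ioo_of_continuous hBp T).toLp _) := by
      intro w
      rw [L2.inner_def]
      refine integral_congr_ae ?_
      filter_upwards [(memLp_Ioo_of_continuous hBp T).coeFn_toLp] with t ht
      rw [ht, ContinuousLinearMap.adjoint_inner_right]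
    have h2 : Tendsto (fun k : ℕ => ∫ t in Set.Ioo 0 T,
        inner ℝ (B (yosidaForm ι B (c + k) x t)) (p t)) atTop
        (𝓝 (∫ t in Set.Ioo 0 T, inner ℝ (B (v t)) (p t))) := by
      have e : ∀ k : ℕ, ∫ t in Set.Ioo 0 T, inner ℝ (B (yosidaForm ι B (c + k) x t)) (p t)
          = inner ℝ (yosidaLp ι B T (c + k) x) ((memLp_Ioo_of_continuous hBp T).toLp _) := by
        intro k
        rw [← hin]
        refine integral_congr_ae ?_
        filter_upwards [(memLp_Ioo_of_continuous (continuous_yosidaForm (ι := ι) (B := B)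
          (c + k) x) T).coeFn_toLp] with t ht
        rw [yosidaLp, ht]
      simp_rw [e, hin]
      exact hv.inner tendsto_const_nhds
    refine tendsto_nhds_unique ((h1.neg.add h2).sub_const (inner ℝ x (ι (p 0)))) ?_
    simp_rw [fun k : ℕ => hF.weak_yosida (hn k) hT.le x hp hq hpq hpT]
    exact tendsto_const_nhds

end Parabolic

end MeanFlow
end

noncomputable section

namespace MeanFlow

/-! ### Uniqueness for the abstract parabolic Cauchy problem -/

section Uniqueness

/-- Test functions of time, vanishing near the final time. -/
def IsTimeTest (T : ℝ) (θ : ℝ → ℝ) : Prop :=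
  ContDiff ℝ ∞ θ ∧ HasCompactSupport θ ∧ tsupport θ ⊆ Set.Iio T

/-- Test functions supported in `(0,T)` are derivatives of time test functions. -/
theorem exists_isTimeTest_deriv_eq {T : ℝ} {η : ℝ → ℝ} (hη : ContDiff ℝ ∞ η)
    (hηc : HasCompactSupport η) (hs : tsupport η ⊆ Set.Ioo 0 T) :
    ∃ θ, IsTimeTest T θ ∧ ∀ t ∈ Set.Ioo 0 T, deriv θ t = η t := by
  obtain ⟨T', hT', hsub⟩ : ∃ T' < T, tsupport η ⊆ Set.Iic T' := by
    rcases (tsupport η).eq_empty_or_nonempty with h | h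
    · exact ⟨T - 1, by linarith, by simp [h]⟩
    · obtain ⟨m, hm⟩ := hηc.isCompact.exists_isGreatest h
      exact ⟨m, (hs hm.1).2, fun t ht => hm.2 ht⟩
  -- The primitive based at T vanishes to the right of the support of η, and a cutoff equal to 1 on
  -- (0,T) makes its support compact. Since θ need not vanish at 0, no zero-mean condition on η
  -- arises.
  set E : ℝ → ℝ := fun t => ∫ s in T..t, η s with hE
  have hEd : ∀ t, HasDerivAt E (η t) t := fun t =>
    intervalIntegral.integral_hasDerivAt_right (hη.continuous.intervalIntegrable _ _)
      (hη.continuous.stronglyMeasurableAtFilter _ _) hη.continuous.continuousAt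
  have hEs : ContDiff ℝ ∞ E := by
    rw [contDiff_infty_iff_deriv]
    exact ⟨fun t => (hEd t).differentiableAt,
      by rwa [show deriv E = η from funext fun t => (hEd t).deriv]⟩
  have hE0 : ∀ t, T' < t → E t = 0 := by
    intro t ht
    refine (intervalIntegral.integral_congr (g := fun _ => (0 : ℝ)) fun s hs' => ?_).trans
      intervalIntegral.integral_zero
    refine image_eq_zero_of_notMem_tsupport fun h => ?_
    have h1 : min T t ≤ s := hs'.1
    exact absurd (hsub h) (not_le.2 ((lt_min hT' ht).trans_le h1))
  let χ : ContDiffBump (0 : ℝ) := ⟨|T| + 1, |T| + 2, by positivity, by linarith⟩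
  refine ⟨fun t => χ t * E t, ⟨χ.contDiff.mul hEs, χ.hasCompactSupport.mul_right, ?_⟩, ?_⟩
  · have h1 : tsupport (fun t => χ t * E t) ⊆ Set.Iic T' := by
      refine closure_minimal (fun t ht => ?_) isClosed_Iic
      by_contra h
      exact ht (by simp only [hE0 t (not_le.1 h), mul_zero])
    exact h1.trans fun t ht => lt_of_le_of_lt ht hT'
  · intro t ht
    have h1 : (fun t => χ t * E t) =ᶠ[𝓝 t] E := by
      filter_upwards [Ioo_mem_nhds ht.1 ht.2] with s hs'
      rw [χ.one_of_mem_closedBall, one_mul]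
      rw [mem_closedBall_zero_iff, Real.norm_eq_abs, abs_of_pos hs'.1]
      change s ≤ |T| + 1
      linarith [hs'.2, le_abs_self T]
    rw [h1.deriv_eq, (hEd t).deriv]

/-- The weak form of `f' = -k`, `f 0 = 0`. -/
theorem eq_neg_integral_of_weak {T : ℝ} (hT : 0 < T) {f k : ℝ → ℝ} (hf : Continuous f)
    (hk : IntervalIntegrable k volume 0 T)
    (h : ∀ θ, IsTimeTest T θ →
      -(∫ t in Set.Ioo 0 T, deriv θ t * f t) + ∫ t in Set.Ioo 0 T, θ t * k t = 0) :
    ∀ t ∈ Set.Icc 0 T, f t = -∫ s in 0..t, k s := by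
  set K : ℝ → ℝ := fun t => ∫ s in 0..t, k s with hK
  have h0mem : (0 : ℝ) ∈ Set.uIcc 0 T := by simp
  have hKac : AbsolutelyContinuousOnInterval K 0 T :=
    hk.absolutelyContinuousOnInterval_intervalIntegral h0mem
  have hKc : ContinuousOn K (Set.Icc 0 T) := by
    have := hKac.continuousOn
    rwa [Set.uIcc_of_le hT.le] at this
  have hparts : ∀ θ, IsTimeTest T θ →
      ∫ t in Set.Ioo 0 T, θ t * k t = -∫ t in Set.Ioo 0 T, deriv θ t * K t := by
    intro θ hθ
    have hθac : AbsolutelyContinuousOnInterval θ 0 T :=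
      (hθ.1.of_le (by simp)).contDiffOn.absolutelyContinuousOnInterval
    have h1 := hθac.integral_mul_deriv_eq_deriv_mul hKac
    have h2 : θ T = 0 := image_eq_zero_of_notMem_tsupport fun h => lt_irrefl T (hθ.2.2 h)
    have h3 : K 0 = 0 := intervalIntegral.integral_same
    rw [h2, h3, zero_mul, mul_zero, sub_zero, zero_sub] at h1
    rw [setIntegral_Ioo_eq hT.le, setIntegral_Ioo_eq hT.le, ← h1]
    refine intervalIntegral.integral_congr_ae ?_
    filter_upwards [hk.ae_hasDerivAt_integral] with t ht htm
    rw [(ht (Set.uIoc_subset_uIcc htm) 0 h0mem).deriv]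
  -- The weak form becomes ∫ θ'(f + K) = 0. Derivatives θ' exhaust the test functions on (0,T), so f
  -- + K vanishes without an undetermined constant: tests that do not vanish at 0 encode f(0) = 0.
  have hae : ∀ᵐ t, t ∈ Set.Ioo 0 T → f t + K t = 0 := by
    refine isOpen_Ioo.ae_eq_zero_of_integral_contDiff_smul_eq_zero ?_ fun η h1 h2 h3 => ?_
    · exact ((hf.continuousOn.add hKc).mono Set.Ioo_subset_Icc_self).locallyIntegrableOn
        measurableSet_Ioo
    · obtain ⟨θ, hθ, hd⟩ := exists_isTimeTest_deriv_eq h1 h2 h3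
      have h4 := h θ hθ
      rw [hparts θ hθ] at h4
      have hdc : Continuous (deriv θ) := hθ.1.continuous_deriv (by simp)
      have i1 : IntegrableOn (fun t => deriv θ t * f t) (Set.Ioo 0 T) volume :=
        ((hdc.mul hf).continuousOn.integrableOn_Icc).mono_set Set.Ioo_subset_Icc_self
      have i2 : IntegrableOn (fun t => deriv θ t * K t) (Set.Ioo 0 T) volume :=
        ((hdc.continuousOn.mul hKc).integrableOn_Icc).mono_set Set.Ioo_subset_Icc_self
      have h5 : ∫ t in Set.Ioo 0 T, η t • (f t + K t) = 0 := by
        have e : ∫ t in Set.Ioo 0 T, η t • (f t + K t)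
            = ∫ t in Set.Ioo 0 T, (deriv θ t * f t + deriv θ t * K t) := by
          refine setIntegral_congr_fun measurableSet_Ioo fun t ht => ?_
          rw [smul_eq_mul, ← hd t ht, mul_add]
        rw [e, integral_add i1 i2]
        linarith
      rw [← h5]
      refine (setIntegral_eq_integral_of_forall_compl_eq_zero fun t ht => ?_).symm
      rw [image_eq_zero_of_notMem_tsupport fun h => ht (h3 h), zero_smul]
  have heq := Measure.eqOn_Icc_of_ae_eq volume hT.ne (f := f) (g := fun t => -K t) (by
    rw [← restrict_Ioo_eq_restrict_Icc]
    filter_upwards [ae_restrict_of_ae hae, ae_restrict_mem measurableSet_Ioo] with t h1 h2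
    linarith [h1 h2]) hf.continuousOn hKc.neg
  exact heq

variable {H V : Type*} [NormedAddCommGroup H] [InnerProductSpace ℝ H] [CompleteSpace H]
  [NormedAddCommGroup V] [InnerProductSpace ℝ V] [CompleteSpace V]
  {ι : V →L[ℝ] H} {B : V →L[ℝ] V} {c : ℝ}

/-- The equation is integrated in time. With W = ∫₀ᵗ v and U = ∫₀ᵗ u = ιW, it reads ⟨u, ιφ⟩ = -⟨BW,
φ⟩ for all φ in V, so W itself is admissible and d/dt |U|² = -2⟨BW, W⟩ ≤ 0. Hence U = 0, and so u =
0. This avoids any regularity of u in time beyond continuity. -/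
theorem IsFormPair.eq_zero_of_weak (hF : IsFormPair ι B c) {T : ℝ} (hT : 0 < T) {u : ℝ → H}
    (hu : Continuous u) {v : ℝ → V} (hv : MemLp v 2 (volume.restrict (Set.Ioo 0 T)))
    (huv : ∀ᵐ t ∂(volume.restrict (Set.Ioo 0 T)), ι (v t) = u t) {D : Set V} (hD : Dense D)
    (hweak : ∀ φ ∈ D, ∀ θ, IsTimeTest T θ →
      -(∫ t in Set.Ioo 0 T, deriv θ t * inner ℝ (u t) (ι φ))
        + ∫ t in Set.Ioo 0 T, θ t * inner ℝ (B (v t)) φ = 0) :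
    ∀ t ∈ Set.Icc 0 T, u t = 0 := by
  have hvi : IntervalIntegrable v volume 0 T := by
    rw [intervalIntegrable_iff_integrableOn_Ioo_of_le hT.le]
    exact hv.integrable one_le_two
  have hvi' : ∀ t ∈ Set.Icc 0 T, IntervalIntegrable v volume 0 t := fun t ht =>
    hvi.mono_set (by
      rw [Set.uIcc_of_le ht.1, Set.uIcc_of_le hT.le]
      exact Set.Icc_subset_Icc_right ht.2)
  set W : ℝ → V := fun t => ∫ s in 0..t, v s with hW
  have hclm : ∀ (L : V →L[ℝ] ℝ), ∀ t ∈ Set.Icc 0 T, ∫ s in 0..t, L (v s) = L (W t) :=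
    fun L t ht => L.intervalIntegral_comp_comm (hvi' t ht)
  have hLv : ∀ φ : V, ∀ w : V, ((innerSL ℝ φ).comp B) w = inner ℝ (B w) φ := fun φ w => by
    rw [ContinuousLinearMap.comp_apply, innerSL_apply_apply, real_inner_comm]
  have key : ∀ t ∈ Set.Icc 0 T, ∀ φ : V, inner ℝ (u t) (ι φ) = -inner ℝ (B (W t)) φ := by
    intro t ht
    have hcont1 : Continuous fun φ : V => inner ℝ (u t) (ι φ) := by fun_prop
    have hcont2 : Continuous fun φ : V => -inner ℝ (B (W t)) φ := by fun_prop
    refine congrFun (hcont1.ext_on hD hcont2 fun φ hφ => ?_)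
    have hk : IntervalIntegrable (fun s => inner ℝ (B (v s)) φ) volume 0 T := by
      rw [intervalIntegrable_iff] at hvi ⊢
      simp_rw [← hLv]
      exact ((innerSL ℝ φ).comp B).integrable_comp hvi
    have h1 := eq_neg_integral_of_weak hT (f := fun t => inner ℝ (u t) (ι φ)) (by fun_prop) hk
      (hweak φ hφ) t ht
    simp only at h1 ⊢
    rw [h1]
    simp_rw [← hLv]
    rw [hclm _ t ht]
  have hUd : ∀ t, HasDerivAt (fun t => ∫ s in 0..t, u s) (u t) t := fun t =>
    intervalIntegral.integral_hasDerivAt_right (hu.intervalIntegrable _ _)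
      (hu.stronglyMeasurableAtFilter _ _) hu.continuousAt
  have hUW : ∀ t ∈ Set.Icc 0 T, ι (W t) = ∫ s in 0..t, u s := by
    intro t ht
    rw [hW, ← ι.intervalIntegral_comp_comm (hvi' t ht)]
    refine intervalIntegral.integral_congr_ae ?_
    have h1 : ∀ᵐ s, s ∈ Set.Ioc 0 T → ι (v s) = u s := by
      rw [restrict_Ioo_eq_restrict_Ioc, ae_restrict_iff' measurableSet_Ioc] at huv
      exact huv
    filter_upwards [h1] with s hs hst
    rw [Set.uIoc_of_le ht.1] at hst
    exact hs ⟨hst.1, hst.2.trans ht.2⟩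
  have hzero : ∀ t ∈ Set.Icc 0 T, ∫ s in 0..t, u s = 0 := by
    have hd : ∀ t, HasDerivAt (fun t => ‖∫ s in 0..t, u s‖ ^ 2)
        (2 * inner ℝ (∫ s in 0..t, u s) (u t)) t := fun t => (hUd t).norm_sq
    have hanti : AntitoneOn (fun t => ‖∫ s in 0..t, u s‖ ^ 2) (Set.Icc 0 T) := by
      refine antitoneOn_of_deriv_nonpos (convex_Icc 0 T)
        (fun t _ => (hd t).continuousAt.continuousWithinAt)
        (fun t _ => (hd t).differentiableAt.differentiableWithinAt) fun t ht => ?_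
      have htm := interior_subset ht
      rw [(hd t).deriv, ← hUW t htm, real_inner_comm, key t htm]
      have := hF.nonneg (W t)
      linarith
    intro t ht
    have h1 := hanti ⟨le_rfl, hT.le⟩ ht ht.1
    simp only [intervalIntegral.integral_same, norm_zero] at h1
    have h2 : ‖∫ s in 0..t, u s‖ ^ 2 = 0 := le_antisymm (by simpa using h1) (sq_nonneg _)
    simpa using h2
  have hopen : Set.EqOn u (fun _ => 0) (Set.Ioo 0 T) := by
    intro t ht
    have h1 : (fun t => ∫ s in 0..t, u s) =ᶠ[𝓝 t] fun _ => 0 := by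
      filter_upwards [Ioo_mem_nhds ht.1 ht.2] with s hs
      exact hzero s (Set.Ioo_subset_Icc_self hs)
    exact (hUd t).unique ((hasDerivAt_const t (0 : H)).congr_of_eventuallyEq h1)
  have := hopen.closure hu continuous_const
  rwa [closure_Ioo hT.ne] at this

end Uniqueness

end MeanFlow
end

noncomputable section

namespace MeanFlow

/-! ### Square integrable functions on a product as square integrable paths -/

section Slices

set_option linter.unusedSectionVars false

theorem aestronglyMeasurable_of_inner {H : Type*} [NormedAddCommGroup H] [InnerProductSpace ℝ H]
    [CompleteSpace H] [SecondCountableTopology H] {Ω : Type*} [MeasurableSpace Ω] {ν : Measure Ω}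
    {f : Ω → H} (hf : ∀ h : H, AEStronglyMeasurable (fun z => inner ℝ h (f z)) ν) :
    AEStronglyMeasurable f ν := by
  obtain ⟨w, b, hb⟩ := exists_hilbertBasis ℝ H
  have : Countable w := b.orthonormal.countable_of_secondCountable
  refine aestronglyMeasurable_of_tendsto_ae atTop
    (f := fun (s : Finset w) z => ∑ i ∈ s, b.repr (f z) i • b i) (fun s => ?_)
    (ae_of_all _ fun z => b.hasSum_repr (f z))
  refine Finset.aestronglyMeasurable_fun_sum _ fun i _ => ?_
  simp_rw [b.repr_apply_apply]
  exact (hf _).smul_const _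

variable {Ω X E : Type*} [MeasurableSpace Ω] [MeasurableSpace X] [NormedAddCommGroup E]
  [InnerProductSpace ℝ E] {ν : Measure Ω} {μ : Measure X} [SFinite ν] [SFinite μ]

theorem norm_sq_eq_integral_norm (f : Lp E 2 μ) : ‖f‖ ^ 2 = ∫ x, ‖f x‖ ^ 2 ∂μ := by
  rw [← real_inner_self_eq_norm_sq, L2.inner_def]
  simp_rw [real_inner_self_eq_norm_sq]

/-- The slices of a function on the product are the values of the path. -/
def IsSlice (ν : Measure Ω) (μ : Measure X) (f : Ω → Lp E 2 μ) (F : Ω × X → E) : Prop :=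
  ∀ᵐ t ∂ν, f t =ᵐ[μ] fun x => F (t, x)

theorem IsSlice.congr {f f' : Ω → Lp E 2 μ} {F F' : Ω × X → E} (h : IsSlice ν μ f F)
    (hf : f =ᵐ[ν] f') (hF : F =ᵐ[ν.prod μ] F') : IsSlice ν μ f' F' := by
  filter_upwards [h, hf, Measure.ae_ae_of_ae_prod hF] with t h1 h2 h3
  rw [← h2]
  exact h1.trans h3

theorem IsSlice.sub {f f' : Ω → Lp E 2 μ} {F F' : Ω × X → E} (h : IsSlice ν μ f F)
    (h' : IsSlice ν μ f' F') : IsSlice ν μ (f - f') (F - F') := by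
  filter_upwards [h, h'] with t h1 h2
  filter_upwards [Lp.coeFn_sub (f t) (f' t), h1, h2] with x a1 a2 a3
  rw [Pi.sub_apply, a1, Pi.sub_apply, Pi.sub_apply, a2, a3]

theorem IsSlice.add {f f' : Ω → Lp E 2 μ} {F F' : Ω × X → E} (h : IsSlice ν μ f F)
    (h' : IsSlice ν μ f' F') : IsSlice ν μ (f + f') (F + F') := by
  filter_upwards [h, h'] with t h1 h2
  filter_upwards [Lp.coeFn_add (f t) (f' t), h1, h2] with x a1 a2 a3
  rw [Pi.add_apply, a1, Pi.add_apply, Pi.add_apply, a2, a3]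

theorem IsSlice.integral_norm_sq {f : Ω → Lp E 2 μ} {F : Ω × X → E} (h : IsSlice ν μ f F)
    (hF : MemLp F 2 (ν.prod μ)) :
    ∫ t, ‖f t‖ ^ 2 ∂ν = ∫ z, ‖F z‖ ^ 2 ∂(ν.prod μ) := by
  rw [integral_prod _ ((memLp_two_iff_integrable_sq_norm hF.1).1 hF)]
  refine integral_congr_ae ?_
  filter_upwards [h] with t ht
  rw [norm_sq_eq_integral_norm]
  refine integral_congr_ae ?_
  filter_upwards [ht] with x hx
  rw [hx]

/-- Measurability is checked weakly: ⟨e, f(t)⟩ is a partial integral of e F over X, measurable in t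
by Fubini. -/
theorem IsSlice.memLp [CompleteSpace E] [SecondCountableTopology (Lp E 2 μ)]
    {f : Ω → Lp E 2 μ} {F : Ω × X → E} (h : IsSlice ν μ f F) (hF : MemLp F 2 (ν.prod μ)) :
    MemLp f 2 ν := by
  have hm : AEStronglyMeasurable f ν := by
    refine aestronglyMeasurable_of_inner fun e => ?_
    have h1 : AEStronglyMeasurable (fun z : Ω × X => inner ℝ (e z.2) (F z)) (ν.prod μ) :=
      ((Lp.aestronglyMeasurable e).comp_snd).inner hF.1
    refine h1.integral_prod_right'.congr ?_
    filter_upwards [h] with t ht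
    rw [L2.inner_def]
    refine integral_congr_ae ?_
    filter_upwards [ht] with x hx
    rw [hx]
  rw [memLp_two_iff_integrable_sq_norm hm]
  refine ((memLp_two_iff_integrable_sq_norm hF.1).1 hF).integral_prod_left.congr ?_
  filter_upwards [h] with t ht
  rw [norm_sq_eq_integral_norm]
  refine integral_congr_ae ?_
  filter_upwards [ht] with x hx
  rw [hx]

theorem MemLp.ae_memLp_slice {F : Ω × X → E} (hF : MemLp F 2 (ν.prod μ)) :
    ∀ᵐ t ∂ν, MemLp (fun x => F (t, x)) 2 μ := by
  filter_upwards [hF.1.prodMk_left, (hF.integrable_norm_pow two_ne_zero).prod_right_ae]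
    with t h1 h2
  exact (memLp_two_iff_integrable_sq_norm h1).2 h2

theorem exists_isSlice {F : Ω × X → E} (hF : MemLp F 2 (ν.prod μ)) :
    ∃ f : Ω → Lp E 2 μ, IsSlice ν μ f F := by
  classical
  refine ⟨fun t => if h : MemLp (fun x => F (t, x)) 2 μ then h.toLp _ else 0, ?_⟩
  filter_upwards [MemLp.ae_memLp_slice hF] with t ht
  simp only [dif_pos ht]
  exact ht.coeFn_toLp

/-- Every square integrable path of square integrable functions has a square integrable joint
representative. -/
theorem exists_joint_rep [CompleteSpace E] [SecondCountableTopology (Lp E 2 μ)]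
    {f : Ω → Lp E 2 μ} (hf : MemLp f 2 ν) :
    ∃ F : Ω × X → E, MemLp F 2 (ν.prod μ) ∧ IsSlice ν μ f F := by
  refine MemLp.induction (p := 2) ENNReal.ofNat_ne_top
    (fun f : Ω → Lp E 2 μ => ∃ F : Ω × X → E, MemLp F 2 (ν.prod μ) ∧ IsSlice ν μ f F)
    ?_ ?_ ?_ ?_ hf
  · intro c s hs hνs
    have hsl : IsSlice ν μ (s.indicator fun _ => c)
        ((s ×ˢ Set.univ).indicator fun z : Ω × X => c z.2) := by
      refine ae_of_all _ fun t => ?_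
      by_cases ht : t ∈ s
      · rw [Set.indicator_of_mem ht]
        refine ae_of_all _ fun x => ?_
        beta_reduce
        rw [Set.indicator_of_mem (by simpa using ht)]
      · rw [Set.indicator_of_notMem ht]
        filter_upwards [Lp.coeFn_zero E 2 μ] with x hx
        rw [Set.indicator_of_notMem (by simpa using ht), hx]
        rfl
    refine ⟨_, ?_, hsl⟩
    have hm : AEStronglyMeasurable (fun z : Ω × X => c z.2) (ν.prod μ) :=
      (Lp.aestronglyMeasurable c).comp_snd
    rw [memLp_indicator_iff_restrict (hs.prod MeasurableSet.univ),
      ← Measure.prod_restrict, Measure.restrict_univ]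
    have hm' : AEStronglyMeasurable (fun z : Ω × X => c z.2) ((ν.restrict s).prod μ) :=
      (Lp.aestronglyMeasurable c).comp_snd
    rw [memLp_two_iff_integrable_sq_norm hm']
    have : IsFiniteMeasure (ν.restrict s) := ⟨by simpa using hνs⟩
    have h1 := (memLp_two_iff_integrable_sq_norm (Lp.aestronglyMeasurable c)).1 (Lp.memLp c)
    exact h1.comp_snd (ν.restrict s)
  · rintro f g - - - ⟨F, hF, hfF⟩ ⟨G, hG, hgG⟩
    exact ⟨F + G, hF.add hG, hfF.add hgG⟩
  · refine IsSeqClosed.isClosed fun f g hf hg => ?_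
    choose F hF hfF using hf
    let Φ : ℕ → Lp E 2 (ν.prod μ) := fun k => (hF k).toLp _
    have hfΦ : ∀ k, IsSlice ν μ (f k) (Φ k) := fun k =>
      (hfF k).congr ae_eq_rfl (hF k).coeFn_toLp.symm
    -- Passing to a joint representative is an isometry, so representatives of a convergent sequence
    -- are Cauchy in L² of the product; the slices of their limit recover the limit path.
    have hdist : ∀ (a b : Lp (Lp E 2 μ) 2 ν) (G K : Lp E 2 (ν.prod μ)), IsSlice ν μ a G →
        IsSlice ν μ b K → dist a b = dist G K := by
      intro a b G K ha hb
      rw [dist_eq_norm, dist_eq_norm, ← sq_eq_sq₀ (norm_nonneg _) (norm_nonneg _),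
        norm_sq_eq_integral_norm, norm_sq_eq_integral_norm]
      exact ((ha.sub hb).congr (Lp.coeFn_sub a b).symm
        (Lp.coeFn_sub G K).symm).integral_norm_sq (Lp.memLp _)
    have hΦ : CauchySeq Φ := by
      rw [Metric.cauchySeq_iff]
      intro ε hε
      obtain ⟨N, hN⟩ := Metric.cauchySeq_iff.1 hg.cauchySeq ε hε
      exact ⟨N, fun m hm n hn => by
        rw [← hdist (f m) (f n) _ _ (hfΦ m) (hfΦ n)]; exact hN m hm n hn⟩
    obtain ⟨Ψ, hΨ⟩ := cauchySeq_tendsto_of_complete hΦ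
    obtain ⟨h, hh⟩ := exists_isSlice (Lp.memLp Ψ)
    have hhm := hh.memLp (Lp.memLp Ψ)
    have hh' : IsSlice ν μ (hhm.toLp h) Ψ := hh.congr hhm.coeFn_toLp.symm ae_eq_rfl
    have hlim : Tendsto f atTop (𝓝 (hhm.toLp h)) := by
      rw [tendsto_iff_dist_tendsto_zero] at hΨ ⊢
      simp_rw [fun k => hdist (f k) (hhm.toLp h) _ _ (hfΦ k) hh']
      exact hΨ
    rw [tendsto_nhds_unique hg hlim]
    exact ⟨Ψ, Lp.memLp Ψ, hh'⟩
  · rintro f g hfg - ⟨F, hF, hfF⟩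
    exact ⟨F, hF, hfF.congr hfg ae_eq_rfl⟩

end Slices

/-! ### Smooth functions as differentiable paths in `L²` -/

section SmoothPaths

variable {d : ℕ} {F : Type*} [NormedAddCommGroup F]

theorem HasCompactSupport.memLp_slice {Ψ : ℝ × Sp d → F} (hc : Continuous Ψ)
    (hs : HasCompactSupport Ψ) (t : ℝ) : MemLp (fun x => Ψ (t, x)) 2 volume := by
  refine Continuous.memLp_of_hasCompactSupport (by fun_prop) ?_
  refine HasCompactSupport.intro (hs.isCompact.image continuous_snd) fun x hx => ?_
  exact image_eq_zero_of_notMem_tsupport fun h => hx ⟨_, h, rfl⟩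

theorem norm_toLp_le_of_support [InnerProductSpace ℝ F] {f : Sp d → F} (hf : MemLp f 2 volume)
    {K : Set (Sp d)} (hK : IsCompact K) (h0 : ∀ x ∉ K, f x = 0) {ε : ℝ} (hε : 0 ≤ ε)
    (hb : ∀ x, ‖f x‖ ≤ ε) : ‖hf.toLp f‖ ≤ ε * √(volume.real K) := by
  refine le_of_sq_le_sq ?_ (by positivity)
  rw [mul_pow, Real.sq_sqrt measureReal_nonneg, norm_sq_eq_integral_norm]
  have e : ∫ x, ‖hf.toLp f x‖ ^ 2 = ∫ x in K, ‖f x‖ ^ 2 := by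
    rw [setIntegral_eq_integral_of_forall_compl_eq_zero fun x hx => by rw [h0 x hx]; simp]
    refine integral_congr_ae ?_
    filter_upwards [hf.coeFn_toLp] with x hx
    rw [hx]
  rw [e]
  rw [← Real.norm_of_nonneg (integral_nonneg (μ := volume.restrict K)
    fun x => sq_nonneg ‖f x‖)]
  refine (norm_setIntegral_le_of_norm_le_const (C := ε ^ 2)
    hK.measure_lt_top fun x _ => ?_)
  rw [norm_pow, norm_norm]
  gcongr
  exact hb x

/-- The path in `L²` of a compactly supported continuous function. -/
def slicePath (Ψ : ℝ × Sp d → F) (hc : Continuous Ψ) (hs : HasCompactSupport Ψ) (t : ℝ) :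
    Lp F 2 (volume : Measure (Sp d)) :=
  (HasCompactSupport.memLp_slice hc hs t).toLp _

theorem exists_delta {Ψ : ℝ × Sp d → F} (hc : Continuous Ψ) (hs : HasCompactSupport Ψ) {ε : ℝ}
    (hε : 0 < ε) : ∃ δ > 0, ∀ s t, |s - t| < δ → ∀ x, ‖Ψ (s, x) - Ψ (t, x)‖ ≤ ε := by
  obtain ⟨δ, hδ, h⟩ := Metric.uniformContinuous_iff.1 (hs.uniformContinuous_of_continuous hc) ε hε
  refine ⟨δ, hδ, fun s t hst x => ?_⟩
  rw [← dist_eq_norm]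
  refine (h ?_).le
  rw [Prod.dist_eq, dist_self, Real.dist_eq, max_eq_left (abs_nonneg _)]
  exact hst

theorem slice_eq_zero {Ψ : ℝ × Sp d → F} {x : Sp d} (hx : x ∉ Prod.snd '' tsupport Ψ) (t : ℝ) :
    Ψ (t, x) = 0 :=
  image_eq_zero_of_notMem_tsupport fun h => hx ⟨_, h, rfl⟩

theorem continuous_slicePath [InnerProductSpace ℝ F] {Ψ : ℝ × Sp d → F} (hc : Continuous Ψ)
    (hs : HasCompactSupport Ψ) : Continuous (slicePath Ψ hc hs) := by
  have hK := hs.isCompact.image continuous_snd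
  rw [Metric.continuous_iff]
  intro t ε hε
  set M := √(volume.real (Prod.snd '' tsupport Ψ))
  have hM : 0 ≤ M := Real.sqrt_nonneg _
  obtain ⟨δ, hδ, h⟩ := exists_delta hc hs (ε := ε / (2 * (M + 1))) (by positivity)
  refine ⟨δ, hδ, fun s hst => ?_⟩
  rw [dist_eq_norm, slicePath, slicePath, ← MemLp.toLp_sub]
  refine (norm_toLp_le_of_support _ hK (fun x hx => ?_) (ε := ε / (2 * (M + 1)))
    (by positivity) fun x => h s t hst x).trans_lt ?_
  · simp only [slice_eq_zero hx, sub_zero]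
  · rw [div_mul_eq_mul_div, div_lt_iff₀ (by positivity)]
    nlinarith

/-- Uniform continuity of ψ' and the mean value inequality make the difference quotients converge
uniformly in x. All supports lie in one compact set, so the convergence also holds in L². -/
theorem hasDerivAt_slicePath {ψ ψ' : ℝ × Sp d → ℝ} (hc : Continuous ψ) (hs : HasCompactSupport ψ)
    (hc' : Continuous ψ') (hs' : HasCompactSupport ψ')
    (hd : ∀ t x, HasDerivAt (fun s => ψ (s, x)) (ψ' (t, x)) t) (t : ℝ) :
    HasDerivAt (slicePath ψ hc hs) (slicePath ψ' hc' hs' t) t := by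
  have hK : IsCompact (Prod.snd '' tsupport ψ ∪ Prod.snd '' tsupport ψ') :=
    (hs.isCompact.image continuous_snd).union (hs'.isCompact.image continuous_snd)
  rw [hasDerivAt_iff_isLittleO, Asymptotics.isLittleO_iff]
  intro ε hε
  set M := √(volume.real (Prod.snd '' tsupport ψ ∪ Prod.snd '' tsupport ψ'))
  have hM : 0 ≤ M := Real.sqrt_nonneg _
  obtain ⟨δ, hδ, h⟩ := exists_delta hc' hs' (ε := ε / (M + 1)) (by positivity)
  filter_upwards [Metric.ball_mem_nhds t hδ] with s hst
  rw [slicePath, slicePath, slicePath, ← MemLp.toLp_sub, ← MemLp.toLp_const_smul,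
    ← MemLp.toLp_sub]
  refine (norm_toLp_le_of_support _ hK (fun x hx => ?_) (ε := ε / (M + 1) * |s - t|)
    (by positivity) fun x => ?_).trans ?_
  · have h1 : x ∉ Prod.snd '' tsupport ψ := fun h => hx (Or.inl h)
    have h2 : x ∉ Prod.snd '' tsupport ψ' := fun h => hx (Or.inr h)
    simp only [Pi.sub_apply, Pi.smul_apply, slice_eq_zero h1, slice_eq_zero h2, smul_zero, sub_zero]
  · have h1 := (convex_ball t δ).norm_image_sub_le_of_norm_hasDerivWithin_le
      (f := fun r => ψ (r, x) - r * ψ' (t, x)) (f' := fun r => ψ' (r, x) - ψ' (t, x))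
      (C := ε / (M + 1)) (fun r _ => ((hd r x).sub (by
        simpa using (hasDerivAt_id r).mul_const (ψ' (t, x)))).hasDerivWithinAt)
      (fun r hr => h r t hr x) (Metric.mem_ball_self hδ) hst
    refine le_trans (le_of_eq ?_) h1
    congr 1
    simp only [Pi.sub_apply, Pi.smul_apply, smul_eq_mul]
    ring
  · rw [Real.norm_eq_abs]
    have h1 : ε / (M + 1) * M ≤ ε := by
      rw [div_mul_eq_mul_div, div_le_iff₀ (by positivity)]
      nlinarith
    calc ε / (M + 1) * |s - t| * M = ε / (M + 1) * M * |s - t| := by ring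
      _ ≤ ε * |s - t| := by gcongr

end SmoothPaths

end MeanFlow
end

noncomputable section

namespace MeanFlow

/-! ### The Dirichlet form of a coercive matrix field -/

section DirichletForm

variable {d : ℕ}

/-- The Sobolev space `H¹(ℝ^d)`, as a space of pairs `(w, ∇w)`. -/
abbrev SpH1 (d : ℕ) : Submodule ℝ (Lp (Jet d) 2 (volume : Measure (Sp d))) :=
  weakGradSpace volume (spTests d)

instance : CompleteSpace (SpH1 d) := (isClosed_weakGradSpace (spTests d)).completeSpace_coe

instance : SecondCountableTopology (Lp (Jet d) 2 (volume : Measure (Sp d))) := by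
  have : Fact ((2 : ENNReal) ≠ ⊤) := ⟨ENNReal.ofNat_ne_top⟩
  infer_instance

/-- The embedding of `H¹` into `L²`. -/
def spEmb (d : ℕ) : SpH1 d →L[ℝ] Lp ℝ 2 (volume : Measure (Sp d)) :=
  ((WithLp.fstL 2 ℝ ℝ (Sp d)).compLpL 2 volume).comp (SpH1 d).subtypeL

theorem coeFn_spEmb (v : SpH1 d) :
    spEmb d v =ᵐ[volume] fun x => ((v : Lp (Jet d) 2 (volume : Measure (Sp d))) x).fst :=
  (WithLp.fstL 2 ℝ ℝ (Sp d)).coeFn_compLp (v : Lp (Jet d) 2 (volume : Measure (Sp d)))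

/-- A test function with its gradient, as an element of `H¹`. -/
def testJet (φ : Sp d → ℝ) (hφ : IsTest φ) : SpH1 d :=
  ⟨(memLp_jet hφ.memLp hφ.memLp_spGrad).toLp _, isTestSpace_sp.testJets_subset
    ⟨(φ, spGrad φ), ⟨hφ, rfl⟩, (memLp_jet hφ.memLp hφ.memLp_spGrad).coeFn_toLp⟩⟩

theorem coeFn_testJet {φ : Sp d → ℝ} (hφ : IsTest φ) :
    (testJet φ hφ : Lp (Jet d) 2 (volume : Measure (Sp d))) =ᵐ[volume] jet φ (spGrad φ) :=
  (memLp_jet hφ.memLp hφ.memLp_spGrad).coeFn_toLp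

theorem dense_testJet : Dense {v : SpH1 d | ∃ φ, ∃ hφ : IsTest φ, v = testJet φ hφ} := by
  intro v
  rw [closure_subtype]
  refine closure_mono ?_ (mem_closure_testJets_sp v.2)
  rintro f ⟨t, ⟨ht, ht'⟩, hf⟩
  refine ⟨testJet t.1 ht, ⟨t.1, ht, rfl⟩, Lp.ext ?_⟩
  rw [ht'] at hf
  exact (coeFn_testJet ht).trans hf.symm

theorem inner_spEmb_testJet (h : Lp ℝ 2 (volume : Measure (Sp d))) {φ : Sp d → ℝ}
    (hφ : IsTest φ) : inner ℝ h (spEmb d (testJet φ hφ)) = ∫ x, h x * φ x := by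
  rw [L2.inner_def]
  refine integral_congr_ae ?_
  filter_upwards [coeFn_spEmb (testJet φ hφ), coeFn_testJet hφ] with x h1 h2
  rw [h1, h2, jet_fst, real_inner_comm]
  rfl

/-- B is multiplication by A on the gradient component, compressed to H¹ by orthogonal projection.
Since ‖v‖² - ‖ιv‖² is exactly ∫|∇v|², the ellipticity constant is the Gårding constant. -/
theorem exists_isFormPair {A : Sp d → Mat d} (hA : IsBoundedCoercive A) :
    ∃ (B : SpH1 d →L[ℝ] SpH1 d) (c : ℝ), IsFormPair (spEmb d) B c ∧
      ∀ v w : SpH1 d, inner ℝ (B v) w = ∫ x, inner ℝ ((A x).toEuclideanLin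
        ((v : Lp (Jet d) 2 (volume : Measure (Sp d))) x).snd)
        ((w : Lp (Jet d) 2 (volume : Measure (Sp d))) x).snd := by
  obtain ⟨hAm, c, C, hc, hAc⟩ := hA
  have hAm' : AEStronglyMeasurable (fun x => matOp (A x)) volume := by
    have : AEMeasurable (fun (x : Sp d) (i j : Fin d) => A x i j) volume :=
      aemeasurable_pi_lambda _ fun i => aemeasurable_pi_lambda _ fun j => hAm i j
    exact continuous_matOp.comp_aestronglyMeasurable (β := Mat d) this.aestronglyMeasurable
  have hK : ∀ᵐ x, ‖matOp (A x)‖ ≤ max C 0 := by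
    filter_upwards [hAc] with x hx
    refine ContinuousLinearMap.opNorm_le_bound _ (le_max_right _ _) fun ξ => ?_
    exact (hx ξ).2.trans (mul_le_mul_of_nonneg_right (le_max_left _ _) (norm_nonneg _))
  let M := multOp (fun x => jetOp 0 (matOp (A x))) (max C 0)
    (aestronglyMeasurable_jetOp aestronglyMeasurable_const hAm') (by
      filter_upwards [hK] with x hx
      refine (norm_jetOp_le _ _).trans ?_
      rw [norm_zero, zero_add]
      exact hx)
  have hM : ∀ f h : Lp (Jet d) 2 (volume : Measure (Sp d)), inner ℝ (M f) h
      = ∫ x, inner ℝ ((A x).toEuclideanLin (f x).snd) (h x).snd := by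
    intro f h
    refine (inner_multOp _ _ f h).trans ?_
    refine integral_congr_ae (ae_of_all _ fun x => ?_)
    simp only [inner_jetOp, inner_zero_left, zero_mul, zero_add, matOp_apply]
  let B : SpH1 d →L[ℝ] SpH1 d :=
    (SpH1 d).orthogonalProjectionOnto.comp (M.comp (SpH1 d).subtypeL)
  have hB : ∀ v w : SpH1 d, inner ℝ (B v) w = inner ℝ (M (v : Lp (Jet d) 2 _)) (w : Lp (Jet d) 2 _) :=
    fun v w => Submodule.inner_orthogonalProjectionOnto_eq_of_mem_right w _
  have h1 : ∀ v : SpH1 d, ‖spEmb d v‖ ^ 2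
      = ∫ x, ((v : Lp (Jet d) 2 (volume : Measure (Sp d))) x).fst ^ 2 := by
    intro v
    rw [norm_sq_eq_integral_norm]
    refine integral_congr_ae ?_
    filter_upwards [coeFn_spEmb v] with x hx
    rw [hx, Real.norm_eq_abs, sq_abs]
  have h2 : ∀ v : SpH1 d, ‖v‖ ^ 2
      = (∫ x, ((v : Lp (Jet d) 2 (volume : Measure (Sp d))) x).fst ^ 2)
        + ∫ x, ‖((v : Lp (Jet d) 2 (volume : Measure (Sp d))) x).snd‖ ^ 2 := fun v =>
    norm_sq_eq_integral (v : Lp (Jet d) 2 (volume : Measure (Sp d)))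
  refine ⟨B, c, ⟨hc, fun v => ?_, fun v => ?_, fun h hh => ?_⟩, fun v w => by rw [hB, hM]⟩
  · refine le_of_sq_le_sq ?_ (norm_nonneg _)
    rw [h1, h2]
    exact le_add_of_nonneg_right (integral_nonneg fun x => sq_nonneg _)
  · have hs := memLp_snd (v : Lp (Jet d) 2 (volume : Measure (Sp d)))
    rw [h1, h2, add_sub_cancel_left, hB, hM, ← integral_const_mul]
    refine integral_mono_ae ((hs.integrable_norm_pow two_ne_zero).const_mul _) ?_ ?_
    · have hAs : MemLp (fun x => matOp (A x)
          ((v : Lp (Jet d) 2 (volume : Measure (Sp d))) x).snd) 2 volume := by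
        refine MemLp.of_le_mul (c := max C 0) hs ?_ ?_
        · exact (ContinuousLinearMap.id ℝ (Sp d →L[ℝ] Sp d)).aestronglyMeasurable_comp₂ hAm' hs.1
        · filter_upwards [hK] with x hx
          exact ((matOp (A x)).le_opNorm _).trans (by gcongr)
      exact integrable_inner_of_memLp hAs hs
    · filter_upwards [hAc] with x hx
      rw [real_inner_comm]
      exact (hx _).1
  · have h0 : ∀ᵐ x, h x = 0 := by
      refine ae_eq_zero_of_integral_contDiff_smul_eq_zero
        ((Lp.memLp h).locallyIntegrable one_le_two) fun φ h1 h2 => ?_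
      have h3 : ∫ x, h x * φ x = 0 := by
        rw [← inner_spEmb_testJet h ⟨h1, h2⟩]
        exact hh _
      simp_rw [smul_eq_mul, mul_comm (φ _)]
      exact h3
    exact (Lp.eq_zero_iff_ae_eq_zero).2 h0

end DirichletForm

end MeanFlow
end

noncomputable section

namespace MeanFlow

/-! ### Well-posedness of the homogenized equation -/

section WellPosed

variable {d : ℕ} {A : Sp d → Mat d} {T : ℝ} {uin : Lp ℝ 2 (volume : Measure (Sp d))}
  {u : C(Set.Icc (0 : ℝ) T, Lp ℝ 2 (volume : Measure (Sp d)))} {B : SpH1 d →L[ℝ] SpH1 d}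

theorem continuous_atTime (hT : 0 < T) : Continuous (atTime hT u) :=
  u.continuous.comp continuous_projIcc

theorem integral_mul_eq_inner (h : Lp ℝ 2 (volume : Measure (Sp d))) {φ : Sp d → ℝ}
    (hφ : MemLp φ 2 volume) : ∫ x, h x * φ x = inner ℝ h (hφ.toLp φ) := by
  rw [L2.inner_def]
  refine integral_congr_ae ?_
  filter_upwards [hφ.coeFn_toLp] with x hx
  rw [hx, real_inner_comm]
  rfl

theorem inner_testJet (hB : ∀ v w : SpH1 d, inner ℝ (B v) w = ∫ x, inner ℝ ((A x).toEuclideanLin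
      ((v : Lp (Jet d) 2 (volume : Measure (Sp d))) x).snd)
      ((w : Lp (Jet d) 2 (volume : Measure (Sp d))) x).snd) {v : SpH1 d} {g : Sp d → Sp d}
    (hg : ∀ᵐ x, ((v : Lp (Jet d) 2 (volume : Measure (Sp d))) x).snd = g x) {φ : Sp d → ℝ}
    (hφ : IsTest φ) :
    inner ℝ (B v) (testJet φ hφ) = ∫ x, fderiv ℝ φ x ((A x).toEuclideanLin (g x)) := by
  rw [hB]
  refine integral_congr_ae ?_
  filter_upwards [hg, coeFn_testJet hφ] with x h1 h2
  rw [h1, h2, jet_snd, inner_spGrad]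

theorem isTest_slice {ψ : ℝ × Sp d → ℝ} (hψ : ContDiff ℝ ∞ ψ) (hs : HasCompactSupport ψ) (t : ℝ) :
    IsTest fun x => ψ (t, x) := by
  refine ⟨hψ.comp (contDiff_const.prodMk contDiff_id), ?_⟩
  refine HasCompactSupport.intro (hs.isCompact.image continuous_snd) fun x hx => ?_
  exact slice_eq_zero hx t

theorem fderiv_slice {ψ : ℝ × Sp d → ℝ} (hψ : Differentiable ℝ ψ) (t : ℝ) (x w : Sp d) :
    fderiv ℝ (fun x => ψ (t, x)) x w = fderiv ℝ ψ (t, x) (0, w) := by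
  have h := (hψ (t, x)).hasFDerivAt.comp x ((hasFDerivAt_const t x).prodMk (hasFDerivAt_id x))
  rw [HasFDerivAt.fderiv (f := fun x => ψ (t, x)) h]
  rfl

theorem hasDerivAt_slice {ψ : ℝ × Sp d → ℝ} (hψ : Differentiable ℝ ψ) (t : ℝ) (x : Sp d) :
    HasDerivAt (fun s => ψ (s, x)) (fderiv ℝ ψ (t, x) (1, 0)) t :=
  (hψ (t, x)).hasFDerivAt.comp_hasDerivAt t ((hasDerivAt_id t).prodMk (hasDerivAt_const t x))

/-- The space-time jet of a test function. -/
def spaceJet (ψ : ℝ × Sp d → ℝ) : ℝ × Sp d → Jet d :=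
  jet ψ fun p => WithLp.toLp 2 fun i => fderiv ℝ ψ p (0, stdVec i)

theorem continuous_spaceJet {ψ : ℝ × Sp d → ℝ} (hψ : ContDiff ℝ ∞ ψ) :
    Continuous (spaceJet ψ) := by
  refine (WithLp.prod_continuous_toLp 2 ℝ (Sp d)).comp (hψ.continuous.prodMk ?_)
  refine (PiLp.continuous_toLp 2 _).comp (continuous_pi fun i => ?_)
  exact (hψ.continuous_fderiv (by simp)).clm_apply continuous_const

theorem hasCompactSupport_spaceJet {ψ : ℝ × Sp d → ℝ} (hs : HasCompactSupport ψ) :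
    HasCompactSupport (spaceJet ψ) := by
  refine HasCompactSupport.intro hs.isCompact fun p hp => ?_
  have h1 : fderiv ℝ ψ p = 0 := fderiv_of_notMem_tsupport ℝ hp
  simp only [spaceJet, jet, image_eq_zero_of_notMem_tsupport hp, h1, _root_.zero_apply]
  rfl

theorem coe_testJet_slice {ψ : ℝ × Sp d → ℝ} (hψ : ContDiff ℝ ∞ ψ) (hs : HasCompactSupport ψ)
    (t : ℝ) : (testJet (fun x => ψ (t, x)) (isTest_slice hψ hs t) :
      Lp (Jet d) 2 (volume : Measure (Sp d)))
      = slicePath (spaceJet ψ) (continuous_spaceJet hψ) (hasCompactSupport_spaceJet hs) t := by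
  refine MemLp.toLp_congr (memLp_jet (isTest_slice hψ hs t).memLp (isTest_slice hψ hs t).memLp_spGrad)
    (HasCompactSupport.memLp_slice (continuous_spaceJet hψ) (hasCompactSupport_spaceJet hs) t)
    (ae_of_all _ fun x => ?_)
  have : spGrad (fun x => ψ (t, x)) x = WithLp.toLp 2 fun i => fderiv ℝ ψ (t, x) (0, stdVec i) := by
    ext i
    rw [spGrad_apply, pderiv, fderiv_slice (hψ.differentiable (by simp))]
  rw [jet, this]
  rfl

/-- The time derivative of a space-time function. -/
def timeDeriv (ψ : ℝ × Sp d → ℝ) (p : ℝ × Sp d) : ℝ := fderiv ℝ ψ p (1, 0)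

theorem continuous_timeDeriv {ψ : ℝ × Sp d → ℝ} (hψ : ContDiff ℝ ∞ ψ) : Continuous (timeDeriv ψ) :=
  (hψ.continuous_fderiv (by simp)).clm_apply continuous_const

theorem hasCompactSupport_timeDeriv {ψ : ℝ × Sp d → ℝ} (hs : HasCompactSupport ψ) :
    HasCompactSupport (timeDeriv ψ) := hs.fderiv_apply ℝ (1, 0)

theorem continuous_testJet_slice {ψ : ℝ × Sp d → ℝ} (hψ : ContDiff ℝ ∞ ψ)
    (hs : HasCompactSupport ψ) :
    Continuous fun t => testJet (fun x => ψ (t, x)) (isTest_slice hψ hs t) := by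
  rw [continuous_induced_rng]
  refine (continuous_slicePath (continuous_spaceJet hψ)
    (hasCompactSupport_spaceJet hs)).congr fun t => ?_
  exact (coe_testJet_slice hψ hs t).symm

theorem testJet_eq_zero {φ : Sp d → ℝ} (hφ : IsTest φ) (h : φ = fun _ => 0) :
    testJet φ hφ = 0 := by
  refine Subtype.ext (Lp.eq_zero_iff_ae_eq_zero.2 ?_)
  filter_upwards [coeFn_testJet hφ] with x hx
  have : spGrad (fun _ : Sp d => (0 : ℝ)) x = 0 := by
    ext i
    simp [pderiv]
  rw [hx, h, jet, this]
  rfl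

theorem spEmb_testJet {φ : Sp d → ℝ} (hφ : IsTest φ) :
    spEmb d (testJet φ hφ) = hφ.memLp.toLp φ := by
  refine Lp.ext ?_
  filter_upwards [coeFn_spEmb (testJet φ hφ), coeFn_testJet hφ, hφ.memLp.coeFn_toLp] with x h1 h2 h3
  rw [h1, h2, h3, jet_fst]

theorem hasDerivAt_spEmb_testJet {ψ : ℝ × Sp d → ℝ} (hψ : ContDiff ℝ ∞ ψ)
    (hs : HasCompactSupport ψ) (t : ℝ) :
    HasDerivAt (fun t => spEmb d (testJet (fun x => ψ (t, x)) (isTest_slice hψ hs t)))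
      (slicePath (timeDeriv ψ) (continuous_timeDeriv hψ) (hasCompactSupport_timeDeriv hs) t) t := by
  refine HasDerivAt.congr_of_eventuallyEq (f := slicePath ψ hψ.continuous hs)
    (hasDerivAt_slicePath hψ.continuous hs (continuous_timeDeriv hψ)
    (hasCompactSupport_timeDeriv hs)
    (fun t x => hasDerivAt_slice (hψ.differentiable (by simp)) t x) t) ?_
  exact Eventually.of_forall fun t => spEmb_testJet (isTest_slice hψ hs t)

theorem hasWeakGrad_of_rep {h : Lp ℝ 2 (volume : Measure (Sp d))} {v : SpH1 d} {g : Sp d → Sp d}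
    (h1 : spEmb d v = h)
    (h2 : ∀ᵐ x, ((v : Lp (Jet d) 2 (volume : Measure (Sp d))) x).snd = g x) :
    HasWeakGrad h g := by
  have h3 := mem_spWeakGradSpace.1 v.2
  intro φ hφ hφ' i
  have e1 : ∫ x, h x * fderiv ℝ φ x (stdVec i)
      = ∫ x, ((v : Lp (Jet d) 2 (volume : Measure (Sp d))) x).fst * fderiv ℝ φ x (stdVec i) := by
    refine integral_congr_ae ?_
    filter_upwards [coeFn_spEmb v] with x hx
    rw [← hx, h1]
  have e2 : ∫ x, g x i * φ x
      = ∫ x, ((v : Lp (Jet d) 2 (volume : Measure (Sp d))) x).snd i * φ x := by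
    refine integral_congr_ae ?_
    filter_upwards [h2] with x hx
    rw [hx]
  rw [e1, e2]
  exact h3 φ hφ hφ' i

/-- A test function ψ becomes a continuous path in H¹, differentiable in time as a path in L², which
is the class of abstract tests. The L²(0,T;H¹) solution gets a joint representative, and its
gradient component is G. -/
theorem exists_isSolution (hT : 0 < T) {c : ℝ} (hF : IsFormPair (spEmb d) B c)
    (hB : ∀ v w : SpH1 d, inner ℝ (B v) w = ∫ x, inner ℝ ((A x).toEuclideanLin
      ((v : Lp (Jet d) 2 (volume : Measure (Sp d))) x).snd)
      ((w : Lp (Jet d) 2 (volume : Measure (Sp d))) x).snd)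
    (uin : Lp ℝ 2 (volume : Measure (Sp d))) :
    ∃ u : C(Set.Icc (0 : ℝ) T, Lp ℝ 2 (volume : Measure (Sp d))), IsSolution A hT uin u := by
  obtain ⟨u, v, h0, huv, hweak⟩ := hF.exists_solution hT uin
  obtain ⟨F, hFm, hFs⟩ := exists_joint_rep (μ := (volume : Measure (Sp d)))
    ((SpH1 d).subtypeL.comp_memLp' (Lp.memLp v))
  have hGv : ∀ᵐ t ∂(volume.restrict (Set.Ioo 0 T)), ∀ᵐ x,
      ((v t : Lp (Jet d) 2 (volume : Measure (Sp d))) x).snd = (F (t, x)).snd := by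
    filter_upwards [hFs] with t ht
    filter_upwards [ht] with x hx
    rw [← hx]
    rfl
  refine ⟨u, h0, fun t x => (F (t, x)).snd, (WithLp.sndL 2 ℝ ℝ (Sp d)).comp_memLp' hFm, ?_, ?_⟩
  · filter_upwards [huv, hGv] with t h1 h2
    exact hasWeakGrad_of_rep h1 h2
  · intro ψ hψ hs hsT
    have hpT : testJet (fun x => ψ (T, x)) (isTest_slice hψ hs T) = 0 :=
      testJet_eq_zero _ (funext fun x =>
        image_eq_zero_of_notMem_tsupport fun h => lt_irrefl T (hsT h).1)
    have h1 := hweak _ _ (continuous_testJet_slice hψ hs)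
      (continuous_slicePath (continuous_timeDeriv hψ) (hasCompactSupport_timeDeriv hs))
      (hasDerivAt_spEmb_testJet hψ hs) hpT
    rw [inner_spEmb_testJet] at h1
    have e1 : ∫ t in Set.Ioo 0 T, ∫ x, atTime hT u t x * fderiv ℝ ψ (t, x) (1, 0)
        = ∫ t in Set.Ioo 0 T, inner ℝ (u (Set.projIcc 0 T hT.le t)) (slicePath (timeDeriv ψ)
          (continuous_timeDeriv hψ) (hasCompactSupport_timeDeriv hs) t) :=
      integral_congr_ae (ae_of_all _ fun t => integral_mul_eq_inner _
        (HasCompactSupport.memLp_slice (continuous_timeDeriv hψ)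
          (hasCompactSupport_timeDeriv hs) t))
    have e2 : ∫ t in Set.Ioo 0 T, ∫ x, fderiv ℝ ψ (t, x)
          (0, (A x).toEuclideanLin (F (t, x)).snd)
        = ∫ t in Set.Ioo 0 T, inner ℝ (B (v t))
          (testJet (fun x => ψ (t, x)) (isTest_slice hψ hs t)) := by
      refine integral_congr_ae ?_
      filter_upwards [hGv] with t ht
      rw [inner_testJet hB ht]
      simp_rw [fderiv_slice (hψ.differentiable (by simp))]
    rw [e1, e2]
    exact h1

theorem fderiv_mul_prod {θ : ℝ → ℝ} {φ : Sp d → ℝ} (hθ : Differentiable ℝ θ)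
    (hφ : Differentiable ℝ φ) (t : ℝ) (x : Sp d) (a : ℝ) (w : Sp d) :
    fderiv ℝ (fun p : ℝ × Sp d => θ p.1 * φ p.2) (t, x) (a, w)
      = a * deriv θ t * φ x + θ t * fderiv ℝ φ x w := by
  have h1 : HasFDerivAt (fun p : ℝ × Sp d => θ p.1) _ (t, x) :=
    (hθ t).hasFDerivAt.comp (t, x) hasFDerivAt_fst
  have h2 : HasFDerivAt (fun p : ℝ × Sp d => φ p.2) _ (t, x) :=
    (hφ x).hasFDerivAt.comp (t, x) hasFDerivAt_snd
  rw [HasFDerivAt.fderiv (f := fun p : ℝ × Sp d => θ p.1 * φ p.2) (h1.mul h2)]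
  simp
  ring

theorem exists_spH1_of_hasWeakGrad {h : Lp ℝ 2 (volume : Measure (Sp d))} {g : Sp d → Sp d}
    (hg : MemLp g 2 volume) (hw : HasWeakGrad h g) :
    ∃ f : SpH1 d, (f : Lp (Jet d) 2 (volume : Measure (Sp d))) =ᵐ[volume] jet h g := by
  have hj := memLp_jet (Lp.memLp h) hg
  refine ⟨⟨hj.toLp _, mem_spWeakGradSpace.2 fun φ hφ hφ' i => ?_⟩, hj.coeFn_toLp⟩
  have e1 : ∫ x, (hj.toLp _ x).fst * fderiv ℝ φ x (stdVec i)
      = ∫ x, h x * fderiv ℝ φ x (stdVec i) := by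
    refine integral_congr_ae ?_
    filter_upwards [fst_toLp_jet hj] with x hx
    rw [hx]
  have e2 : ∫ x, (hj.toLp _ x).snd i * φ x = ∫ x, g x i * φ x := by
    refine integral_congr_ae ?_
    filter_upwards [snd_toLp_jet hj] with x hx
    rw [hx]
  rw [e1, e2]
  exact hw φ hφ hφ' i

theorem spEmb_eq_of_jet {f : SpH1 d} {h : Lp ℝ 2 (volume : Measure (Sp d))} {g : Sp d → Sp d}
    (hf : (f : Lp (Jet d) 2 (volume : Measure (Sp d))) =ᵐ[volume] jet h g) : spEmb d f = h := by
  refine Lp.ext ?_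
  filter_upwards [coeFn_spEmb f, hf] with x h1 h2
  rw [h1, h2, jet_fst]

theorem inner_eq_of_jet {f : SpH1 d} {h : Lp ℝ 2 (volume : Measure (Sp d))} {g : Sp d → Sp d}
    (hf : (f : Lp (Jet d) 2 (volume : Measure (Sp d))) =ᵐ[volume] jet h g) (k : SpH1 d) :
    inner ℝ k f = inner ℝ (spEmb d k) h
      + ∫ x, inner ℝ ((k : Lp (Jet d) 2 (volume : Measure (Sp d))) x).snd (g x) := by
  rw [Submodule.coe_inner, inner_eq_integral, L2.inner_def]
  congr 1
  · refine integral_congr_ae ?_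
    filter_upwards [coeFn_spEmb k, hf] with x h5 h6
    rw [h5, h6, real_inner_comm]
    rfl
  · refine integral_congr_ae ?_
    filter_upwards [hf] with x hx
    rw [hx, jet_snd]

theorem norm_sq_eq_of_jet {f : SpH1 d} {h : Lp ℝ 2 (volume : Measure (Sp d))} {g : Sp d → Sp d}
    (hf : (f : Lp (Jet d) 2 (volume : Measure (Sp d))) =ᵐ[volume] jet h g) :
    ‖f‖ ^ 2 = ‖h‖ ^ 2 + ∫ x, ‖g x‖ ^ 2 := by
  have h5 : ‖f‖ ^ 2 = _ :=
    norm_sq_eq_integral (f : Lp (Jet d) 2 (volume : Measure (Sp d)))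
  rw [h5, norm_sq_eq_integral_norm]
  congr 1
  · refine integral_congr_ae ?_
    filter_upwards [hf] with x hx
    rw [hx, jet_fst, Real.norm_eq_abs, sq_abs]
  · refine integral_congr_ae ?_
    filter_upwards [hf] with x hx
    rw [hx, jet_snd]

theorem memLp_of_jet {h : ℝ → Lp ℝ 2 (volume : Measure (Sp d))} (hh : Continuous h)
    {G : ℝ → Sp d → Sp d} (hG : MemLp (fun p : ℝ × Sp d => G p.1 p.2) 2
      ((volume.restrict (Set.Ioo 0 T)).prod volume)) {v : ℝ → SpH1 d}
    (hv : ∀ᵐ t ∂(volume.restrict (Set.Ioo 0 T)),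
      (v t : Lp (Jet d) 2 (volume : Measure (Sp d))) =ᵐ[volume] jet (h t) (G t)) :
    MemLp v 2 (volume.restrict (Set.Ioo 0 T)) := by
  have hm : AEStronglyMeasurable v (volume.restrict (Set.Ioo 0 T)) := by
    refine aestronglyMeasurable_of_inner fun k => ?_
    have h1 : AEStronglyMeasurable (fun z : ℝ × Sp d => inner ℝ
        ((k : Lp (Jet d) 2 (volume : Measure (Sp d))) z.2).snd (G z.1 z.2))
        ((volume.restrict (Set.Ioo 0 T)).prod volume) :=
      ((memLp_snd (k : Lp (Jet d) 2 (volume : Measure (Sp d)))).1.comp_snd).inner hG.1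
    have h2 : AEStronglyMeasurable (fun t => inner ℝ (spEmb d k) (h t))
        (volume.restrict (Set.Ioo 0 T)) :=
      (continuous_const.inner hh).aestronglyMeasurable
    refine (h2.add h1.integral_prod_right').congr ?_
    filter_upwards [hv] with t h3
    exact (inner_eq_of_jet h3 k).symm
  rw [memLp_two_iff_integrable_sq_norm hm]
  have i1 : Integrable (fun t => ‖h t‖ ^ 2) (volume.restrict (Set.Ioo 0 T)) :=
    (memLp_Ioo_of_continuous hh T).integrable_norm_pow two_ne_zero
  have i2 : Integrable (fun p : ℝ × Sp d => ‖G p.1 p.2‖ ^ 2)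
      ((volume.restrict (Set.Ioo 0 T)).prod volume) := hG.integrable_norm_pow two_ne_zero
  refine (i1.add i2.integral_prod_left).congr ?_
  filter_upwards [hv] with t h3
  exact (norm_sq_eq_of_jet h3).symm

theorem tsupport_mul_prod_subset (θ : ℝ → ℝ) (φ : Sp d → ℝ) :
    tsupport (fun p : ℝ × Sp d => θ p.1 * φ p.2) ⊆ tsupport θ ×ˢ tsupport φ := by
  refine closure_minimal (fun p hp => ?_) ((isClosed_tsupport θ).prod (isClosed_tsupport φ))
  exact ⟨subset_tsupport θ fun h => hp (by simp only [h, zero_mul]),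
    subset_tsupport φ fun h => hp (by simp only [h, mul_zero])⟩

theorem weak_separated (hT : 0 < T) {G : ℝ → Sp d → Sp d}
    (hweak : ∀ ψ : ℝ × Sp d → ℝ, ContDiff ℝ ∞ ψ → HasCompactSupport ψ →
      tsupport ψ ⊆ Set.Iio T ×ˢ Set.univ →
      - (∫ t in Set.Ioo 0 T, ∫ x, atTime hT u t x * fderiv ℝ ψ (t, x) (1, 0))
        + (∫ t in Set.Ioo 0 T, ∫ x, fderiv ℝ ψ (t, x) (0, (A x).toEuclideanLin (G t x)))
        - (∫ x, uin x * ψ (0, x)) = 0)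
    {φ : Sp d → ℝ} (hφ : IsTest φ) {θ : ℝ → ℝ} (hθ : IsTimeTest T θ) :
    -(∫ t in Set.Ioo 0 T, deriv θ t * ∫ x, atTime hT u t x * φ x)
      + (∫ t in Set.Ioo 0 T, θ t * ∫ x, fderiv ℝ φ x ((A x).toEuclideanLin (G t x)))
      - θ 0 * ∫ x, uin x * φ x = 0 := by
  have hts := tsupport_mul_prod_subset θ φ
  have h1 := hweak (fun p => θ p.1 * φ p.2)
    ((hθ.1.comp contDiff_fst).mul (hφ.1.comp contDiff_snd))
    (IsCompact.of_isClosed_subset (hθ.2.1.isCompact.prod hφ.2.isCompact)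
      (isClosed_tsupport _) hts)
    (hts.trans (Set.prod_mono hθ.2.2 (Set.subset_univ _)))
  simp only [fderiv_mul_prod (hθ.1.differentiable (by simp)) hφ.differentiable, map_zero, mul_zero,
    add_zero, one_mul, zero_mul, zero_add] at h1
  simp only [← integral_const_mul]
  simpa only [mul_left_comm] using h1

theorem IsSolution.exists_path (hT : 0 < T)
    (hB : ∀ v w : SpH1 d, inner ℝ (B v) w = ∫ x, inner ℝ ((A x).toEuclideanLin
      ((v : Lp (Jet d) 2 (volume : Measure (Sp d))) x).snd)
      ((w : Lp (Jet d) 2 (volume : Measure (Sp d))) x).snd) (hu : IsSolution A hT uin u) :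
    ∃ v : ℝ → SpH1 d, MemLp v 2 (volume.restrict (Set.Ioo 0 T)) ∧
      (∀ᵐ t ∂(volume.restrict (Set.Ioo 0 T)), spEmb d (v t) = atTime hT u t) ∧
      ∀ φ (hφ : IsTest φ) (θ : ℝ → ℝ), IsTimeTest T θ →
        -(∫ t in Set.Ioo 0 T, deriv θ t * inner ℝ (atTime hT u t) (spEmb d (testJet φ hφ)))
          + (∫ t in Set.Ioo 0 T, θ t * inner ℝ (B (v t)) (testJet φ hφ))
          - θ 0 * inner ℝ uin (spEmb d (testJet φ hφ)) = 0 := by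
  obtain ⟨-, G, hG, hgrad, hweak⟩ := hu
  -- An element of H¹ is picked at each time, with default 0 at the exceptional times; measurability
  -- of the resulting path comes afterwards from `memLp_of_jet`.
  have hex : ∀ t, ∃ f : SpH1 d, MemLp (G t) 2 volume → HasWeakGrad (atTime hT u t) (G t) →
      (f : Lp (Jet d) 2 (volume : Measure (Sp d))) =ᵐ[volume] jet (atTime hT u t) (G t) := by
    intro t
    by_cases h : MemLp (G t) 2 volume ∧ HasWeakGrad (atTime hT u t) (G t)
    · obtain ⟨f, hf⟩ := exists_spH1_of_hasWeakGrad h.1 h.2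
      exact ⟨f, fun _ _ => hf⟩
    · exact ⟨0, fun h1 h2 => absurd ⟨h1, h2⟩ h⟩
  choose v hv using hex
  have hvt : ∀ᵐ t ∂(volume.restrict (Set.Ioo 0 T)),
      (v t : Lp (Jet d) 2 (volume : Measure (Sp d))) =ᵐ[volume] jet (atTime hT u t) (G t) := by
    filter_upwards [MemLp.ae_memLp_slice hG, hgrad] with t h1 h2
    exact hv t h1 h2
  refine ⟨v, memLp_of_jet (continuous_atTime hT) hG hvt, ?_, fun φ hφ θ hθ => ?_⟩
  · filter_upwards [hvt] with t ht
    exact spEmb_eq_of_jet ht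
  · have h1 := weak_separated hT hweak hφ hθ
    have e : ∫ t in Set.Ioo 0 T, θ t * inner ℝ (B (v t)) (testJet φ hφ)
        = ∫ t in Set.Ioo 0 T, θ t * ∫ x, fderiv ℝ φ x ((A x).toEuclideanLin (G t x)) := by
      refine integral_congr_ae ?_
      filter_upwards [hvt] with t ht
      rw [inner_testJet hB (g := G t) (by
        filter_upwards [ht] with x hx
        rw [hx, jet_snd])]
    simp only [inner_spEmb_testJet]
    rw [e]
    exact h1

/-- In the difference of two solutions the initial terms cancel, leaving the homogeneous weak
equation. Separated tests θ(t)φ(x) suffice, since test jets are dense in H¹. -/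
theorem isSolution_unique (hT : 0 < T) {c : ℝ} (hF : IsFormPair (spEmb d) B c)
    (hB : ∀ v w : SpH1 d, inner ℝ (B v) w = ∫ x, inner ℝ ((A x).toEuclideanLin
      ((v : Lp (Jet d) 2 (volume : Measure (Sp d))) x).snd)
      ((w : Lp (Jet d) 2 (volume : Measure (Sp d))) x).snd)
    {u₁ u₂ : C(Set.Icc (0 : ℝ) T, Lp ℝ 2 (volume : Measure (Sp d)))}
    (h₁ : IsSolution A hT uin u₁) (h₂ : IsSolution A hT uin u₂) : u₁ = u₂ := by
  obtain ⟨v₁, hm₁, he₁, hw₁⟩ := h₁.exists_path hT hB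
  obtain ⟨v₂, hm₂, he₂, hw₂⟩ := h₂.exists_path hT hB
  have hi : ∀ {v : ℝ → SpH1 d} {θ : ℝ → ℝ} (φ : SpH1 d),
      MemLp v 2 (volume.restrict (Set.Ioo 0 T)) → Continuous θ →
      Integrable (fun t => θ t * inner ℝ (B (v t)) φ) (volume.restrict (Set.Ioo 0 T)) :=
    fun φ hv hθ => integrable_mul_of_memLp (memLp_Ioo_of_continuous hθ T)
      (((innerSL ℝ φ).comp B).comp_memLp' hv |>.congr_norm
        (((B.comp_memLp' hv).1.inner aestronglyMeasurable_const))
        (ae_of_all _ fun t => by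
          simp [real_inner_comm]))
  have h0 := hF.eq_zero_of_weak hT (u := fun t => atTime hT u₁ t - atTime hT u₂ t)
    ((continuous_atTime hT).sub (continuous_atTime hT)) (hm₁.sub hm₂)
    (by
      filter_upwards [he₁, he₂] with t a1 a2
      rw [Pi.sub_apply, map_sub, a1, a2]) dense_testJet (by
      rintro _ ⟨φ, hφ, rfl⟩ θ hθ
      have a1 := hw₁ φ hφ θ hθ
      have a2 := hw₂ φ hφ θ hθ
      have hc : Continuous θ := hθ.1.continuous
      have hc' : Continuous (deriv θ) := hθ.1.continuous_deriv (by simp)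
      have i1 : ∀ u : C(Set.Icc (0 : ℝ) T, Lp ℝ 2 (volume : Measure (Sp d))),
          Integrable (fun t => deriv θ t * inner ℝ (atTime hT u t) (spEmb d (testJet φ hφ)))
            (volume.restrict (Set.Ioo 0 T)) := fun u =>
        (memLp_Ioo_of_continuous (hc'.mul ((continuous_atTime hT).inner continuous_const))
          T).integrable one_le_two
      simp only [Pi.sub_apply, map_sub, inner_sub_left, mul_sub]
      rw [integral_sub (i1 _) (i1 _), integral_sub (hi _ hm₁ hc) (hi _ hm₂ hc)]
      linarith)
  ext1 t
  have := sub_eq_zero.1 (h0 t t.2)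
  simpa only [atTime, Set.projIcc_val] using this

/-- The homogenized Cauchy problem is well posed. -/
theorem existsUnique_isSolution (hA : IsBoundedCoercive A) (hT : 0 < T)
    (uin : Lp ℝ 2 (volume : Measure (Sp d))) :
    ∃! u : C(Set.Icc (0 : ℝ) T, Lp ℝ 2 (volume : Measure (Sp d))), IsSolution A hT uin u := by
  obtain ⟨B, c, hF, hB⟩ := exists_isFormPair hA
  obtain ⟨u, hu⟩ := exists_isSolution hT hF hB uin
  exact ⟨u, hu, fun u' hu' => isSolution_unique hT hF hB hu' hu⟩

end WellPosed

end MeanFlow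
end

theorem mainTheorem6 {d : ℕ}
    (b : MeanFlow.Sp d → MeanFlow.Tor d → MeanFlow.Sp d)
    (D : MeanFlow.Sp d → MeanFlow.Tor d → MeanFlow.Mat d)
    (Φ : ℝ → MeanFlow.Sp d → MeanFlow.Sp d)
    -- the fluid field: measurable, incompressible, bounded fluctuation, `C¹` mean
    (hb_meas : AEStronglyMeasurable (fun p : MeanFlow.Sp d × MeanFlow.Tor d => b p.1 p.2) volume)
    (hb_bdd : ∃ M : ℝ, ∀ᵐ p : MeanFlow.Sp d × MeanFlow.Tor d,
      ‖b p.1 p.2 - MeanFlow.meanField b p.1‖ ≤ M)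
    (hb_mean : ContDiff ℝ 1 (MeanFlow.meanField b))
    (hb_divx : MeanFlow.DivFreeX b)
    (hb_divy : MeanFlow.DivFreeY b)
    -- the molecular diffusion: measurable, symmetric, bounded and uniformly coercive
    (hD_meas : ∀ i j,
      AEMeasurable (fun p : MeanFlow.Sp d × MeanFlow.Tor d => D p.1 p.2 i j) volume)
    (hD_symm : ∀ᵐ p : MeanFlow.Sp d × MeanFlow.Tor d, (D p.1 p.2).IsSymm)
    (hD_coer : ∃ lam Lam : ℝ, 0 < lam ∧ 0 < Lam ∧
      ∀ᵐ p : MeanFlow.Sp d × MeanFlow.Tor d, ∀ ξ : MeanFlow.Sp d,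
        lam * ‖ξ‖ ^ 2 ≤ inner ℝ ξ ((D p.1 p.2).toEuclideanLin ξ) ∧
        inner ℝ ξ ((D p.1 p.2).toEuclideanLin ξ) ≤ Lam * ‖ξ‖ ^ 2)
    -- the flow of the mean field, with uniformly bounded Jacobian
    (hΦ : MeanFlow.IsFlowOf (MeanFlow.meanField b) Φ)
    (hJ : ∃ C : ℝ, ∀ (τ : ℝ) (x : MeanFlow.Sp d) (i j : Fin d), |MeanFlow.jacobian Φ τ x i j| ≤ C)
    -- the limits that define the effective diffusion exist and are finite
    (hlim : ∀ᵐ X : MeanFlow.Sp d, ∀ i j : Fin d, ∃ L : ℝ,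
      Tendsto (MeanFlow.fastTimeAverage b D Φ X i j) atTop (𝓝 L)) :
    MeanFlow.IsBoundedCoercive (MeanFlow.effectiveDiffusion b D Φ) ∧
    ∀ (T : ℝ) (hT : 0 < T) (uin : Lp ℝ 2 (volume : Measure (MeanFlow.Sp d))),
      ∃! u : C(Set.Icc (0 : ℝ) T, Lp ℝ 2 (volume : Measure (MeanFlow.Sp d))),
        MeanFlow.IsSolution (MeanFlow.effectiveDiffusion b D Φ) hT uin u := by
  obtain ⟨hQm, lam, R, hlam, hQ⟩ := MeanFlow.exists_cellMatrix_bounds b D hb_meas hb_bdd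
    hb_mean.continuous hb_divy hD_meas hD_symm hD_coer
  obtain ⟨C, hC⟩ := hJ
  have hA : MeanFlow.IsBoundedCoercive (MeanFlow.effectiveDiffusion b D Φ) := by
    refine MeanFlow.isBoundedCoercive_average (C := max C 0)
      (Q := fun x => MeanFlow.cellMatrix (b x) (D x)) hΦ hb_mean
      (fun τ x i j => (hC τ x i j).trans (le_max_left _ _)) (le_max_right _ _) hQm hlam hQ ?_
    filter_upwards [hlim] with X hX i j
    obtain ⟨L, hL⟩ := hX i j
    -- `limUnder` is a junk value unless the limit exists; on the full-measure set where it does, it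
    -- is the limit.
    have h : MeanFlow.effectiveDiffusion b D Φ X i j = L := hL.limUnder_eq
    rw [h]
    exact hL
  exact ⟨hA, fun T hT uin => MeanFlow.existsUnique_isSolution hA hT uin⟩
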